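/- Let $f\in C^2([0,\infty),\mathbb R)$ and consider the complex Klein–Gordon equation $$u_{tt}-u_{xx}+f(|u|^2)u=0,\qquad u(x,t)\in\mathbb C .\tag{KG}$$ For $a>0$, a function $\theta_\infty\in C^1(\mathbb R,\mathbb R)$ is called $a$-admissible if $\theta_\infty'\in H^1(\mathbb R)$ and either (i) $f(a^2)>0$, or (ii) $f(a^2)\le 0$ and $\theta_\infty'\in L^1(\mathbb R)$. In this case put $E_\infty=\|\theta_\infty'\|_{L^2(\mathbb R)}$ in case (i) and $E_\infty=\|\theta_\infty'\|_{L^2(\mathbb R)}+\|\theta_\infty'\|_{L^1(\mathbb R)}^{1/2}$ in case (ii). **Theorem.** Let $a>0$ and $(k,\omega)\in\mathbb R^2\setminus\{(0,0)\}$ satisfy $$\omega^2=k^2+f(a^2),\qquad a^2f'(a^2)>2\max\{0,-f(a^2)\},$$ and let $R>0$. Then there exist constants $C,\delta>0$ (depending only on $f,a,k,\omega,R$) such that the following holds for every $a$-admissible $\theta_\infty\in C^1(\mathbb R,\mathbb R)$ with $E_\infty\le\delta$ and all complex-valued $(w_0,v_0)\in H^2(\mathbb R)\times H^1(\mathbb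 R)$ with $E_0:=\|w_0\|_{H^1(\mathbb R)}+\|v_0\|_{L^2(\mathbb R)}\le\delta$. There exists a unique global classical solution $$u\in C([0,\infty),H^2_{\mathrm{loc}}(\mathbb R))\cap C^1([0,\infty),H^1_{\mathrm{loc}}(\mathbb R))\cap C^2([0,\infty),L^2_{\mathrm{loc}}(\mathbb R))$$ of (KG), the equation holding in $L^2_{\mathrm{loc}}(\mathbb R)$ for every $t\ge0$, with initial data $$u(x,0)=a e^{ikx-i\theta_\infty(x)}+w_0(x),\qquad u_t(x,0)=i\omega\, a e^{ikx-i\theta_\infty(x)}+v_0(x).$$ Furthermore: - (Local orbital stability) For every $x_*\in\mathbb R$ and $t\ge0$ there is $\gamma=\gamma(x_*,t)\in\mathbb R$ such that $$\big\|u(t)-a e^{ik(\cdot)+i\omega t+i\gamma}\big\|_{H^1(x_*-R,x_*+R)}\le C(E_0+E_\infty).$$ - (Bounds on phase and radius) There exist $\varrho,\vartheta\in C^1(\mathbb R\times[0,\infty),\mathbb R)$ with $\varrho(t),\vartheta(t)\in H^1(\mathbb R)$ and $\varrho_t(t),\vartheta_t(t)\in L^2(\mathbb R)$ for all $t\ge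 0$ such that $$u(x,t)=a e^{ikx+i\omega t-i\theta_\infty(x)}\,e^{\varrho(x,t)+i\vartheta(x,t)}\qquad(x\in\mathbb R,\ t\ge0),$$ and, for all $t\ge0$, $$\|\varrho_t(t)\|_{L^2(\mathbb R)}+\|\vartheta_t(t)\|_{L^2(\mathbb R)}+\|\varrho(t)\|_{H^1(\mathbb R)}+\|\vartheta_x(t)\|_{L^2(\mathbb R)}\le C(E_0+E_\infty),$$ $$\|\vartheta(t)\|_{L^2(\mathbb R)}\le C(E_0+E_\infty)(1+t).$$ -/

import Mathlib

open MeasureTheory Filter Topology Set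
open scoped ENNReal NNReal

noncomputable section

namespace KleinGordon

variable {E : Type*} [NormedAddCommGroup E] [NormedSpace ℝ E]

/-- `g` is a weak derivative of `w` on the open set `Ω ⊆ ℝ`: both are locally integrable on `Ω`
and `∫ φ' w = - ∫ φ g` for all smooth `φ` with compact support in `Ω`. -/
def HasWeakDerivOn (Ω : Set ℝ) (w g : ℝ → E) : Prop :=
  LocallyIntegrableOn w Ω volume ∧ LocallyIntegrableOn g Ω volume ∧
    ∀ φ : ℝ → ℝ, ContDiff ℝ (⊤ : ℕ∞) φ → HasCompactSupport φ → tsupport φ ⊆ Ω →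
      ∫ x, deriv φ x • w x = -∫ x, φ x • g x

/-- `w ∈ H^m(Ω)`: `w` and its weak derivatives up to order `m` are in `L²(Ω)`. -/
def MemH : ℕ → Set ℝ → (ℝ → E) → Prop
  | 0, Ω, w => MemLp w 2 (volume.restrict Ω)
  | m + 1, Ω, w => MemLp w 2 (volume.restrict Ω) ∧ ∃ g, HasWeakDerivOn Ω w g ∧ MemH m Ω g

/-- The square of the `H^m(Ω)`-norm, `∑_{j ≤ m} ‖∂ₓʲ w‖²_{L²(Ω)}`. Weak derivatives are unique
almost everywhere, so the infimum only selects the weak derivative; it is `∞` if there is none. -/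
def hNormSq : ℕ → Set ℝ → (ℝ → E) → ℝ≥0∞
  | 0, Ω, w => eLpNorm w 2 (volume.restrict Ω) ^ 2
  | m + 1, Ω, w => eLpNorm w 2 (volume.restrict Ω) ^ 2 +
      ⨅ (g : ℝ → E) (_ : HasWeakDerivOn Ω w g), hNormSq m Ω g

/-- The `H^m(Ω)`-norm. -/
def hNorm (m : ℕ) (Ω : Set ℝ) (w : ℝ → E) : ℝ≥0∞ :=
  hNormSq m Ω w ^ (1 / 2 : ℝ)

/-- `w ∈ H^m_loc(ℝ)`. -/
def MemHLoc (m : ℕ) (w : ℝ → E) : Prop :=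
  ∀ r : ℝ, 0 < r → MemH m (Ioo (-r) r) w

/-- `U ∈ C([0,∞), H^m_loc(ℝ))`, where `U t` is the spatial profile at time `t` and `H^m_loc(ℝ)`
is the Fréchet space with the seminorms `‖·‖_{H^m(-r,r)}`, `r > 0`. -/
def ContHLoc (m : ℕ) (U : ℝ → ℝ → E) : Prop :=
  (∀ t, 0 ≤ t → MemHLoc m (U t)) ∧
    ∀ t₀, 0 ≤ t₀ → ∀ r : ℝ, 0 < r →
      Tendsto (fun t => hNorm m (Ioo (-r) r) (fun x => U t x - U t₀ x)) (𝓝[Ici 0] t₀) (𝓝 0)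

/-- `V` is the derivative of `U : [0,∞) → H^m_loc(ℝ)` (one-sided at time `0`). -/
def HasTimeDerivHLoc (m : ℕ) (U V : ℝ → ℝ → E) : Prop :=
  (∀ t, 0 ≤ t → MemHLoc m (V t)) ∧
    ∀ t₀, 0 ≤ t₀ → ∀ r : ℝ, 0 < r →
      Tendsto
        (fun t => hNorm m (Ioo (-r) r) (fun x => (t - t₀)⁻¹ • (U t x - U t₀ x) - V t₀ x))
        (𝓝[Ici 0 \ {t₀}] t₀) (𝓝 0)

/-- `U ∈ C^j([0,∞), H^m_loc(ℝ))`. -/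
def ContDiffHLoc : ℕ → ℕ → (ℝ → ℝ → E) → Prop
  | 0, m, U => ContHLoc m U
  | j + 1, m, U => ContHLoc m U ∧ ∃ V, HasTimeDerivHLoc m U V ∧ ContDiffHLoc j m V

/-- `u` is a global classical solution of `u_tt - u_xx + f(|u|²) u = 0` with `u(0) = u₀` and
`u_t(0) = u₁`: it lies in `C([0,∞), H²_loc) ∩ C¹([0,∞), H¹_loc) ∩ C²([0,∞), L²_loc)` and the
equation holds in `L²_loc(ℝ)` at every time `t ≥ 0`. -/
def IsClassicalSolution (f : ℝ → ℝ) (u₀ u₁ : ℝ → ℂ) (u : ℝ → ℝ → ℂ) : Prop :=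
  ContDiffHLoc 0 2 u ∧ ContDiffHLoc 1 1 u ∧ ContDiffHLoc 2 0 u ∧
    ∃ ut utt : ℝ → ℝ → ℂ, HasTimeDerivHLoc 1 u ut ∧ HasTimeDerivHLoc 0 ut utt ∧
      (∀ t, 0 ≤ t → ∃ ux uxx : ℝ → ℂ,
        HasWeakDerivOn univ (u t) ux ∧ HasWeakDerivOn univ ux uxx ∧
          ∀ᵐ x : ℝ, utt t x - uxx x + (f (‖u t x‖ ^ 2) : ℂ) * u t x = 0) ∧
      u 0 =ᵐ[volume] u₀ ∧ ut 0 =ᵐ[volume] u₁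

/-- `θ ∈ C¹(ℝ,ℝ)` is `a`-admissible (for the nonlinearity `f`). -/
def Admissible (f : ℝ → ℝ) (a : ℝ) (θ : ℝ → ℝ) : Prop :=
  ContDiff ℝ 1 θ ∧ MemH 1 univ (deriv θ) ∧
    (0 < f (a ^ 2) ∨ f (a ^ 2) ≤ 0 ∧ MemLp (deriv θ) 1 volume)

open Classical in
/-- The size `E_∞` of an `a`-admissible phase modulation. -/
def phaseSize (f : ℝ → ℝ) (a : ℝ) (θ : ℝ → ℝ) : ℝ≥0∞ :=
  eLpNorm (deriv θ) 2 volume +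
    if 0 < f (a ^ 2) then 0 else eLpNorm (deriv θ) 1 volume ^ (1 / 2 : ℝ)

/-- The size `E_0 = ‖w₀‖_{H¹(ℝ)} + ‖v₀‖_{L²(ℝ)}` of the localized perturbation. -/
def dataSize (w₀ v₀ : ℝ → ℂ) : ℝ≥0∞ :=
  hNorm 1 univ w₀ + eLpNorm v₀ 2 volume

end KleinGordon

end

open KleinGordon

/-! The proof is an energy method in variables that do not see the phase. Put p = u_t + u_x, q = u_t
- u_x, s = |u|²/a², P = p/u - i(ω+k), Q = q/u - i(ω-k). The triple (P, Q, s-1) vanishes exactly on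
the waves a·e^{ikx+iωt+iγ}. A modulation θ therefore enters the initial size only through θ' in L²,
although θ itself may be unbounded, and smallness in these variables means local closeness to the
orbit.

There are densities Y(s,P) and Z(s,Q) with (∂_t-∂_x)Y = S and (∂_t+∂_x)Z = -S for the same source S
(`hasDerivAt_density`, `densitySource_swap`), so Y+Z is conserved. Up to constants, a²(Y+Z) is a
combination of the densities of energy, momentum and charge and of the phase derivative Im(u_x/u);
the cross term κ(s-1)·Im P with κ = k+αω is what absorbs the parts that are not conserved. The free
parameter α, the weight of the momentum, makes both forms positive definite near s = 1 exactly when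
2κ² < (1-α²)a²f'(a²), and the spectral condition provides such an α (`exists_moment`,
`exists_density_bounds`). As Y, Z ≥ 0, energy cannot enter a backward light cone
(`integral_cone_le`), so all estimates are local. A Sobolev inequality turns the energy bound into a
pointwise bound on s-1, and a continuity argument closes the estimate for all times
(`exists_stability`).

For existence, f is cut off outside a neighbourhood of a², so that the nonlinearity is bounded and
globally Lipschitz; Picard iteration gives a global solution, and stability shows that the cut-off
is never felt on t ≥ 0 (`exists_stable_wave`). Regularity comes from differentiating the d'Alembert
formula along characteristics. For uniqueness the difference of two solutions is mollified in x,
estimated along characteristics, and halved repeatedly on slowly shrinking cones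
(`IsClassicalSolution.ae_eq`).

Radius and phase are the real and imaginary parts of a complex logarithm z of u over the modulated
wave, obtained by integrating u_t/u - iω in time from the principal logarithm at t = 0
(`IsWave.exists_polar`). Its derivatives are P, Q and θ', hence bounded by the energy, except that
the L² norm of the phase is recovered by integration in time and so may grow linearly
(`IsWave.polar_bounds`). Orbital stability follows by taking γ to be the phase defect at the centre
of the interval (`IsWave.orbital_bound`). -/

namespace KleinGordon

/-! ### Absolutely continuous functions as indefinite integrals. -/

section Primitive

variable {E : Type*} [NormedAddCommGroup E] [NormedSpace ℝ E]

/-- `w` is an indefinite integral of the locally integrable function `g`. -/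
structure IsPrimitive (w g : ℝ → E) : Prop where
  loc : LocallyIntegrable g volume
  eq : ∀ x, w x = w 0 + ∫ y in (0 : ℝ)..x, g y

omit [NormedSpace ℝ E] in
theorem _root_.MeasureTheory.LocallyIntegrable.intervalIntegrable' {g : ℝ → E}
    (hg : LocallyIntegrable g volume) (a b : ℝ) : IntervalIntegrable g volume a b :=
  (hg.integrableOn_isCompact isCompact_uIcc).intervalIntegrable

namespace IsPrimitive

variable {w w₁ w₂ g g₁ g₂ : ℝ → E}

theorem sub_eq (h : IsPrimitive w g) (a b : ℝ) : w b - w a = ∫ y in a..b, g y := by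
  rw [h.eq a, h.eq b, add_sub_add_left_eq_sub,
    intervalIntegral.integral_interval_sub_left (h.loc.intervalIntegrable' _ _)
      (h.loc.intervalIntegrable' _ _)]

theorem of_sub_eq (hg : LocallyIntegrable g volume)
    (h : ∀ a b, w b - w a = ∫ y in a..b, g y) : IsPrimitive w g :=
  ⟨hg, fun x => by rw [← h 0 x]; abel⟩

theorem continuous (h : IsPrimitive w g) : Continuous w := by
  have : w = fun x => w 0 + ∫ y in (0 : ℝ)..x, g y := funext h.eq
  rw [this]
  exact continuous_const.add
    (intervalIntegral.continuous_primitive (fun a b => h.loc.intervalIntegrable' a b) 0)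

theorem add (h₁ : IsPrimitive w₁ g₁) (h₂ : IsPrimitive w₂ g₂) :
    IsPrimitive (fun x => w₁ x + w₂ x) (fun x => g₁ x + g₂ x) := by
  refine of_sub_eq (h₁.loc.add h₂.loc) fun a b => ?_
  rw [intervalIntegral.integral_add (h₁.loc.intervalIntegrable' _ _)
    (h₂.loc.intervalIntegrable' _ _), ← h₁.sub_eq, ← h₂.sub_eq]
  abel

theorem sub (h₁ : IsPrimitive w₁ g₁) (h₂ : IsPrimitive w₂ g₂) :
    IsPrimitive (fun x => w₁ x - w₂ x) (fun x => g₁ x - g₂ x) := by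
  refine of_sub_eq (h₁.loc.sub h₂.loc) fun a b => ?_
  rw [intervalIntegral.integral_sub (h₁.loc.intervalIntegrable' _ _)
    (h₂.loc.intervalIntegrable' _ _), ← h₁.sub_eq, ← h₂.sub_eq]
  abel

theorem clm {F : Type*} [NormedAddCommGroup F] [NormedSpace ℝ F] [CompleteSpace E]
    [CompleteSpace F] (L : E →L[ℝ] F)
    (h : IsPrimitive w g) : IsPrimitive (fun x => L (w x)) (fun x => L (g x)) := by
  refine of_sub_eq (fun x => ?_) fun a b => ?_
  · obtain ⟨s, hs, hi⟩ := h.loc x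
    exact ⟨s, hs, L.integrable_comp hi⟩
  · rw [L.intervalIntegral_comp_comm (h.loc.intervalIntegrable' _ _), ← h.sub_eq, map_sub]

theorem comp_add (h : IsPrimitive w g) (c : ℝ) :
    IsPrimitive (fun x => w (x + c)) (fun x => g (x + c)) := by
  refine of_sub_eq ?_ fun a b => ?_
  · rw [locallyIntegrable_iff]
    intro K hK
    have h2 := h.loc.integrableOn_isCompact
      (hK.image (by fun_prop : Continuous fun x : ℝ => x + c))
    have e : MeasurePreserving (fun x : ℝ => x + c) volume volume :=
      measurePreserving_add_right volume c
    have h3 := (e.integrableOn_image (f := g) (s := K) (measurableEmbedding_addRight c)).1 h2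
    exact h3
  · rw [intervalIntegral.integral_comp_add_right, h.sub_eq]

theorem of_hasDerivAt [CompleteSpace E] (hd : ∀ x, HasDerivAt w (g x) x) (hg : Continuous g) :
    IsPrimitive w g :=
  of_sub_eq hg.locallyIntegrable fun a b =>
    (intervalIntegral.integral_eq_sub_of_hasDerivAt (fun x _ => hd x)
      (hg.intervalIntegrable a b)).symm

theorem hasDerivAt [CompleteSpace E] (h : IsPrimitive w g) (hg : Continuous g) (x : ℝ) :
    HasDerivAt w (g x) x := by
  have : w = fun x => w 0 + ∫ y in (0 : ℝ)..x, g y := funext h.eq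
  rw [this]
  exact (hg.integral_hasStrictDerivAt 0 x).hasDerivAt.const_add _

/-- Integration by parts for absolutely continuous functions: an indefinite integral is absolutely
continuous and its classical derivative is the integrand almost everywhere. -/
theorem mul_real {v w v' g : ℝ → ℝ} (hv : IsPrimitive v v') (hw : IsPrimitive w g) (a b : ℝ) :
    v b * w b - v a * w a = ∫ y in a..b, (v' y * w y + v y * g y) := by
  have ac : ∀ {v v' : ℝ → ℝ}, IsPrimitive v v' → AbsolutelyContinuousOnInterval v a b := by
    intro v v' hv
    have h1 : v = fun x => v a + ∫ y in a..x, v' y := by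
      funext x; rw [← hv.sub_eq]; ring
    have h2 := (hv.loc.intervalIntegrable' a b).absolutelyContinuousOnInterval_intervalIntegral
      (c := a) (by simp)
    have h3 : AbsolutelyContinuousOnInterval (fun _ : ℝ => v a) a b :=
      (contDiff_const.contDiffOn (n := 1)).absolutelyContinuousOnInterval
    rw [h1]
    exact h3.add h2
  have hd : ∀ {v v' : ℝ → ℝ}, IsPrimitive v v' → ∀ᵐ x, deriv v x = v' x := by
    intro v v' hv
    filter_upwards [LocallyIntegrable.ae_hasDerivAt_integral hv.loc] with x hx
    have h1 : v = fun x => v 0 + ∫ y in (0 : ℝ)..x, v' y := funext hv.eq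
    rw [h1]
    exact ((hx 0).const_add _).deriv
  rw [← (ac hv).integral_deriv_mul_eq_sub (ac hw)]
  apply intervalIntegral.integral_congr_ae
  filter_upwards [hd hv, hd hw] with x h1 h2 _
  rw [h1, h2]

/-- The product rule for vector values follows from the scalar one by testing with continuous linear
functionals, which separate points. -/
theorem smul [CompleteSpace E] {v v' : ℝ → ℝ} (hv : IsPrimitive v v') (hw : IsPrimitive w g) :
    IsPrimitive (fun x => v x • w x) (fun x => v' x • w x + v x • g x) := by
  have hl : LocallyIntegrable (fun x => v' x • w x + v x • g x) volume := by
    refine LocallyIntegrable.add ?_ ?_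
    · rw [locallyIntegrable_iff]
      intro K hK
      exact (hv.loc.integrableOn_isCompact hK).smul_continuousOn hw.continuous.continuousOn hK
    · rw [locallyIntegrable_iff]
      intro K hK
      exact (hw.loc.integrableOn_isCompact hK).continuousOn_smul hv.continuous.continuousOn hK
  refine of_sub_eq hl fun a b => ?_
  refine (SeparatingDual.eq_iff_forall_dual_eq (R := ℝ)).2 fun L => ?_
  rw [← ContinuousLinearMap.intervalIntegral_comp_comm L (hl.intervalIntegrable' a b)]
  have := mul_real hv (hw.clm L) a b
  simpa using this

theorem hasWeakDerivOn [CompleteSpace E] (h : IsPrimitive w g) (Ω : Set ℝ) :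
    HasWeakDerivOn Ω w g := by
  refine ⟨h.continuous.locallyIntegrable.locallyIntegrableOn _, h.loc.locallyIntegrableOn _,
    fun φ hφ hc _ => ?_⟩
  have hφ' : Continuous (deriv φ) := hφ.continuous_deriv (by simp)
  have hp : IsPrimitive φ (deriv φ) :=
    of_hasDerivAt (fun x => (hφ.differentiable (by simp) x).hasDerivAt) hφ'
  have hs := hp.smul h
  have i1 : Integrable (fun x => deriv φ x • w x) :=
    h.continuous.locallyIntegrable.integrable_smul_left_of_hasCompactSupport hφ' hc.deriv
  have i2 : Integrable (fun x => φ x • g x) :=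
    h.loc.integrable_smul_left_of_hasCompactSupport hφ.continuous hc
  rw [eq_neg_iff_add_eq_zero, ← integral_add i1 i2]
  obtain ⟨M, hM⟩ := hc.isCompact.isBounded.subset_ball 0
  have hz : ∀ x, M ≤ |x| → φ x = 0 ∧ deriv φ x = 0 := by
    intro x hx
    have hx' : x ∉ tsupport φ := fun hxs => by
      have := hM hxs
      simp at this; linarith
    exact ⟨image_eq_zero_of_notMem_tsupport hx', by
      by_contra hne
      exact hx' (support_deriv_subset hne)⟩
  have hM0 : M ≤ |M| := le_abs_self M
  have h0 := hs.sub_eq (-|M|) (|M|)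
  rw [(hz (-|M|) (by simpa using hM0)).1, (hz (|M|) (by simpa using hM0)).1] at h0
  simp only [zero_smul, sub_zero] at h0
  rw [h0, intervalIntegral.integral_of_le (by linarith [abs_nonneg M])]
  symm
  apply setIntegral_eq_integral_of_forall_compl_eq_zero
  intro x hx
  have : M ≤ |x| := by
    by_contra hlt
    push Not at hlt
    have := abs_lt.1 (lt_of_lt_of_le hlt hM0)
    exact hx ⟨this.1, this.2.le⟩
  simp [hz x this]

end IsPrimitive

end Primitive

end KleinGordon

namespace KleinGordon

/-! ### Weak derivatives, continuous representatives and Sobolev norms. -/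

section WeakDerivative

variable {E : Type*} [NormedAddCommGroup E] [NormedSpace ℝ E] {Ω : Set ℝ} {w w' g g' : ℝ → E}

theorem integrable_smul_of_tsupport_subset (hg : LocallyIntegrableOn g Ω volume) {φ : ℝ → ℝ}
    (hφ : Continuous φ) (hc : HasCompactSupport φ) (hs : tsupport φ ⊆ Ω) :
    Integrable (fun x => φ x • g x) := by
  have h1 : IntegrableOn g (tsupport φ) volume := hg.integrableOn_compact_subset hs hc.isCompact
  have h2 := h1.continuousOn_smul hφ.continuousOn hc.isCompact
  refine (integrableOn_iff_integrable_of_support_subset ?_).1 h2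
  intro x hx
  apply subset_tsupport
  intro h0
  exact hx (by simp [h0])

theorem tsupport_deriv_subset' (φ : ℝ → ℝ) : tsupport (deriv φ) ⊆ tsupport φ :=
  closure_minimal support_deriv_subset (isClosed_tsupport φ)

omit [NormedSpace ℝ E] in
theorem locallyIntegrableOn_congr_ae (h : LocallyIntegrableOn w Ω volume)
    (hw : w =ᵐ[volume.restrict Ω] w') : LocallyIntegrableOn w' Ω volume := by
  intro x hx
  obtain ⟨s, hs, hi⟩ := h x hx
  refine ⟨s ∩ Ω, inter_mem hs self_mem_nhdsWithin, ?_⟩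
  refine (hi.mono_set inter_subset_left).congr ?_
  exact ae_restrict_of_ae_restrict_of_subset inter_subset_right hw

theorem integral_smul_congr (hΩ : MeasurableSet Ω) (hw : w =ᵐ[volume.restrict Ω] w') {φ : ℝ → ℝ}
    (hs : tsupport φ ⊆ Ω) : ∫ x, φ x • w x = ∫ x, φ x • w' x := by
  apply integral_congr_ae
  filter_upwards [(ae_restrict_iff' hΩ).1 hw] with x hx
  by_cases hxs : x ∈ Ω
  · simp only [hx hxs]
  · simp [image_eq_zero_of_notMem_tsupport fun h => hxs (hs h)]

namespace HasWeakDerivOn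

theorem congr (h : HasWeakDerivOn Ω w g) (hΩ : MeasurableSet Ω)
    (hw : w =ᵐ[volume.restrict Ω] w') (hg : g =ᵐ[volume.restrict Ω] g') :
    HasWeakDerivOn Ω w' g' := by
  refine ⟨locallyIntegrableOn_congr_ae h.1 hw, locallyIntegrableOn_congr_ae h.2.1 hg, fun φ hφ hc hs => ?_⟩
  rw [← integral_smul_congr hΩ hg hs,
    ← integral_smul_congr hΩ hw ((tsupport_deriv_subset' φ).trans hs)]
  exact h.2.2 φ hφ hc hs

theorem sub (h : HasWeakDerivOn Ω w g) (h' : HasWeakDerivOn Ω w' g') :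
    HasWeakDerivOn Ω (fun x => w x - w' x) (fun x => g x - g' x) := by
  refine ⟨h.1.sub h'.1, h.2.1.sub h'.2.1, fun φ hφ hc hs => ?_⟩
  have hφ' : Continuous (deriv φ) := hφ.continuous_deriv (by simp)
  have hs' := (tsupport_deriv_subset' φ).trans hs
  simp only [smul_sub]
  rw [integral_sub (integrable_smul_of_tsupport_subset h.1 hφ' hc.deriv hs')
    (integrable_smul_of_tsupport_subset h'.1 hφ' hc.deriv hs'),
    integral_sub (integrable_smul_of_tsupport_subset h.2.1 hφ.continuous hc hs)
    (integrable_smul_of_tsupport_subset h'.2.1 hφ.continuous hc hs),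
    h.2.2 φ hφ hc hs, h'.2.2 φ hφ hc hs]
  abel

theorem unique [CompleteSpace E] (hΩ : IsOpen Ω) (h : HasWeakDerivOn Ω w g)
    (h' : HasWeakDerivOn Ω w g') : g =ᵐ[volume.restrict Ω] g' := by
  have := hΩ.ae_eq_zero_of_integral_contDiff_smul_eq_zero (f := fun x => g x - g' x)
    (h.2.1.sub h'.2.1) (fun φ hφ hc hs => by
      simp only [smul_sub]
      rw [integral_sub (integrable_smul_of_tsupport_subset h.2.1 hφ.continuous hc hs)
        (integrable_smul_of_tsupport_subset h'.2.1 hφ.continuous hc hs), sub_eq_zero,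
        ← neg_inj, ← h.2.2 φ hφ hc hs, ← h'.2.2 φ hφ hc hs])
  rw [Filter.EventuallyEq, ae_restrict_iff' hΩ.measurableSet]
  filter_upwards [this] with x hx hxΩ
  exact sub_eq_zero.1 (hx hxΩ)

end HasWeakDerivOn

/-- Du Bois-Reymond's lemma. With a fixed bump η of integral 1, every test function ψ splits as
(∫ψ)η plus a function of mean zero, and the latter is the derivative of a test function; so v pairs
with ψ like the constant ∫ηv. -/
theorem ae_eq_const_of_integral_deriv_smul_eq_zero [CompleteSpace E] (hΩ : IsOpen Ω)
    (hoc : OrdConnected Ω) (hne : Ω.Nonempty) {v : ℝ → E} (hv : LocallyIntegrableOn v Ω volume)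
    (h : ∀ φ : ℝ → ℝ, ContDiff ℝ (⊤ : ℕ∞) φ → HasCompactSupport φ → tsupport φ ⊆ Ω →
      ∫ x, deriv φ x • v x = 0) :
    ∃ c, v =ᵐ[volume.restrict Ω] fun _ => c := by
  obtain ⟨x₀, hx₀⟩ := hne
  obtain ⟨ε, hε, hball⟩ := Metric.isOpen_iff.1 hΩ x₀ hx₀
  let b : ContDiffBump x₀ := ⟨ε / 4, ε / 2, by positivity, by linarith⟩
  let η : ℝ → ℝ := b.normed volume
  have hη : ContDiff ℝ (⊤ : ℕ∞) η := b.contDiff_normed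
  have hηc : HasCompactSupport η := b.hasCompactSupport_normed
  have hη1 : ∫ x, η x = 1 := b.integral_normed
  have hηs : tsupport η = Metric.closedBall x₀ (ε / 2) := b.tsupport_normed_eq
  have hηΩ : tsupport η ⊆ Ω := by
    rw [hηs]
    exact (Metric.closedBall_subset_ball (by linarith)).trans hball
  have hηi : Integrable η := hη.continuous.integrable_of_hasCompactSupport hηc
  refine ⟨∫ x, η x • v x, ?_⟩
  set c := ∫ x, η x • v x with hcdef
  have key := hΩ.ae_eq_zero_of_integral_contDiff_smul_eq_zero (f := fun x => v x - c)
    (hv.sub ((locallyIntegrable_const c).locallyIntegrableOn _)) (fun ψ hψ hψc hψs => by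
      have hψi : Integrable ψ := hψ.continuous.integrable_of_hasCompactSupport hψc
      set A := ∫ x, ψ x with hA
      let h₀ : ℝ → ℝ := fun x => ψ x - A * η x
      have h₀s : ContDiff ℝ (⊤ : ℕ∞) h₀ := hψ.sub (contDiff_const.mul hη)
      have h₀z : ∫ x, h₀ x = 0 := by
        simp only [h₀]
        rw [integral_sub hψi (hηi.const_mul A), integral_const_mul, hη1]
        simp [hA]
      let K := tsupport ψ ∪ tsupport η
      have hK : IsCompact K := hψc.isCompact.union hηc.isCompact
      have hKne : K.Nonempty := ⟨x₀, Or.inr (by rw [hηs]; simp; positivity)⟩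
      have hKΩ : K ⊆ Ω := union_subset hψs hηΩ
      have hlo := hK.sInf_mem hKne
      have hhi := hK.sSup_mem hKne
      have h₀K : ∀ y, y ∉ Icc (sInf K) (sSup K) → h₀ y = 0 := by
        intro y hy
        have hyK : y ∉ K := fun hyK => hy ⟨csInf_le hK.bddBelow hyK, le_csSup hK.bddAbove hyK⟩
        simp only [K, mem_union, not_or] at hyK
        simp [h₀, image_eq_zero_of_notMem_tsupport hyK.1, image_eq_zero_of_notMem_tsupport hyK.2]
      -- Mean zero makes this primitive vanish beyond both ends of the hull of K; connectedness of Ω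
      -- keeps that hull inside Ω.
      let φ : ℝ → ℝ := fun x => ∫ y in (sInf K)..x, h₀ y
      have hφd : ∀ x, HasDerivAt φ (h₀ x) x := fun x =>
        (h₀s.continuous.integral_hasStrictDerivAt _ x).hasDerivAt
      have hφderiv : deriv φ = h₀ := funext fun x => (hφd x).deriv
      have hφs : ContDiff ℝ (⊤ : ℕ∞) φ := by
        rw [contDiff_infty_iff_deriv]
        exact ⟨fun x => (hφd x).differentiableAt, by rw [hφderiv]; exact h₀s⟩
      have hφsupp : ∀ x, x ∉ Icc (sInf K) (sSup K) → φ x = 0 := by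
        intro x hx
        by_cases hxl : x < sInf K
        · simp only [φ]
          rw [intervalIntegral.integral_symm, neg_eq_zero]
          apply intervalIntegral.integral_zero_ae
          have : ∀ᵐ y : ℝ, y ≠ sInf K := by simp [ae_iff]
          filter_upwards [this] with y hy hym
          rw [uIoc_of_le hxl.le] at hym
          exact h₀K y fun h => hy (le_antisymm hym.2 h.1)
        · have hxh : sSup K < x := by
            by_contra hcon
            exact hx ⟨not_lt.1 hxl, not_lt.1 hcon⟩
          simp only [φ]
          rw [intervalIntegral.integral_of_le (not_lt.1 hxl), ← integral_Icc_eq_integral_Ioc,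
            ← h₀z]
          apply setIntegral_eq_integral_of_forall_compl_eq_zero
          intro y hy
          exact h₀K y fun h => hy ⟨h.1, h.2.trans hxh.le⟩
      have hφt : tsupport φ ⊆ Icc (sInf K) (sSup K) :=
        closure_minimal (fun x hx => by_contra fun hn => hx (hφsupp x hn)) isClosed_Icc
      have hφc : HasCompactSupport φ :=
        isCompact_Icc.of_isClosed_subset (isClosed_tsupport φ) hφt
      have h1 := h φ hφs hφc (hφt.trans (hoc.out (hKΩ hlo) (hKΩ hhi)))
      rw [hφderiv] at h1
      have iψ := integrable_smul_of_tsupport_subset hv hψ.continuous hψc hψs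
      have iη := integrable_smul_of_tsupport_subset hv hη.continuous hηc hηΩ
      simp only [h₀, sub_smul, mul_smul] at h1
      rw [integral_sub iψ (show Integrable fun x => A • η x • v x from iη.smul A),
        integral_smul, ← hcdef, sub_eq_zero] at h1
      simp only [smul_sub]
      rw [integral_sub iψ (hψi.smul_const c), h1, integral_smul_const, ← hA, sub_self])
  rw [Filter.EventuallyEq, ae_restrict_iff' hΩ.measurableSet]
  filter_upwards [key] with x hx hxΩ
  exact sub_eq_zero.1 (hx hxΩ)

theorem HasWeakDerivOn.exists_isPrimitive [CompleteSpace E] (hΩ : IsOpen Ω)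
    (hoc : OrdConnected Ω) (hne : Ω.Nonempty) (h : HasWeakDerivOn Ω w g)
    (hg : LocallyIntegrable g volume) :
    ∃ W, IsPrimitive W g ∧ w =ᵐ[volume.restrict Ω] W := by
  let W₀ : ℝ → E := fun x => ∫ y in (0 : ℝ)..x, g y
  have hW₀ : IsPrimitive W₀ g := ⟨hg, fun x => by simp [W₀]⟩
  have hs := h.sub (hW₀.hasWeakDerivOn Ω)
  obtain ⟨c, hc⟩ := ae_eq_const_of_integral_deriv_smul_eq_zero hΩ hoc hne hs.1
    (fun φ hφ hcs hφs => by rw [hs.2.2 φ hφ hcs hφs]; simp)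
  refine ⟨fun x => c + W₀ x, IsPrimitive.of_sub_eq hg fun a b => ?_, ?_⟩
  · rw [← hW₀.sub_eq]; abel
  · filter_upwards [hc] with x hx
    rw [← hx]; abel

theorem hNormSq_congr (hΩ : MeasurableSet Ω) (hw : w =ᵐ[volume.restrict Ω] w') (m : ℕ) :
    hNormSq m Ω w = hNormSq m Ω w' := by
  cases m with
  | zero => simp only [hNormSq, eLpNorm_congr_ae hw]
  | succ m =>
    have : ∀ g, HasWeakDerivOn Ω w g ↔ HasWeakDerivOn Ω w' g := fun g =>
      ⟨fun h => h.congr hΩ hw EventuallyEq.rfl, fun h => h.congr hΩ hw.symm EventuallyEq.rfl⟩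
    simp only [hNormSq, eLpNorm_congr_ae hw, this]

theorem hNormSq_succ [CompleteSpace E] (hΩ : IsOpen Ω) (h : HasWeakDerivOn Ω w g) (m : ℕ) :
    hNormSq (m + 1) Ω w = eLpNorm w 2 (volume.restrict Ω) ^ 2 + hNormSq m Ω g := by
  simp only [hNormSq]
  congr 1
  apply le_antisymm
  · exact iInf₂_le g h
  · refine le_iInf₂ fun g' h' => ?_
    rw [hNormSq_congr hΩ.measurableSet (h.unique hΩ h')]

theorem sq_rpow_half (x : ℝ≥0∞) : (x ^ 2) ^ (1 / 2 : ℝ) = x := by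
  rw [← ENNReal.rpow_natCast, ← ENNReal.rpow_mul]; simp

theorem hNorm_zero (Ω : Set ℝ) (w : ℝ → E) : hNorm 0 Ω w = eLpNorm w 2 (volume.restrict Ω) := by
  simp only [hNorm, hNormSq, sq_rpow_half]

theorem eLpNorm_le_hNorm (m : ℕ) (Ω : Set ℝ) (w : ℝ → E) :
    eLpNorm w 2 (volume.restrict Ω) ≤ hNorm m Ω w := by
  rw [← sq_rpow_half (eLpNorm w 2 (volume.restrict Ω))]
  apply ENNReal.rpow_le_rpow _ (by norm_num)
  cases m with
  | zero => simp [hNormSq]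
  | succ m => simp [hNormSq]

theorem hNorm_weakDeriv_le [CompleteSpace E] (hΩ : IsOpen Ω) (h : HasWeakDerivOn Ω w g) (m : ℕ) :
    hNorm m Ω g ≤ hNorm (m + 1) Ω w := by
  apply ENNReal.rpow_le_rpow _ (by norm_num)
  rw [hNormSq_succ hΩ h]
  exact le_add_self

theorem hNorm_succ_le (h : HasWeakDerivOn Ω w g) (m : ℕ) :
    hNorm (m + 1) Ω w ≤ eLpNorm w 2 (volume.restrict Ω) + hNorm m Ω g := by
  have : hNormSq (m + 1) Ω w ≤ eLpNorm w 2 (volume.restrict Ω) ^ 2 + hNormSq m Ω g := by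
    simp only [hNormSq]
    gcongr
    exact iInf₂_le g h
  refine (ENNReal.rpow_le_rpow this (by norm_num)).trans ?_
  refine (ENNReal.rpow_add_le_add_rpow _ _ (by norm_num) (by norm_num)).trans ?_
  rw [sq_rpow_half, hNorm]

theorem hNorm_one_le (h : HasWeakDerivOn Ω w g) :
    hNorm 1 Ω w ≤ eLpNorm w 2 (volume.restrict Ω) + eLpNorm g 2 (volume.restrict Ω) := by
  have := hNorm_succ_le h 0
  rwa [hNorm_zero] at this

theorem HasWeakDerivOn.of_memH (h : MemH 1 Ω w) : ∃ g, HasWeakDerivOn Ω w g ∧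
    MemLp w 2 (volume.restrict Ω) ∧ MemLp g 2 (volume.restrict Ω) := by
  obtain ⟨h1, g, h2, h3⟩ := h
  exact ⟨g, h2, h1, h3⟩

/-- The continuous representative of an `H¹(ℝ)` function. -/
theorem exists_isPrimitive_of_memH_one [CompleteSpace E] (h : MemH 1 univ w) :
    ∃ W g, IsPrimitive W g ∧ w =ᵐ[volume] W ∧ MemLp W 2 volume ∧ MemLp g 2 volume := by
  obtain ⟨g, h1, h2, h3⟩ := HasWeakDerivOn.of_memH h
  rw [Measure.restrict_univ] at h2 h3
  obtain ⟨W, hW, hw⟩ := h1.exists_isPrimitive isOpen_univ ordConnected_univ univ_nonempty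
    (h3.locallyIntegrable (by norm_num))
  rw [Measure.restrict_univ] at hw
  exact ⟨W, g, hW, hw, (memLp_congr_ae hw).1 h2, h3⟩

/-- The continuously differentiable representative of an `H²(ℝ)` function. -/
theorem exists_isPrimitive_of_memH_two [CompleteSpace E] (h : MemH 2 univ w) :
    ∃ W W' g, (∀ x, HasDerivAt W (W' x) x) ∧ IsPrimitive W' g ∧ w =ᵐ[volume] W ∧
      MemLp W 2 volume ∧ MemLp W' 2 volume ∧ MemLp g 2 volume := by
  obtain ⟨h1, g₀, h2, h3⟩ := h
  obtain ⟨W', g, hW', hg₀, h4, h5⟩ := exists_isPrimitive_of_memH_one h3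
  rw [Measure.restrict_univ] at h1
  have h6 : HasWeakDerivOn univ w W' :=
    h2.congr MeasurableSet.univ EventuallyEq.rfl (by rwa [Measure.restrict_univ])
  obtain ⟨W, hW, hw⟩ := h6.exists_isPrimitive isOpen_univ ordConnected_univ univ_nonempty
    hW'.continuous.locallyIntegrable
  rw [Measure.restrict_univ] at hw
  exact ⟨W, W', g, hW.hasDerivAt hW'.continuous, hW', hw, (memLp_congr_ae hw).1 h1, h4, h5⟩

/-- The Sobolev embedding on a bounded interval. -/
theorem IsPrimitive.enorm_le (h : IsPrimitive w g) {c d x : ℝ} (hcd : c < d)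
    (hx : x ∈ Icc c d) :
    ‖w x‖ₑ ≤ (ENNReal.ofReal (d - c))⁻¹ * (eLpNorm w 2 (volume.restrict (Ioo c d)) *
        ENNReal.ofReal (d - c) ^ (1 / 2 : ℝ)) +
      eLpNorm g 2 (volume.restrict (Ioo c d)) * ENNReal.ofReal (d - c) ^ (1 / 2 : ℝ) := by
  set μ := volume.restrict (Ioo c d) with hμ
  have hμu : μ univ = ENNReal.ofReal (d - c) := by simp [hμ]
  have hpos : ENNReal.ofReal (d - c) ≠ 0 := by simpa using hcd
  have hL : ∀ v : ℝ → E, AEStronglyMeasurable v μ → ∫⁻ y, ‖v y‖ₑ ∂μ ≤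
      eLpNorm v 2 μ * ENNReal.ofReal (d - c) ^ (1 / 2 : ℝ) := by
    intro v hv
    have := eLpNorm_le_eLpNorm_mul_rpow_measure_univ (p := 1) (q := 2) (by norm_num) hv
    rw [eLpNorm_one_eq_lintegral_enorm, hμu] at this
    convert this using 3
    norm_num
  -- The pointwise value is compared with the value at every y, then averaged over y; Cauchy–Schwarz
  -- on the interval gives the two L² terms.
  have h1 : ∀ y ∈ Ioo c d, ‖w x‖ₑ ≤ ‖w y‖ₑ + ∫⁻ z, ‖g z‖ₑ ∂μ := by
    intro y hy
    have e : w x = w y + ∫ z in y..x, g z := by rw [← h.sub_eq]; abel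
    rw [e]
    refine (enorm_add_le _ _).trans ?_
    gcongr
    rw [intervalIntegral.intervalIntegral_eq_integral_uIoc]
    have : ∀ z : E, ‖(if y ≤ x then (1 : ℝ) else -1) • z‖ₑ = ‖z‖ₑ := by
      intro z; split_ifs <;> simp
    rw [this]
    refine (enorm_integral_le_lintegral_enorm _).trans ?_
    refine lintegral_mono' (le_trans (Measure.restrict_mono ?_ le_rfl)
      (restrict_Ioo_eq_restrict_Icc (μ := volume)).ge) le_rfl
    exact uIoc_subset_uIcc.trans (uIcc_subset_Icc (Ioo_subset_Icc_self hy) hx)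
  have h2 : ∫⁻ _, ‖w x‖ₑ ∂μ ≤ ∫⁻ y, (‖w y‖ₑ + ∫⁻ z, ‖g z‖ₑ ∂μ) ∂μ :=
    setLIntegral_mono_ae' measurableSet_Ioo (Eventually.of_forall h1)
  rw [lintegral_const, hμu, lintegral_add_right _ measurable_const, lintegral_const, hμu] at h2
  have h3 : ‖w x‖ₑ = (ENNReal.ofReal (d - c))⁻¹ * (‖w x‖ₑ * ENNReal.ofReal (d - c)) := by
    rw [mul_comm, mul_assoc, ENNReal.mul_inv_cancel hpos ENNReal.ofReal_ne_top, mul_one]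
  rw [h3]
  have h4 := h2.trans (add_le_add (hL w h.continuous.aestronglyMeasurable)
    (mul_le_mul_left (hL g h.loc.aestronglyMeasurable.restrict) _))
  refine (mul_le_mul_right h4 _).trans (le_of_eq ?_)
  rw [mul_add, mul_comm (eLpNorm g 2 μ * _) (ENNReal.ofReal _), ← mul_assoc _ (ENNReal.ofReal _),
    ENNReal.inv_mul_cancel hpos ENNReal.ofReal_ne_top, one_mul]

end WeakDerivative

end KleinGordon

namespace KleinGordon

/-! ### Joint differentiability from partial derivatives; Leibniz rules. -/

section Parametric

variable {E : Type*} [NormedAddCommGroup E] [NormedSpace ℝ E]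

/-- The linear map `(τ, ξ) ↦ τ • a + ξ • b`. -/
noncomputable def pairCLM (a b : E) : ℝ × ℝ →L[ℝ] E :=
  ((1 : ℝ →L[ℝ] ℝ).smulRight a).coprod ((1 : ℝ →L[ℝ] ℝ).smulRight b)

theorem pairCLM_apply (a b : E) (v : ℝ × ℝ) : pairCLM a b v = v.1 • a + v.2 • b := by
  simp [pairCLM]

theorem hasFDerivAt_of_partial {f f₁ f₂ : ℝ → ℝ → E} {u : ℝ × ℝ}
    (h₁ : ∀ᶠ v in 𝓝 u, HasDerivAt (fun s => f s v.2) (f₁ v.1 v.2) v.1)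
    (h₂ : ∀ᶠ v in 𝓝 u, HasDerivAt (fun y => f v.1 y) (f₂ v.1 v.2) v.2)
    (c₁ : ContinuousAt (fun v : ℝ × ℝ => f₁ v.1 v.2) u)
    (c₂ : ContinuousAt (fun v : ℝ × ℝ => f₂ v.1 v.2) u) :
    HasFDerivAt (fun v : ℝ × ℝ => f v.1 v.2) (pairCLM (f₁ u.1 u.2) (f₂ u.1 u.2)) u := by
  have := hasStrictFDerivAt_uncurry_coprod (𝕜 := ℝ) (u := u) (f := f)
    (f₁ := fun t x => (1 : ℝ →L[ℝ] ℝ).smulRight (f₁ t x))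
    (f₂ := fun t x => (1 : ℝ →L[ℝ] ℝ).smulRight (f₂ t x))
    (h₁.mono fun v hv => hv.hasFDerivAt) (h₂.mono fun v hv => hv.hasFDerivAt)
    (by
      exact ((ContinuousLinearMap.smulRightL ℝ ℝ E (1 : ℝ →L[ℝ] ℝ)).continuous.continuousAt).comp
        c₁)
    (by
      exact ((ContinuousLinearMap.smulRightL ℝ ℝ E (1 : ℝ →L[ℝ] ℝ)).continuous.continuousAt).comp
        c₂)
  exact this.hasFDerivAt

theorem hasDerivAt_comp_of_partial {f f₁ f₂ : ℝ → ℝ → E} {τ ξ : ℝ → ℝ} {τ' ξ' s : ℝ}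
    (h₁ : ∀ᶠ v : ℝ × ℝ in 𝓝 (τ s, ξ s), HasDerivAt (fun s => f s v.2) (f₁ v.1 v.2) v.1)
    (h₂ : ∀ᶠ v : ℝ × ℝ in 𝓝 (τ s, ξ s), HasDerivAt (fun y => f v.1 y) (f₂ v.1 v.2) v.2)
    (c₁ : ContinuousAt (fun v : ℝ × ℝ => f₁ v.1 v.2) (τ s, ξ s))
    (c₂ : ContinuousAt (fun v : ℝ × ℝ => f₂ v.1 v.2) (τ s, ξ s))
    (hτ : HasDerivAt τ τ' s) (hξ : HasDerivAt ξ ξ' s) :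
    HasDerivAt (fun s => f (τ s) (ξ s)) (τ' • f₁ (τ s) (ξ s) + ξ' • f₂ (τ s) (ξ s)) s := by
  have := (hasFDerivAt_of_partial h₁ h₂ c₁ c₂).comp_hasDerivAt_of_eq s (hτ.prodMk hξ) rfl
  rw [pairCLM_apply] at this
  exact this

theorem contDiffOn_of_partial {f f₁ f₂ : ℝ → ℝ → E} {O : Set (ℝ × ℝ)} (hO : IsOpen O)
    (h₁ : ∀ v ∈ O, HasDerivAt (fun s => f s v.2) (f₁ v.1 v.2) v.1)
    (h₂ : ∀ v ∈ O, HasDerivAt (fun y => f v.1 y) (f₂ v.1 v.2) v.2)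
    (c₁ : ContinuousOn (fun v : ℝ × ℝ => f₁ v.1 v.2) O)
    (c₂ : ContinuousOn (fun v : ℝ × ℝ => f₂ v.1 v.2) O) :
    ContDiffOn ℝ 1 (fun v : ℝ × ℝ => f v.1 v.2) O := by
  have hd : ∀ v ∈ O, HasFDerivAt (fun v : ℝ × ℝ => f v.1 v.2)
      (pairCLM (f₁ v.1 v.2) (f₂ v.1 v.2)) v := fun v hv =>
    hasFDerivAt_of_partial (eventually_of_mem (hO.mem_nhds hv) h₁)
      (eventually_of_mem (hO.mem_nhds hv) h₂) (c₁.continuousAt (hO.mem_nhds hv))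
      (c₂.continuousAt (hO.mem_nhds hv))
  refine (contDiffOn_succ_iff_fderiv_of_isOpen (n := 0) hO).2 ⟨fun v hv =>
    (hd v hv).differentiableAt.differentiableWithinAt, by simp, contDiffOn_zero.2 ?_⟩
  refine ContinuousOn.congr (f := fun v : ℝ × ℝ => pairCLM (f₁ v.1 v.2) (f₂ v.1 v.2)) ?_
    fun v hv => (hd v hv).fderiv
  have e : ∀ a b : E, pairCLM a b =
      (ContinuousLinearMap.smulRightL ℝ (ℝ × ℝ) E (ContinuousLinearMap.fst ℝ ℝ ℝ)) a +
      (ContinuousLinearMap.smulRightL ℝ (ℝ × ℝ) E (ContinuousLinearMap.snd ℝ ℝ ℝ)) b := by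
    intro a b
    ext <;> simp [pairCLM]
  simp only [e]
  exact ((ContinuousLinearMap.continuous _).comp_continuousOn c₁).add
    ((ContinuousLinearMap.continuous _).comp_continuousOn c₂)

theorem hasDerivAt_intervalIntegral_param {S : Set ℝ} (hS : IsOpen S) {h h' : ℝ → ℝ → E}
    (ch : ContinuousOn (fun v : ℝ × ℝ => h v.1 v.2) (S ×ˢ univ))
    (ch' : ContinuousOn (fun v : ℝ × ℝ => h' v.1 v.2) (S ×ˢ univ))
    (hd : ∀ t ∈ S, ∀ y, HasDerivAt (fun s => h s y) (h' t y) t) {t : ℝ} (ht : t ∈ S) (a b : ℝ) :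
    HasDerivAt (fun s => ∫ y in a..b, h s y) (∫ y in a..b, h' t y) t := by
  obtain ⟨ε, hε, hball⟩ := Metric.isOpen_iff.1 hS t ht
  have hcb : Metric.closedBall t (ε / 2) ⊆ S :=
    (Metric.closedBall_subset_ball (by linarith)).trans hball
  have hslice : ∀ {k : ℝ → ℝ → E}, ContinuousOn (fun v : ℝ × ℝ => k v.1 v.2) (S ×ˢ univ) →
      ∀ s ∈ S, Continuous (k s) := by
    intro k hk s hs
    have : Continuous fun y : ℝ => (fun v : ℝ × ℝ => k v.1 v.2) (s, y) :=
      hk.comp_continuous (by fun_prop) (fun y => ⟨hs, mem_univ _⟩)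
    exact this
  obtain ⟨C, hC⟩ := ((isCompact_closedBall t (ε / 2)).prod
    (isCompact_uIcc (a := a) (b := b))).exists_bound_of_continuousOn
    (ch'.mono (prod_mono hcb (subset_univ _)))
  refine (intervalIntegral.hasDerivAt_integral_of_dominated_loc_of_deriv_le (bound := fun _ => C)
    (Metric.closedBall_mem_nhds t (by positivity : 0 < ε / 2)) ?_
    ((hslice ch t ht).intervalIntegrable a b)
    (hslice ch' t ht).aestronglyMeasurable ?_ (by simp) ?_).2
  · filter_upwards [hS.mem_nhds ht] with s hs
    exact (hslice ch s hs).aestronglyMeasurable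
  · refine Eventually.of_forall fun y hy s hs => hC (s, y) ⟨hs, uIoc_subset_uIcc hy⟩
  · exact Eventually.of_forall fun y _ s hs => hd s (hcb hs) y

theorem continuousOn_intervalIntegral_param {S : Set ℝ} {h : ℝ → ℝ → E}
    (ch : ContinuousOn (fun v : ℝ × ℝ => h v.1 v.2) (S ×ˢ univ)) :
    ContinuousOn (fun v : ℝ × ℝ => ∫ y in (0 : ℝ)..v.2, h v.1 y) (S ×ˢ univ) := by
  rw [continuousOn_iff_continuous_domRestrict]
  have h1 : Continuous (fun z : (S ×ˢ (univ : Set ℝ) : Set (ℝ × ℝ)) × ℝ => h z.1.1.1 z.2) := by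
    have : Continuous fun z : (S ×ˢ (univ : Set ℝ) : Set (ℝ × ℝ)) × ℝ =>
        (fun v : ℝ × ℝ => h v.1 v.2) (z.1.1.1, z.2) :=
      ch.comp_continuous (by fun_prop) (fun z => ⟨z.1.2.1, mem_univ _⟩)
    exact this
  exact intervalIntegral.continuous_parametric_intervalIntegral_of_continuous
    (f := fun (z : (S ×ˢ (univ : Set ℝ) : Set (ℝ × ℝ))) y => h z.1.1 y) h1 (by fun_prop)

/-- Leibniz' rule for the derivative of an integral with variable limits. -/
theorem hasDerivAt_intervalIntegral_moving [CompleteSpace E] {S : Set ℝ} (hS : IsOpen S)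
    {h h' : ℝ → ℝ → E}
    (ch : ContinuousOn (fun v : ℝ × ℝ => h v.1 v.2) (S ×ˢ univ))
    (ch' : ContinuousOn (fun v : ℝ × ℝ => h' v.1 v.2) (S ×ˢ univ))
    (hd : ∀ t ∈ S, ∀ y, HasDerivAt (fun s => h s y) (h' t y) t) {t : ℝ} (ht : t ∈ S)
    {a b : ℝ → ℝ} {a' b' : ℝ} (ha : HasDerivAt a a' t) (hb : HasDerivAt b b' t) :
    HasDerivAt (fun s => ∫ y in (a s)..(b s), h s y)
      (b' • h t (b t) - a' • h t (a t) + ∫ y in (a t)..(b t), h' t y) t := by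
  have hO : IsOpen (S ×ˢ (univ : Set ℝ)) := hS.prod isOpen_univ
  have hslice : ∀ {k : ℝ → ℝ → E}, ContinuousOn (fun v : ℝ × ℝ => k v.1 v.2) (S ×ˢ univ) →
      ∀ s ∈ S, Continuous (k s) := by
    intro k hk s hs
    have : Continuous fun y : ℝ => (fun v : ℝ × ℝ => k v.1 v.2) (s, y) :=
      hk.comp_continuous (by fun_prop) (fun y => ⟨hs, mem_univ _⟩)
    exact this
  -- The integral is a C¹ function of the parameter and the endpoint separately, so the chain rule
  -- applies along s ↦ (s, c s).
  have key : ∀ {c : ℝ → ℝ} {c' : ℝ}, HasDerivAt c c' t →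
      HasDerivAt (fun s => ∫ y in (0 : ℝ)..(c s), h s y)
        ((1 : ℝ) • (∫ y in (0 : ℝ)..(c t), h' t y) + c' • h t (c t)) t := by
    intro c c' hc
    have hmem : S ×ˢ (univ : Set ℝ) ∈ 𝓝 (t, c t) := hO.mem_nhds ⟨ht, mem_univ _⟩
    exact hasDerivAt_comp_of_partial (f := fun s b => ∫ y in (0 : ℝ)..b, h s y)
      (f₁ := fun s b => ∫ y in (0 : ℝ)..b, h' s y) (f₂ := h) (τ := fun s => s) (ξ := c)
      (by
        filter_upwards [hmem] with v hv
        exact hasDerivAt_intervalIntegral_param hS ch ch' hd hv.1 _ _)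
      (by
        filter_upwards [hmem] with v hv
        exact ((hslice ch v.1 hv.1).integral_hasStrictDerivAt _ _).hasDerivAt)
      ((continuousOn_intervalIntegral_param ch').continuousAt hmem)
      (ch.continuousAt hmem) (hasDerivAt_id t) hc
  have hsub := (key hb).sub (key ha)
  have e : ∀ k : ℝ → ℝ → E, ContinuousOn (fun v : ℝ × ℝ => k v.1 v.2) (S ×ˢ univ) → ∀ s ∈ S,
      (∫ y in (0 : ℝ)..(b s), k s y) - (∫ y in (0 : ℝ)..(a s), k s y) =
        ∫ y in (a s)..(b s), k s y := fun k hk s hs =>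
    intervalIntegral.integral_interval_sub_left ((hslice hk s hs).intervalIntegrable _ _)
      ((hslice hk s hs).intervalIntegrable _ _)
  convert hsub.congr_of_eventuallyEq (eventually_of_mem (hS.mem_nhds ht) fun s hs =>
    (e h ch s hs).symm) using 1
  rw [← e h' ch' t ht]
  simp only [one_smul]
  abel

end Parametric

end KleinGordon

namespace KleinGordon

/-! ### The nonlinear wave equation in characteristic form; Picard iteration. -/

section Wave

theorem _root_.HasDerivAt.of_eq {E : Type*} [NormedAddCommGroup E] [NormedSpace ℝ E]
    {v w : ℝ → E} {v' w' : E} {x : ℝ} (h : HasDerivAt v v' x) (hf : ∀ y, w y = v y)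
    (hf' : w' = v') : HasDerivAt w w' x := by
  rw [funext hf, hf']; exact h

/-- The first order form of `u_tt - u_xx + g(u) = 0`, with `p = u_t + u_x` and `q = u_t - u_x`
differentiable along the characteristics. -/
structure IsWave (g : ℂ → ℂ) (u p q : ℝ → ℝ → ℂ) : Prop where
  cont_u : Continuous fun v : ℝ × ℝ => u v.1 v.2
  cont_p : Continuous fun v : ℝ × ℝ => p v.1 v.2
  cont_q : Continuous fun v : ℝ × ℝ => q v.1 v.2
  dt : ∀ t x, HasDerivAt (fun s => u s x) ((p t x + q t x) / 2) t
  dx : ∀ t x, HasDerivAt (fun y => u t y) ((p t x - q t x) / 2) x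
  dp : ∀ t ξ, HasDerivAt (fun s => p s (ξ - s)) (-g (u t (ξ - t))) t
  dq : ∀ t ξ, HasDerivAt (fun s => q s (ξ + s)) (-g (u t (ξ + t))) t

/-- The solution of `u_tt - u_xx = h` with vanishing initial data. -/
noncomputable def duhamel (h : ℝ → ℝ → ℂ) (t x : ℝ) : ℂ :=
  (1 / 2 : ℝ) • ∫ s in (0 : ℝ)..t, ∫ y in (x - (t - s))..(x + (t - s)), h s y

theorem continuous_cone_integral {h : ℝ → ℝ → ℂ} (ch : Continuous fun v : ℝ × ℝ => h v.1 v.2) :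
    Continuous fun v : (ℝ × ℝ) × ℝ =>
      ∫ y in (v.1.2 - (v.1.1 - v.2))..(v.1.2 + (v.1.1 - v.2)), h v.2 y := by
  have h1 : ∀ c : (ℝ × ℝ) × ℝ → ℝ, Continuous c →
      Continuous fun v : (ℝ × ℝ) × ℝ => ∫ y in (0 : ℝ)..(c v), h v.2 y := fun c hc =>
    intervalIntegral.continuous_parametric_intervalIntegral_of_continuous
      (f := fun (v : (ℝ × ℝ) × ℝ) y => h v.2 y)
      (ch.comp (by fun_prop : Continuous fun z : ((ℝ × ℝ) × ℝ) × ℝ => (z.1.2, z.2))) hc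
  have hs : ∀ s, Continuous (h s) := fun s => ch.comp (by fun_prop : Continuous fun y : ℝ => (s, y))
  have h2 := (h1 (fun v => v.1.2 + (v.1.1 - v.2)) (by fun_prop)).sub
    (h1 (fun v => v.1.2 - (v.1.1 - v.2)) (by fun_prop))
  refine h2.congr fun v => ?_
  exact intervalIntegral.integral_interval_sub_left ((hs _).intervalIntegrable _ _)
    ((hs _).intervalIntegrable _ _)

theorem continuous_duhamel {h : ℝ → ℝ → ℂ} (ch : Continuous fun v : ℝ × ℝ => h v.1 v.2) :
    Continuous fun v : ℝ × ℝ => duhamel h v.1 v.2 := by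
  unfold duhamel
  have := intervalIntegral.continuous_parametric_intervalIntegral_of_continuous (μ := volume)
    (a₀ := 0) (f := fun (v : ℝ × ℝ) s => ∫ y in (v.2 - (v.1 - s))..(v.2 + (v.1 - s)), h s y)
    (continuous_cone_integral ch) continuous_fst
  exact this.const_smul (1 / 2 : ℝ)

theorem hasDerivAt_duhamel_time {h : ℝ → ℝ → ℂ} (ch : Continuous fun v : ℝ × ℝ => h v.1 v.2)
    (t x : ℝ) :
    HasDerivAt (fun t => duhamel h t x) ((1 / 2 : ℝ) •
      ((∫ s in (0 : ℝ)..t, h s (x + (t - s))) + ∫ s in (0 : ℝ)..t, h s (x - (t - s)))) t := by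
  have hs : ∀ s, Continuous (h s) := fun s => ch.comp (by fun_prop : Continuous fun y : ℝ => (s, y))
  have c1 : Continuous fun v : ℝ × ℝ => h v.2 (x + (v.1 - v.2)) :=
    ch.comp (by fun_prop : Continuous fun v : ℝ × ℝ => (v.2, x + (v.1 - v.2)))
  have c2 : Continuous fun v : ℝ × ℝ => h v.2 (x - (v.1 - v.2)) :=
    ch.comp (by fun_prop : Continuous fun v : ℝ × ℝ => (v.2, x - (v.1 - v.2)))
  have key := hasDerivAt_intervalIntegral_moving (S := univ) isOpen_univ
    (h := fun t s => ∫ y in (x - (t - s))..(x + (t - s)), h s y)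
    (h' := fun t s => h s (x + (t - s)) + h s (x - (t - s)))
    ((continuous_cone_integral ch).comp
      (by fun_prop : Continuous fun v : ℝ × ℝ => ((v.1, x), v.2))).continuousOn
    (c1.add c2).continuousOn
    (fun t _ s => by
      have := hasDerivAt_intervalIntegral_moving (S := univ) isOpen_univ
        (h := fun _ y => h s y) (h' := fun _ _ => 0)
        ((hs s).comp continuous_snd).continuousOn continuousOn_const
        (fun t _ y => hasDerivAt_const _ _) (mem_univ t)
        (a := fun t => x - (t - s)) (b := fun t => x + (t - s))
        (((hasDerivAt_id t).sub_const s).const_sub x) (((hasDerivAt_id t).sub_const s).const_add x)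
      simpa using this)
    (mem_univ t) (a := fun _ => 0) (b := fun t => t) (hasDerivAt_const _ _) (hasDerivAt_id t)
  have key2 := key.const_smul (1 / 2 : ℝ)
  refine key2.of_eq (fun _ => rfl) ?_
  rw [intervalIntegral.integral_add]
  · simp
  · exact (c1.comp (by fun_prop : Continuous fun s : ℝ => (t, s))).intervalIntegrable _ _
  · exact (c2.comp (by fun_prop : Continuous fun s : ℝ => (t, s))).intervalIntegrable _ _

theorem hasDerivAt_duhamel_space {h : ℝ → ℝ → ℂ} (ch : Continuous fun v : ℝ × ℝ => h v.1 v.2)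
    (t x : ℝ) :
    HasDerivAt (fun x => duhamel h t x) ((1 / 2 : ℝ) •
      ((∫ s in (0 : ℝ)..t, h s (x + (t - s))) - ∫ s in (0 : ℝ)..t, h s (x - (t - s)))) x := by
  have hs : ∀ s, Continuous (h s) := fun s => ch.comp (by fun_prop : Continuous fun y : ℝ => (s, y))
  have c1 : Continuous fun v : ℝ × ℝ => h v.2 (v.1 + (t - v.2)) :=
    ch.comp (by fun_prop : Continuous fun v : ℝ × ℝ => (v.2, v.1 + (t - v.2)))
  have c2 : Continuous fun v : ℝ × ℝ => h v.2 (v.1 - (t - v.2)) :=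
    ch.comp (by fun_prop : Continuous fun v : ℝ × ℝ => (v.2, v.1 - (t - v.2)))
  have key := hasDerivAt_intervalIntegral_param (S := univ) isOpen_univ
    (h := fun x s => ∫ y in (x - (t - s))..(x + (t - s)), h s y)
    (h' := fun x s => h s (x + (t - s)) - h s (x - (t - s)))
    ((continuous_cone_integral ch).comp
      (by fun_prop : Continuous fun v : ℝ × ℝ => ((t, v.1), v.2))).continuousOn
    (c1.sub c2).continuousOn
    (fun x _ s => by
      have := hasDerivAt_intervalIntegral_moving (S := univ) isOpen_univ
        (h := fun _ y => h s y) (h' := fun _ _ => 0)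
        ((hs s).comp continuous_snd).continuousOn continuousOn_const
        (fun t _ y => hasDerivAt_const _ _) (mem_univ x)
        (a := fun x => x - (t - s)) (b := fun x => x + (t - s))
        ((hasDerivAt_id x).sub_const _) ((hasDerivAt_id x).add_const _)
      simpa using this)
    (mem_univ x) 0 t
  have key2 := key.const_smul (1 / 2 : ℝ)
  refine key2.of_eq (fun _ => rfl) ?_
  rw [intervalIntegral.integral_sub]
  · exact (c1.comp (by fun_prop : Continuous fun s : ℝ => (x, s))).intervalIntegrable _ _
  · exact (c2.comp (by fun_prop : Continuous fun s : ℝ => (x, s))).intervalIntegrable _ _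

/-- Integrating twice in time against e^{λs} gains λ⁻². This gain makes the Duhamel map a
contraction in the weighted norm without restricting time. -/
theorem norm_integral_le_exp_of_nonneg {k : ℝ → ℂ} {M lam t : ℝ} (hl : 0 < lam) (hM : 0 ≤ M)
    (ht : 0 ≤ t) (hk : ∀ s ∈ Icc 0 t, ‖k s‖ ≤ M * (t - s) * Real.exp (lam * s)) :
    ‖∫ s in (0 : ℝ)..t, k s‖ ≤ M * Real.exp (lam * t) / lam ^ 2 := by
  have hd : ∀ s, HasDerivAt (fun s => M * ((t - s) * Real.exp (lam * s) / lam +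
      Real.exp (lam * s) / lam ^ 2)) (M * (t - s) * Real.exp (lam * s)) s := by
    intro s
    have h1 : HasDerivAt (fun s => Real.exp (lam * s)) (Real.exp (lam * s) * lam) s := by
      simpa using ((hasDerivAt_id s).const_mul lam).exp
    have h2 : HasDerivAt (fun s => t - s) (-1) s := by simpa using (hasDerivAt_id s).const_sub t
    have h3 := (((h2.mul h1).div_const lam).add (h1.div_const (lam ^ 2))).const_mul M
    refine h3.of_eq (fun _ => rfl) ?_
    field_simp
    ring
  have hftc := intervalIntegral.integral_eq_sub_of_hasDerivAt (a := 0) (b := t)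
    (fun s _ => hd s) (by apply Continuous.intervalIntegrable; fun_prop)
  refine (intervalIntegral.norm_integral_le_of_norm_le ht (Eventually.of_forall fun s hs =>
    hk s (Ioc_subset_Icc_self hs)) (by apply Continuous.intervalIntegrable; fun_prop)).trans ?_
  rw [hftc]
  simp only [sub_self, zero_mul, zero_div, zero_add, sub_zero, mul_zero, Real.exp_zero, mul_one]
  have : 0 ≤ M * (t / lam + 1 / lam ^ 2) := by positivity
  have e : M * (Real.exp (lam * t) / lam ^ 2) = M * Real.exp (lam * t) / lam ^ 2 := by ring
  linarith

theorem norm_integral_le_exp {k : ℝ → ℂ} {M lam t : ℝ} (hl : 0 < lam) (hM : 0 ≤ M)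
    (hk : ∀ s, ‖k s‖ ≤ M * |t - s| * Real.exp (lam * |s|)) :
    ‖∫ s in (0 : ℝ)..t, k s‖ ≤ M * Real.exp (lam * |t|) / lam ^ 2 := by
  rcases le_total 0 t with ht | ht
  · rw [abs_of_nonneg ht]
    refine norm_integral_le_exp_of_nonneg hl hM ht fun s hs => ?_
    have := hk s
    rwa [abs_of_nonneg hs.1, abs_of_nonneg (sub_nonneg.2 hs.2)] at this
  · rw [abs_of_nonpos ht]
    have e : ∫ s in (0 : ℝ)..t, k s = -∫ s in (0 : ℝ)..(-t), k (-s) := by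
      rw [intervalIntegral.integral_comp_neg (fun s => k s), neg_neg, neg_zero,
        intervalIntegral.integral_symm]
    rw [e, norm_neg]
    refine norm_integral_le_exp_of_nonneg hl hM (by linarith) fun s hs => ?_
    have := hk (-s)
    rw [abs_neg, abs_of_nonneg hs.1] at this
    have h2 : |t - -s| = -t - s := by
      rw [abs_of_nonpos (by linarith [hs.2])]; ring
    rwa [h2] at this

theorem norm_duhamel_le {h : ℝ → ℝ → ℂ} {M lam : ℝ} (hl : 0 < lam) (hM : 0 ≤ M)
    (hh : ∀ s y, ‖h s y‖ ≤ M * Real.exp (lam * |s|)) (t x : ℝ) :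
    ‖duhamel h t x‖ ≤ M * Real.exp (lam * |t|) / lam ^ 2 := by
  unfold duhamel
  have := norm_integral_le_exp (k := fun s => ∫ y in (x - (t - s))..(x + (t - s)), h s y) (t := t)
    hl (mul_nonneg zero_le_two hM) (fun s => by
      refine (intervalIntegral.norm_integral_le_of_norm_le_const (C := M * Real.exp (lam * |s|))
        fun y _ => hh s y).trans (le_of_eq ?_)
      have : |x + (t - s) - (x - (t - s))| = 2 * |t - s| := by
        rw [show x + (t - s) - (x - (t - s)) = 2 * (t - s) by ring, abs_mul]; simp
      rw [this]; ring)
  rw [norm_smul]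
  simp only [one_div, norm_inv, Real.norm_ofNat]
  calc _ ≤ (2 : ℝ)⁻¹ * (2 * M * Real.exp (lam * |t|) / lam ^ 2) := by gcongr
    _ = _ := by ring

theorem duhamel_sub {h₁ h₂ : ℝ → ℝ → ℂ} (c₁ : Continuous fun v : ℝ × ℝ => h₁ v.1 v.2)
    (c₂ : Continuous fun v : ℝ × ℝ => h₂ v.1 v.2) (t x : ℝ) :
    duhamel (fun s y => h₁ s y - h₂ s y) t x = duhamel h₁ t x - duhamel h₂ t x := by
  have hs₁ : ∀ s, Continuous (h₁ s) := fun s =>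
    c₁.comp (by fun_prop : Continuous fun y : ℝ => (s, y))
  have hs₂ : ∀ s, Continuous (h₂ s) := fun s =>
    c₂.comp (by fun_prop : Continuous fun y : ℝ => (s, y))
  unfold duhamel
  rw [← smul_sub, ← intervalIntegral.integral_sub]
  · congr 1
    apply intervalIntegral.integral_congr
    intro s _
    exact intervalIntegral.integral_sub ((hs₁ s).intervalIntegrable _ _)
      ((hs₂ s).intervalIntegrable _ _)
  · exact ((continuous_cone_integral c₁).comp
      (by fun_prop : Continuous fun s : ℝ => ((t, x), s))).intervalIntegrable _ _
  · exact ((continuous_cone_integral c₂).comp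
      (by fun_prop : Continuous fun s : ℝ => ((t, x), s))).intervalIntegrable _ _

/-- Banach's fixed point theorem for v = e^{-λ|t|}u among bounded continuous functions on the whole
plane. Boundedness of g and the linear growth of F keep the map inside this space, and the Lipschitz
bound with large λ makes it contract. Negative times are included so that later derivatives at t = 0
are two-sided. -/
theorem exists_integral_solution {g : ℂ → ℂ} {L : ℝ≥0} (hL : LipschitzWith L g) {B : ℝ}
    (hB : ∀ z, ‖g z‖ ≤ B) {F : ℝ → ℝ → ℂ} (cF : Continuous fun v : ℝ × ℝ => F v.1 v.2) {C : ℝ}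
    (hF : ∀ t x, ‖F t x‖ ≤ C * (1 + |t|)) :
    ∃ u : ℝ → ℝ → ℂ, (Continuous fun v : ℝ × ℝ => u v.1 v.2) ∧
      ∀ t x, u t x = F t x + duhamel (fun s y => -g (u s y)) t x := by
  have hB0 : 0 ≤ B := (norm_nonneg _).trans (hB 0)
  have hC0 : 0 ≤ C := by
    have := (norm_nonneg _).trans (hF 0 0)
    simpa using this
  -- Any λ ≥ 1 with L/λ² ≤ 1/2 would do; λ ≥ 1 also gives 1 + |t| ≤ e^{λ|t|}.
  set lam : ℝ := 1 + 2 * L with hlam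
  have hL0 : (0 : ℝ) ≤ L := L.2
  have hl1 : 1 ≤ lam := by linarith
  have hl0 : 0 < lam := by linarith
  let X := BoundedContinuousFunction (ℝ × ℝ) ℂ
  let ex : X → ℝ → ℝ → ℂ := fun v s y => Real.exp (lam * |s|) • v (s, y)
  have cex : ∀ v : X, Continuous fun z : ℝ × ℝ => ex v z.1 z.2 := fun v => by
    have := v.continuous
    simp only [ex]
    fun_prop
  let src : X → ℝ → ℝ → ℂ := fun v s y => -g (ex v s y)
  have csrc : ∀ v : X, Continuous fun z : ℝ × ℝ => src v z.1 z.2 := fun v =>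
    (hL.continuous.comp (cex v)).neg
  have hexp : ∀ t : ℝ, 0 < Real.exp (-(lam * |t|)) := fun t => Real.exp_pos _
  have hee : ∀ t : ℝ, Real.exp (-(lam * |t|)) * Real.exp (lam * |t|) = 1 := fun t => by
    rw [← Real.exp_add]; simp
  have h1t : ∀ t : ℝ, 1 + |t| ≤ Real.exp (lam * |t|) := fun t => by
    have := Real.add_one_le_exp (lam * |t|)
    nlinarith [abs_nonneg t]
  let Φfun : X → ℝ × ℝ → ℂ := fun v z =>
    Real.exp (-(lam * |z.1|)) • (F z.1 z.2 + duhamel (src v) z.1 z.2)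
  have cΦ : ∀ v, Continuous (Φfun v) := fun v => by
    have := continuous_duhamel (csrc v)
    simp only [Φfun]
    fun_prop
  have bΦ : ∀ v z, ‖Φfun v z‖ ≤ C + B / lam ^ 2 := fun v z => by
    have h1 := norm_duhamel_le (h := src v) hl0 hB0 (fun s y => by
      simp only [src, norm_neg]
      refine (hB _).trans ?_
      have : 1 ≤ Real.exp (lam * |s|) := Real.one_le_exp (by positivity)
      nlinarith) z.1 z.2
    have h2 := hF z.1 z.2
    simp only [Φfun]
    rw [norm_smul, Real.norm_of_nonneg (hexp _).le]
    have h3 : ‖F z.1 z.2 + duhamel (src v) z.1 z.2‖ ≤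
        (C + B / lam ^ 2) * Real.exp (lam * |z.1|) := by
      refine (norm_add_le _ _).trans ?_
      have := mul_le_mul_of_nonneg_left (h1t z.1) hC0
      have e : B * Real.exp (lam * |z.1|) / lam ^ 2 = B / lam ^ 2 * Real.exp (lam * |z.1|) := by
        ring
      linarith
    calc _ ≤ Real.exp (-(lam * |z.1|)) * ((C + B / lam ^ 2) * Real.exp (lam * |z.1|)) := by gcongr
      _ = (C + B / lam ^ 2) * (Real.exp (-(lam * |z.1|)) * Real.exp (lam * |z.1|)) := by ring
      _ = _ := by rw [hee, mul_one]
  let Φ : X → X := fun v => BoundedContinuousFunction.ofNormedAddCommGroup (Φfun v) (cΦ v) _ (bΦ v)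
  have hΦ : ContractingWith (1 / 2 : ℝ≥0) Φ := by
    refine ⟨by rw [← NNReal.coe_lt_coe]; norm_num, LipschitzWith.of_dist_le_mul fun v w => ?_⟩
    rw [BoundedContinuousFunction.dist_le (by positivity)]
    intro z
    change dist (Φfun v z) (Φfun w z) ≤ _
    have h1 := norm_duhamel_le (h := fun s y => src v s y - src w s y) (M := L * dist v w) hl0
      (by positivity) (fun s y => by
        simp only [src]
        have h2 := hL.dist_le_mul (ex w s y) (ex v s y)
        rw [dist_eq_norm, dist_eq_norm] at h2
        have h3 : ‖ex w s y - ex v s y‖ ≤ Real.exp (lam * |s|) * dist v w := by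
          simp only [ex]
          rw [← smul_sub, norm_smul, Real.norm_of_nonneg (Real.exp_pos _).le, ← dist_eq_norm,
            dist_comm]
          gcongr
          exact BoundedContinuousFunction.dist_coe_le_dist _
        calc ‖-g (ex v s y) - -g (ex w s y)‖ = ‖g (ex w s y) - g (ex v s y)‖ := by congr 1; ring
          _ ≤ L * (Real.exp (lam * |s|) * dist v w) := h2.trans (by gcongr)
          _ = _ := by ring) z.1 z.2
    rw [duhamel_sub (csrc v) (csrc w)] at h1
    simp only [Φfun]
    rw [dist_eq_norm, ← smul_sub, norm_smul, Real.norm_of_nonneg (hexp _).le,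
      add_sub_add_left_eq_sub]
    have h4 : (L : ℝ) / lam ^ 2 ≤ 1 / 2 := by
      rw [div_le_iff₀ (by positivity)]; nlinarith
    calc _ ≤ Real.exp (-(lam * |z.1|)) * (L * dist v w * Real.exp (lam * |z.1|) / lam ^ 2) := by
          gcongr
      _ = L / lam ^ 2 * dist v w * (Real.exp (-(lam * |z.1|)) * Real.exp (lam * |z.1|)) := by ring
      _ ≤ 1 / 2 * dist v w * 1 := by rw [hee]; gcongr
      _ = _ := by simp
  obtain ⟨v, hv⟩ : ∃ v : X, Φ v = v := ⟨_, hΦ.fixedPoint_isFixedPt⟩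
  refine ⟨ex v, cex v, fun t x => ?_⟩
  have h5 : Φfun v (t, x) = v (t, x) := by
    conv_rhs => rw [← hv]
    rfl
  change Real.exp (lam * |t|) • v (t, x) = _
  rw [← h5]
  simp only [Φfun]
  rw [smul_smul, mul_comm, hee, one_smul]

/-- D'Alembert's formula plus Duhamel's. Both first derivatives of u combine into p and q, each a
transported datum plus an integral of the source over one characteristic, so no second derivative of
the data is needed to differentiate p and q along their own characteristics. -/
theorem exists_isWave {g : ℂ → ℂ} {L : ℝ≥0} (hL : LipschitzWith L g) {B : ℝ}
    (hB : ∀ z, ‖g z‖ ≤ B) {u₀ u₀' u₁ : ℝ → ℂ} (h₀ : ∀ x, HasDerivAt u₀ (u₀' x) x)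
    (c₀ : Continuous u₀') (c₁ : Continuous u₁) {C : ℝ} (b₀ : ∀ x, ‖u₀ x‖ ≤ C)
    (b₁ : ∀ x, ‖u₁ x‖ ≤ C) :
    ∃ u p q, IsWave g u p q ∧ (∀ x, u 0 x = u₀ x) ∧
      (∀ t x, p t x = u₁ (x + t) + u₀' (x + t) + ∫ s in (0 : ℝ)..t, -g (u s (x + (t - s)))) ∧
      (∀ t x, q t x = u₁ (x - t) - u₀' (x - t) + ∫ s in (0 : ℝ)..t, -g (u s (x - (t - s)))) := by
  have cu₀ : Continuous u₀ := continuous_iff_continuousAt.2 fun x => (h₀ x).continuousAt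
  let F : ℝ → ℝ → ℂ := fun t x => (1 / 2 : ℝ) • (u₀ (x + t) + u₀ (x - t) +
    ∫ y in (x - t)..(x + t), u₁ y)
  have cI : Continuous fun v : ℝ × ℝ => ∫ y in (v.2 - v.1)..(v.2 + v.1), u₁ y := by
    have h1 : ∀ c : ℝ × ℝ → ℝ, Continuous c → Continuous fun v => ∫ y in (0 : ℝ)..(c v), u₁ y :=
      fun c hc => (intervalIntegral.continuous_primitive
        (fun a b => c₁.intervalIntegrable a b) 0).comp hc
    refine ((h1 (fun v => v.2 + v.1) (by fun_prop)).sub (h1 (fun v => v.2 - v.1)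
      (by fun_prop))).congr fun v => ?_
    exact intervalIntegral.integral_interval_sub_left (c₁.intervalIntegrable _ _)
      (c₁.intervalIntegrable _ _)
  have cF : Continuous fun v : ℝ × ℝ => F v.1 v.2 := by
    simp only [F]
    fun_prop
  have bF : ∀ t x, ‖F t x‖ ≤ C * (1 + |t|) := by
    intro t x
    have h1 := intervalIntegral.norm_integral_le_of_norm_le_const (a := x - t) (b := x + t)
      (fun y _ => b₁ y)
    rw [show x + t - (x - t) = 2 * t by ring, abs_mul, abs_two] at h1
    simp only [F]
    rw [norm_smul]
    simp only [one_div, norm_inv, Real.norm_ofNat]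
    have h2 := norm_add₃_le (a := u₀ (x + t)) (b := u₀ (x - t)) (c := ∫ y in (x - t)..(x + t), u₁ y)
    have := b₀ (x + t)
    have := b₀ (x - t)
    linarith
  obtain ⟨u, cu, hu⟩ := exists_integral_solution hL hB cF bF
  have csrc : Continuous fun v : ℝ × ℝ => -g (u v.1 v.2) := (hL.continuous.comp cu).neg
  have cp : ∀ σ : ℝ, Continuous fun v : ℝ × ℝ =>
      ∫ s in (0 : ℝ)..v.1, -g (u s (v.2 + σ * (v.1 - s))) := fun σ =>
    intervalIntegral.continuous_parametric_intervalIntegral_of_continuous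
      (f := fun (v : ℝ × ℝ) s => -g (u s (v.2 + σ * (v.1 - s))))
      (csrc.comp (by fun_prop : Continuous fun z : (ℝ × ℝ) × ℝ =>
        (z.2, z.1.2 + σ * (z.1.1 - z.2)))) continuous_fst
  have hFt : ∀ t x, HasDerivAt (fun t => F t x) ((1 / 2 : ℝ) • (u₀' (x + t) - u₀' (x - t) +
      (u₁ (x + t) + u₁ (x - t)))) t := by
    intro t x
    have h1 : HasDerivAt (fun t => u₀ (x + t)) (u₀' (x + t)) t := (h₀ (x + t)).comp_const_add x t
    have h2 : HasDerivAt (fun t => u₀ (x - t)) (-u₀' (x - t)) t := (h₀ (x - t)).comp_const_sub x t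
    have h3 := hasDerivAt_intervalIntegral_moving (S := univ) isOpen_univ
        (h := fun _ y => u₁ y) (h' := fun _ _ => 0)
        (c₁.comp continuous_snd).continuousOn continuousOn_const
        (fun t _ y => hasDerivAt_const _ _) (mem_univ t)
        (a := fun t => x - t) (b := fun t => x + t)
        ((hasDerivAt_id t).const_sub x) ((hasDerivAt_id t).const_add x)
    have h4 := ((h1.add h2).add h3).const_smul (1 / 2 : ℝ)
    refine h4.of_eq (fun _ => rfl) ?_
    simp [sub_eq_add_neg]
  have hFx : ∀ t x, HasDerivAt (fun x => F t x) ((1 / 2 : ℝ) • (u₀' (x + t) + u₀' (x - t) +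
      (u₁ (x + t) - u₁ (x - t)))) x := by
    intro t x
    have h1 : HasDerivAt (fun x => u₀ (x + t)) (u₀' (x + t)) x := (h₀ (x + t)).comp_add_const x t
    have h2 : HasDerivAt (fun x => u₀ (x - t)) (u₀' (x - t)) x := (h₀ (x - t)).comp_sub_const x t
    have h3 := hasDerivAt_intervalIntegral_moving (S := univ) isOpen_univ
        (h := fun _ y => u₁ y) (h' := fun _ _ => 0)
        (c₁.comp continuous_snd).continuousOn continuousOn_const
        (fun t _ y => hasDerivAt_const _ _) (mem_univ x)
        (a := fun x => x - t) (b := fun x => x + t)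
        ((hasDerivAt_id x).sub_const t) ((hasDerivAt_id x).add_const t)
    have h4 := ((h1.add h2).add h3).const_smul (1 / 2 : ℝ)
    refine h4.of_eq (fun _ => rfl) ?_
    simp
  have ehalf : ∀ z : ℂ, (1 / 2 : ℝ) • z = z / 2 := fun z => by
    rw [Complex.real_smul]; push_cast; ring
  refine ⟨u, fun t x => u₁ (x + t) + u₀' (x + t) + ∫ s in (0 : ℝ)..t, -g (u s (x + (t - s))),
    fun t x => u₁ (x - t) - u₀' (x - t) + ∫ s in (0 : ℝ)..t, -g (u s (x - (t - s))),
    ⟨cu, ?_, ?_, ?_, ?_, ?_, ?_⟩, ?_, fun _ _ => rfl, fun _ _ => rfl⟩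
  · have := cp 1
    simp only [one_mul] at this
    fun_prop
  · have := cp (-1)
    simp only [neg_mul, one_mul, ← sub_eq_add_neg] at this
    fun_prop
  · intro t x
    have h1 := (hFt t x).add (hasDerivAt_duhamel_time (h := fun s y => -g (u s y)) csrc t x)
    refine h1.of_eq (fun s => hu s x) ?_
    simp only [ehalf]
    ring
  · intro t x
    have h1 := (hFx t x).add (hasDerivAt_duhamel_space (h := fun s y => -g (u s y)) csrc t x)
    refine h1.of_eq (fun s => hu t s) ?_
    simp only [ehalf]
    ring
  · intro t ξ
    have c : Continuous fun s => -g (u s (ξ - s)) :=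
      csrc.comp (by fun_prop : Continuous fun s : ℝ => (s, ξ - s))
    have h1 := (c.integral_hasStrictDerivAt 0 t).hasDerivAt.const_add (u₁ ξ + u₀' ξ)
    refine h1.of_eq (fun s => ?_) rfl
    simp
  · intro t ξ
    have c : Continuous fun s => -g (u s (ξ + s)) :=
      csrc.comp (by fun_prop : Continuous fun s : ℝ => (s, ξ + s))
    have h1 := (c.integral_hasStrictDerivAt 0 t).hasDerivAt.const_add (u₁ ξ - u₀' ξ)
    refine h1.of_eq (fun s => ?_) rfl
    simp only [add_sub_cancel_right, add_right_inj]
    refine intervalIntegral.integral_congr fun σ _ => ?_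
    rw [show ξ + s - (s - σ) = ξ + σ by ring]
  · intro x
    rw [hu]
    simp only [F, duhamel, intervalIntegral.integral_same, add_zero, sub_zero, ehalf]
    ring

end Wave

end KleinGordon

namespace KleinGordon

/-! ### Conserved quadratic densities and their positivity. -/

section Energy

/-- Adding the two transport equations gives ∂_t(Y+Z) = ∂_x(Y-Z). On an interval shrinking at unit
speed at both ends, the boundary terms total -2Y at the left and -2Z at the right, so nonnegative
densities can only leak out. -/
theorem integral_cone_le {Y Z S : ℝ → ℝ → ℝ} {τ : ℝ}
    (cY : ContinuousOn (fun v : ℝ × ℝ => Y v.1 v.2) (Icc 0 τ ×ˢ univ))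
    (cZ : ContinuousOn (fun v : ℝ × ℝ => Z v.1 v.2) (Icc 0 τ ×ˢ univ))
    (cS : ContinuousOn (fun v : ℝ × ℝ => S v.1 v.2) (Icc 0 τ ×ˢ univ))
    (dY : ∀ t ∈ Ioo 0 τ, ∀ ξ, HasDerivAt (fun s => Y s (ξ - s)) (S t (ξ - t)) t)
    (dZ : ∀ t ∈ Ioo 0 τ, ∀ ξ, HasDerivAt (fun s => Z s (ξ + s)) (-S t (ξ + t)) t)
    (hY : ∀ t ∈ Icc 0 τ, ∀ x, 0 ≤ Y t x) (hZ : ∀ t ∈ Icc 0 τ, ∀ x, 0 ≤ Z t x)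
    {t : ℝ} (ht : t ∈ Icc 0 τ) (c d : ℝ) :
    ∫ x in c..d, (Y t x + Z t x) ≤ ∫ x in (c - t)..(d + t), (Y 0 x + Z 0 x) := by
  let Y' : ℝ → ℝ → ℝ := fun s y => Y s (y - s)
  let Z' : ℝ → ℝ → ℝ := fun s y => Z s (y + s)
  have cY' : ContinuousOn (fun v : ℝ × ℝ => Y' v.1 v.2) (Icc 0 τ ×ˢ univ) :=
    cY.comp (f := fun v : ℝ × ℝ => (v.1, v.2 - v.1)) (by fun_prop)
      (fun v hv => ⟨hv.1, mem_univ _⟩)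
  have cZ' : ContinuousOn (fun v : ℝ × ℝ => Z' v.1 v.2) (Icc 0 τ ×ˢ univ) :=
    cZ.comp (f := fun v : ℝ × ℝ => (v.1, v.2 + v.1)) (by fun_prop)
      (fun v hv => ⟨hv.1, mem_univ _⟩)
  have cSY : ContinuousOn (fun v : ℝ × ℝ => S v.1 (v.2 - v.1)) (Icc 0 τ ×ˢ univ) :=
    cS.comp (f := fun v : ℝ × ℝ => (v.1, v.2 - v.1)) (by fun_prop)
      (fun v hv => ⟨hv.1, mem_univ _⟩)
  have cSZ : ContinuousOn (fun v : ℝ × ℝ => -S v.1 (v.2 + v.1)) (Icc 0 τ ×ˢ univ) :=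
    (cS.comp (f := fun v : ℝ × ℝ => (v.1, v.2 + v.1)) (by fun_prop)
      (fun v hv => ⟨hv.1, mem_univ _⟩)).neg
  have hsub : Ioo 0 τ ×ˢ (univ : Set ℝ) ⊆ Icc 0 τ ×ˢ univ := prod_mono Ioo_subset_Icc_self le_rfl
  have slice : ∀ {k : ℝ → ℝ → ℝ}, ContinuousOn (fun v : ℝ × ℝ => k v.1 v.2) (Icc 0 τ ×ˢ univ) →
      ∀ s ∈ Icc 0 τ, Continuous (k s) := by
    intro k hk s hs
    have : Continuous fun y : ℝ => (fun v : ℝ × ℝ => k v.1 v.2) (s, y) :=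
      hk.comp_continuous (by fun_prop) (fun y => ⟨hs, mem_univ _⟩)
    exact this
  -- Each density is integrated in its own characteristic coordinate, where its time derivative is
  -- the source; neither Y nor Z need be differentiable in x.
  let I : ℝ → ℝ := fun s => (∫ y in (c - t + 2 * s)..(d + t), Y' s y) +
    ∫ y in (c - t)..(d + t - 2 * s), Z' s y
  have hI : ∀ s ∈ Icc 0 τ, I s = ∫ x in (c - t + s)..(d + t - s), (Y s x + Z s x) := by
    intro s hs
    simp only [I, Y', Z']
    rw [intervalIntegral.integral_comp_sub_right (fun x => Y s x) s,
      intervalIntegral.integral_comp_add_right (fun x => Z s x) s,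
      intervalIntegral.integral_add ((slice cY s hs).intervalIntegrable _ _)
        ((slice cZ s hs).intervalIntegrable _ _)]
    congr 2 <;> ring
  have cI : ContinuousOn I (Icc 0 τ) := by
    have key : ∀ {k : ℝ → ℝ → ℝ}, ContinuousOn (fun v : ℝ × ℝ => k v.1 v.2) (Icc 0 τ ×ˢ univ) →
        ∀ l r : ℝ → ℝ, Continuous l → Continuous r →
        ContinuousOn (fun s => ∫ y in (l s)..(r s), k s y) (Icc 0 τ) := by
      intro k hk l r hl hr
      have h1 := continuousOn_intervalIntegral_param hk
      have h2 : ∀ b : ℝ → ℝ, Continuous b →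
          ContinuousOn (fun s => ∫ y in (0 : ℝ)..(b s), k s y) (Icc 0 τ) := fun b hb =>
        h1.comp (f := fun s : ℝ => (s, b s)) (by fun_prop) (fun s hs => ⟨hs, mem_univ _⟩)
      refine ((h2 r hr).sub (h2 l hl)).congr fun s hs => ?_
      exact (intervalIntegral.integral_interval_sub_left ((slice hk s hs).intervalIntegrable _ _)
        ((slice hk s hs).intervalIntegrable _ _)).symm
    exact (key cY' _ _ (by fun_prop) (by fun_prop)).add (key cZ' _ _ (by fun_prop) (by fun_prop))
  have dI : ∀ s ∈ Ioo 0 τ, HasDerivAt I (-(2 * Y s (c - t + s)) - 2 * Z s (d + t - s)) s := by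
    intro s hs
    have hs' := Ioo_subset_Icc_self hs
    have h1 := hasDerivAt_intervalIntegral_moving isOpen_Ioo (cY'.mono hsub) (cSY.mono hsub)
      (fun s hs y => dY s hs y) hs
      (a := fun s => c - t + 2 * s) (b := fun _ => d + t) (a' := 2) (b' := 0)
      (by simpa using ((hasDerivAt_id s).const_mul 2).const_add (c - t)) (hasDerivAt_const _ _)
    have h2 := hasDerivAt_intervalIntegral_moving isOpen_Ioo (cZ'.mono hsub) (cSZ.mono hsub)
      (fun s hs y => dZ s hs y) hs
      (a := fun _ => c - t) (b := fun s => d + t - 2 * s) (a' := 0) (b' := -2)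
      (hasDerivAt_const _ _) (by simpa using ((hasDerivAt_id s).const_mul 2).const_sub (d + t))
    refine (h1.add h2).of_eq (fun _ => rfl) ?_
    have e1 : ∫ y in (c - t + 2 * s)..(d + t), S s (y - s) =
        ∫ x in (c - t + s)..(d + t - s), S s x := by
      rw [intervalIntegral.integral_comp_sub_right (fun x => S s x) s]
      congr 1; ring
    have e2 : ∫ y in (c - t)..(d + t - 2 * s), -S s (y + s) =
        -∫ x in (c - t + s)..(d + t - s), S s x := by
      rw [intervalIntegral.integral_neg, intervalIntegral.integral_comp_add_right (fun x => S s x) s]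
      congr 2; ring
    rw [e1, e2]
    simp only [Y', Z', smul_eq_mul]
    rw [show c - t + 2 * s - s = c - t + s by ring, show d + t - 2 * s + s = d + t - s by ring]
    ring
  have anti : AntitoneOn I (Icc 0 τ) := by
    refine antitoneOn_of_deriv_nonpos (convex_Icc _ _) cI ?_ ?_
    · rw [interior_Icc]
      exact fun s hs => (dI s hs).differentiableAt.differentiableWithinAt
    · rw [interior_Icc]
      intro s hs
      rw [(dI s hs).deriv]
      have := hY s (Ioo_subset_Icc_self hs) (c - t + s)
      have := hZ s (Ioo_subset_Icc_self hs) (d + t - s)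
      linarith
  have h0 : (0 : ℝ) ∈ Icc 0 τ := ⟨le_rfl, ht.1.trans ht.2⟩
  have := anti h0 ht ht.1
  rw [hI t ht, hI 0 h0] at this
  simpa using this

variable (F : ℝ → ℝ) (a : ℝ)

/-- The potential energy density, as a function of `s = |u|² / a²`. -/
noncomputable def potential (s : ℝ) : ℝ := ∫ y in (1 : ℝ)..s, (F (a ^ 2 * y) - F (a ^ 2))

/-- The energy density transported along one family of characteristics, as a function of
`s = |u|² / a²` and of the relative characteristic derivative `P`. -/
noncomputable def density (α κ s : ℝ) (P : ℂ) : ℝ :=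
  (1 + α) / 2 * (s * (P.re ^ 2 + P.im ^ 2)) + κ * ((s - 1) * P.im) +
    (1 - α) / 2 * potential F a s

/-- The source term in the transport equation for `density`. -/
noncomputable def densitySource (k ω α s : ℝ) (P Q : ℂ) : ℝ :=
  (1 + α) * s * ((ω + k) * (P.re * Q.im - P.im * Q.re) - (F (a ^ 2 * s) - F (a ^ 2)) * P.re) +
  (k + α * ω) * (2 * s * Q.re * P.im + (s - 1) * (-(ω + k) * Q.re - (ω - k) * P.re -
    (P.re * Q.im + P.im * Q.re))) + (1 - α) * (F (a ^ 2 * s) - F (a ^ 2)) * s * Q.re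

/-- Reflection x ↦ -x exchanges P with Q, k with -k and α with -α. That the source is odd under it
is the conservation law: what one family of characteristics loses the other gains. -/
theorem densitySource_swap (k ω α s : ℝ) (P Q : ℂ) :
    densitySource F a (-k) ω (-α) s Q P = -densitySource F a k ω α s P Q := by
  simp only [densitySource]; ring

variable {F a}

theorem hasDerivAt_potential (hF : Continuous F) (s : ℝ) :
    HasDerivAt (potential F a) (F (a ^ 2 * s) - F (a ^ 2)) s :=
  ((by fun_prop : Continuous fun y => F (a ^ 2 * y) - F (a ^ 2)).integral_hasStrictDerivAt
    1 s).hasDerivAt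

/-- Along the left-moving characteristic U' = q and p' = -F(|U|²)U, so P' = -F(|U|²) - (P +
i(ω+k))(Q + i(ω-k)) and s' = 2s·Re Q. The source is what the product and chain rules then yield. -/
theorem hasDerivAt_density (hF : Continuous F) {k ω α : ℝ} {U p : ℝ → ℂ} {q : ℂ} {t : ℝ}
    (ha : a ≠ 0) (hk : ω ^ 2 = k ^ 2 + F (a ^ 2)) (hU : HasDerivAt U q t) (h0 : U t ≠ 0)
    (hp : HasDerivAt p (-((F (‖U t‖ ^ 2) : ℂ) * U t)) t) :
    HasDerivAt (fun s => density F a α (k + α * ω) (‖U s‖ ^ 2 / a ^ 2)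
        (p s / U s - Complex.I * (ω + k : ℝ)))
      (densitySource F a k ω α (‖U t‖ ^ 2 / a ^ 2) (p t / U t - Complex.I * (ω + k : ℝ))
        (q / U t - Complex.I * (ω - k : ℝ))) t := by
  set P : ℝ → ℂ := fun s => p s / U s - Complex.I * (ω + k : ℝ) with hPdef
  set Q : ℂ := q / U t - Complex.I * (ω - k : ℝ) with hQdef
  set s : ℝ → ℝ := fun σ => ‖U σ‖ ^ 2 / a ^ 2 with hsdef
  have hq : q = U t * (Q + Complex.I * (ω - k : ℝ)) := by rw [hQdef]; field_simp; ring
  have hpt : p t = U t * (P t + Complex.I * (ω + k : ℝ)) := by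
    simp only [hPdef]; field_simp; ring
  have hPd : HasDerivAt P (-(F (‖U t‖ ^ 2) : ℂ) -
      (P t + Complex.I * (ω + k : ℝ)) * (Q + Complex.I * (ω - k : ℝ))) t := by
    have h1 := (hp.div hU h0).sub_const (Complex.I * (ω + k : ℝ))
    refine h1.of_eq (fun _ => rfl) ?_
    rw [hpt, hq]
    field_simp
  have hUre : HasDerivAt (fun σ => (U σ).re) q.re t :=
    (Complex.reCLM.hasFDerivAt.comp_hasDerivAt t hU)
  have hUim : HasDerivAt (fun σ => (U σ).im) q.im t :=
    (Complex.imCLM.hasFDerivAt.comp_hasDerivAt t hU)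
  have hns : ∀ z : ℂ, ‖z‖ ^ 2 = z.re ^ 2 + z.im ^ 2 := fun z => by
    rw [← Complex.normSq_eq_norm_sq, Complex.normSq_apply]; ring
  have hsd : HasDerivAt s (2 * s t * Q.re) t := by
    refine (((hUre.pow 2).add (hUim.pow 2)).div_const (a ^ 2)).of_eq (fun σ => ?_) ?_
    · simp only [hsdef, hns]; rfl
    · simp only [hsdef, hns]
      rw [hq]
      simp
      field_simp
      ring
  have hPre : HasDerivAt (fun σ => (P σ).re) _ t :=
    (Complex.reCLM.hasFDerivAt.comp_hasDerivAt t hPd)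
  have hPim : HasDerivAt (fun σ => (P σ).im) _ t :=
    (Complex.imCLM.hasFDerivAt.comp_hasDerivAt t hPd)
  have hW : HasDerivAt (fun σ => potential F a (s σ))
      ((F (a ^ 2 * s t) - F (a ^ 2)) * (2 * s t * Q.re)) t :=
    (hasDerivAt_potential hF (s t)).comp t hsd
  have has : a ^ 2 * s t = ‖U t‖ ^ 2 := by simp only [hsdef]; field_simp
  have hfin := (((hsd.mul ((hPre.pow 2).add (hPim.pow 2))).const_mul ((1 + α) / 2)).add
    (((hsd.sub_const 1).mul hPim).const_mul (k + α * ω))).add (hW.const_mul ((1 - α) / 2))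
  refine hfin.of_eq (fun _ => rfl) ?_
  change densitySource F a k ω α (s t) (P t) Q = _
  simp only [densitySource]
  rw [has]
  simp
  -- The dispersion relation: the constant term (ω+k)(ω-k) of the product cancels against F(a²), so
  -- only F(|U|²) - F(a²) survives.
  have e : F (a ^ 2) = ω ^ 2 - k ^ 2 := by linarith
  rw [e]
  ring

/-- Second-order Taylor expansion of the potential at s = 1, obtained by integrating the first-order
expansion of F; only differentiability of F at a² is needed. -/
theorem exists_potential_bounds (hF : Continuous F) {F' : ℝ} (hd : HasDerivAt F F' (a ^ 2))
    {η : ℝ} (hη : 0 < η) : ∃ ε > 0, ∀ s, |s - 1| ≤ ε →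
      |potential F a s - a ^ 2 * F' / 2 * (s - 1) ^ 2| ≤ η * (s - 1) ^ 2 := by
  have h1 : HasDerivAt (fun y => F (a ^ 2 * y) - F (a ^ 2)) (a ^ 2 * F') 1 := by
    have h2 : HasDerivAt (fun y : ℝ => a ^ 2 * y) (a ^ 2) 1 := by
      simpa using (hasDerivAt_id (1 : ℝ)).const_mul (a ^ 2)
    have h3 : HasDerivAt F F' (a ^ 2 * 1) := by simpa using hd
    refine ((h3.comp 1 h2).sub_const (F (a ^ 2))).of_eq (fun _ => rfl) (by ring)
  have h4 := (hasDerivAt_iff_isLittleO.1 h1).def hη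
  obtain ⟨ε, hε, hb⟩ := Metric.eventually_nhds_iff_ball.1 h4
  refine ⟨ε / 2, by positivity, fun s hs => ?_⟩
  have hc : Continuous fun y => F (a ^ 2 * y) - F (a ^ 2) := by fun_prop
  have e : potential F a s - a ^ 2 * F' / 2 * (s - 1) ^ 2 =
      ∫ y in (1 : ℝ)..s, (F (a ^ 2 * y) - F (a ^ 2) - a ^ 2 * F' * (y - 1)) := by
    rw [intervalIntegral.integral_sub (hc.intervalIntegrable _ _)
      (by apply Continuous.intervalIntegrable; fun_prop), intervalIntegral.integral_const_mul,
      intervalIntegral.integral_comp_sub_right (fun y => y) 1, integral_id, potential]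
    ring
  rw [e]
  have := intervalIntegral.norm_integral_le_of_norm_le_const (a := 1) (b := s)
    (C := η * |s - 1|) (f := fun y => F (a ^ 2 * y) - F (a ^ 2) - a ^ 2 * F' * (y - 1))
    (fun y hy => by
      have hy2 : |y - 1| ≤ |s - 1| := by
        rcases le_total 1 s with h | h
        · rw [uIoc_of_le h] at hy
          rw [abs_of_nonneg (by linarith [hy.1]), abs_of_nonneg (by linarith)]
          linarith [hy.2]
        · rw [uIoc_of_ge h] at hy
          rw [abs_of_nonpos (by linarith [hy.2]), abs_of_nonpos (by linarith)]
          linarith [hy.1]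
      have h5 := hb y (by
        rw [Metric.mem_ball, Real.dist_eq]; linarith)
      simp only [mul_one, sub_self, sub_zero, smul_eq_mul] at h5
      rw [Real.norm_eq_abs (y - 1)] at h5
      rw [mul_comm (a ^ 2 * F')]
      refine h5.trans ?_
      gcongr)
  rw [Real.norm_eq_abs] at this
  refine this.trans (le_of_eq ?_)
  rw [mul_assoc, ← sq, sq_abs]

theorem abs_mul_le_sq_add_sq (x y : ℝ) : |x * y| ≤ x ^ 2 + y ^ 2 := by
  rw [abs_le]
  constructor <;> nlinarith [sq_nonneg (x + y), sq_nonneg (x - y)]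

/-- At s = 1 the density is to leading order the form (1+α)/2·|P|² + κ(s-1)·Im P +
(1-α)/4·a²F'·(s-1)². The hypothesis on κ is its discriminant condition, which is strict and so
survives the higher-order errors for s near 1. -/
theorem exists_density_bounds (hF : Continuous F) {F' : ℝ} (hd : HasDerivAt F F' (a ^ 2))
    {α κ : ℝ} (h1 : -1 < α) (h2 : α < 1) (hκ : 2 * κ ^ 2 < (1 - α ^ 2) * (a ^ 2 * F')) :
    ∃ ε > 0, ∃ c > 0, ∃ C > 0, ∀ s, |s - 1| ≤ ε → ∀ P : ℂ,
      c * (‖P‖ ^ 2 + (s - 1) ^ 2) ≤ density F a α κ s P ∧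
      density F a α κ s P ≤ C * (‖P‖ ^ 2 + (s - 1) ^ 2) := by
  set μ := a ^ 2 * F' with hμ
  have hμ0 : 0 < μ := by
    have : 0 < 1 - α ^ 2 := by nlinarith
    by_contra hcon
    nlinarith [sq_nonneg κ]
  -- η bounds both errors, the deviation of s from 1 in the kinetic coefficient and the Taylor
  -- remainder of the potential, while leaving the discriminant negative.
  obtain ⟨η, hη0, hη1, hη2, hη3⟩ : ∃ η > 0, η ≤ 1 / 4 ∧ η < μ / 2 ∧
      κ ^ 2 < ((1 + α) * (1 - η)) * ((1 - α) * (μ / 2 - η)) := by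
    have hcont : Continuous fun η : ℝ => ((1 + α) * (1 - η)) * ((1 - α) * (μ / 2 - η)) := by
      fun_prop
    have hlt : κ ^ 2 < ((1 + α) * (1 - 0)) * ((1 - α) * (μ / 2 - 0)) := by nlinarith
    have ev := (hcont.tendsto 0).eventually (lt_mem_nhds hlt)
    obtain ⟨δ, hδ, hb⟩ := Metric.eventually_nhds_iff_ball.1 ev
    refine ⟨min (min (δ / 2) (1 / 4)) (μ / 4), by positivity,
      (min_le_left _ _).trans (min_le_right _ _), (min_le_right _ _).trans_lt (by linarith),
      hb _ ?_⟩
    rw [Metric.mem_ball, Real.dist_eq, sub_zero, abs_of_pos (by positivity)]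
    exact ((min_le_left _ _).trans (min_le_left _ _)).trans_lt (by linarith)
  obtain ⟨ε, hε, hW⟩ := exists_potential_bounds hF hd hη0
  set A := (1 + α) * (1 - η) with hA
  set B := (1 - α) * (μ / 2 - η) with hB
  have hA0 : 0 < A := mul_pos (by linarith) (by linarith)
  have hB0 : 0 < B := mul_pos (by linarith) (by linarith)
  -- This c gives (A-c)(B-c) = κ² + c² ≥ κ², so the form stays nonnegative after c times the squared
  -- norm is subtracted.
  set c := (A * B - κ ^ 2) / (A + B) with hc
  have hc0 : 0 < c := div_pos (by linarith) (by linarith)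
  have hcA : c ≤ A := by
    rw [hc, div_le_iff₀ (by linarith)]; nlinarith [sq_nonneg κ]
  have hcB : c ≤ B := by
    rw [hc, div_le_iff₀ (by linarith)]; nlinarith [sq_nonneg κ]
  have hdet : κ ^ 2 ≤ (A - c) * (B - c) := by
    have : c * (A + B) = A * B - κ ^ 2 := by rw [hc]; field_simp
    nlinarith [sq_nonneg c]
  have hquad : ∀ x y : ℝ, 0 ≤ (A - c) * x ^ 2 + 2 * κ * x * y + (B - c) * y ^ 2 := by
    intro x y
    rcases (sub_nonneg.2 hcA).eq_or_lt with h | h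
    · have hk0 : κ = 0 := by
        rw [← h] at hdet; nlinarith [sq_nonneg κ]
      rw [← h, hk0]
      have := mul_nonneg (sub_nonneg.2 hcB) (sq_nonneg y)
      linarith
    · have h5 : 0 ≤ (A - c) * ((A - c) * x ^ 2 + 2 * κ * x * y + (B - c) * y ^ 2) := by
        have := mul_nonneg (sub_nonneg.2 hdet) (sq_nonneg y)
        nlinarith [sq_nonneg ((A - c) * x + κ * y)]
      exact nonneg_of_mul_nonneg_right h5 h
  -- Half of c, because A and B bound twice the coefficients of the density. The upper constant adds
  -- crude bounds for its three terms.
  refine ⟨min ε η, by positivity, c / 2, by positivity, 2 + |κ| + 2 * μ, by positivity,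
    fun s hs P => ?_⟩
  have hs1 := hs.trans (min_le_left _ _)
  have hs2 := abs_le.1 (hs.trans (min_le_right _ _))
  have hWs := abs_le.1 (hW s hs1)
  have hP : ‖P‖ ^ 2 = P.re ^ 2 + P.im ^ 2 := by
    rw [← Complex.normSq_eq_norm_sq, Complex.normSq_apply]; ring
  rw [hP]
  have hr := sq_nonneg P.re
  have hi := sq_nonneg P.im
  have hm := sq_nonneg (s - 1)
  simp only [density]
  constructor
  · have g1 : A * (P.re ^ 2 + P.im ^ 2) ≤ (1 + α) * (s * (P.re ^ 2 + P.im ^ 2)) := by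
      rw [hA, mul_assoc]
      apply mul_le_mul_of_nonneg_left _ (by linarith)
      apply mul_le_mul_of_nonneg_right _ (by linarith)
      linarith
    have g2 : B * (s - 1) ^ 2 ≤ (1 - α) * potential F a s := by
      rw [hB, mul_assoc]
      apply mul_le_mul_of_nonneg_left _ (by linarith)
      linarith
    have g3 := hquad P.im (s - 1)
    have g4 := mul_nonneg (sub_nonneg.2 hcA) hr
    linarith
  · have g1 : (1 + α) / 2 * (s * (P.re ^ 2 + P.im ^ 2)) ≤ 2 * (P.re ^ 2 + P.im ^ 2) := by
      rw [← mul_assoc]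
      apply mul_le_mul_of_nonneg_right _ (by linarith)
      calc (1 + α) / 2 * s ≤ 1 * 2 :=
            mul_le_mul (by linarith) (by linarith) (by linarith) (by norm_num)
        _ = 2 := by norm_num
    have g2 : (1 - α) / 2 * potential F a s ≤ 2 * μ * (s - 1) ^ 2 := by
      have w0 : η * (s - 1) ^ 2 ≤ μ / 2 * (s - 1) ^ 2 :=
        mul_le_mul_of_nonneg_right hη2.le hm
      have w1 : potential F a s ≤ μ * (s - 1) ^ 2 := by linarith
      have w2 : 0 ≤ μ * (s - 1) ^ 2 := by positivity
      calc (1 - α) / 2 * potential F a s ≤ (1 - α) / 2 * (μ * (s - 1) ^ 2) :=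
            mul_le_mul_of_nonneg_left w1 (by linarith)
        _ ≤ 1 * (μ * (s - 1) ^ 2) := mul_le_mul_of_nonneg_right (by linarith) w2
        _ ≤ _ := by linarith
    have g3 : κ * ((s - 1) * P.im) ≤ |κ| * ((s - 1) ^ 2 + P.im ^ 2) := by
      refine (le_abs_self _).trans ?_
      rw [abs_mul]
      exact mul_le_mul_of_nonneg_left (abs_mul_le_sq_add_sq _ _) (abs_nonneg κ)
    have g4 := mul_nonneg (abs_nonneg κ) hr
    have g5 := mul_nonneg hμ0.le hr
    have g6 := mul_nonneg hμ0.le hi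
    have e : (2 + |κ| + 2 * μ) * (P.re ^ 2 + P.im ^ 2 + (s - 1) ^ 2) =
        2 * (P.re ^ 2 + P.im ^ 2) + 2 * μ * (s - 1) ^ 2 + |κ| * ((s - 1) ^ 2 + P.im ^ 2) +
        (|κ| * P.re ^ 2 + 2 * (μ * P.re ^ 2) + 2 * (μ * P.im ^ 2) + 2 * (s - 1) ^ 2) := by ring
    rw [e]
    linarith

/-- The identity (k+αω)² = (k²-ω²)(1-α²) + (ω+αk)² shows that, when |ω| < |k|, the best choice is α
= -ω/k, and the condition becomes 2(k²-ω²) < μ, that is -2f₀ < μ. When |ω| > |k|, α = -k/ω makes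
k+αω vanish. When |ω| = |k| ≠ 0 both choices degenerate to ±1, and α must be taken slightly inside
the interval. -/
theorem exists_moment {k ω f₀ μ : ℝ} (hkω : (k, ω) ≠ (0, 0)) (hdisp : ω ^ 2 = k ^ 2 + f₀)
    (hμ : 2 * max 0 (-f₀) < μ) :
    ∃ α : ℝ, -1 < α ∧ α < 1 ∧ 2 * (k + α * ω) ^ 2 < (1 - α ^ 2) * μ := by
  have hm0 : 0 < μ := lt_of_le_of_lt (by positivity) hμ
  have hm1 : 2 * (-f₀) < μ := lt_of_le_of_lt (by gcongr; exact le_max_right _ _) hμ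
  rcases lt_trichotomy f₀ 0 with h | h | h
  · have hk : k ≠ 0 := by rintro rfl; nlinarith [sq_nonneg ω]
    have hk2 : 0 < k ^ 2 := by positivity
    have hr : (ω / k) ^ 2 < 1 := by rw [div_pow, div_lt_one hk2]; linarith
    have habs := abs_lt.1 ((sq_lt_one_iff_abs_lt_one _).1 hr)
    refine ⟨-(ω / k), by linarith [habs.2], by linarith [habs.1], ?_⟩
    have e1 : k + -(ω / k) * ω = -f₀ / k := by field_simp; linarith
    have e2 : 1 - (-(ω / k)) ^ 2 = -f₀ / k ^ 2 := by field_simp; linarith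
    rw [e1, e2, div_pow]
    have : -f₀ / k ^ 2 * (2 * (-f₀)) < -f₀ / k ^ 2 * μ :=
      mul_lt_mul_of_pos_left hm1 (div_pos (by linarith) hk2)
    calc 2 * ((-f₀) ^ 2 / k ^ 2) = -f₀ / k ^ 2 * (2 * (-f₀)) := by ring
      _ < _ := this
  · subst h
    have hk : k ≠ 0 := by
      rintro rfl
      apply hkω
      have : ω = 0 := by simpa using hdisp
      rw [this]
    have hk2 : 0 < k ^ 2 := by positivity
    have hω : ω = k ∨ ω = -k := sq_eq_sq_iff_eq_or_eq_neg.1 (by linarith)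
    -- With 1-|α| = η the requirement is 2k²η² < (2η-η²)μ; this η satisfies η(2k²+μ) = μ < 2μ.
    set η := μ / (2 * k ^ 2 + μ) with hη
    have hη0 : 0 < η := by positivity
    have hη1 : η < 1 := by rw [hη, div_lt_one (by positivity)]; linarith
    have hη2 : η * (2 * k ^ 2 + μ) = μ := by rw [hη]; field_simp
    have hη3 : 2 * (k * η) ^ 2 < (1 - (1 - η) ^ 2) * μ := by
      nlinarith [mul_pos hη0 hm0, mul_pos (mul_pos hη0 hη0) hm0, mul_pos hη0 hη0,
        mul_pos hη0 (sub_pos.2 hη1), mul_pos (mul_pos hη0 (sub_pos.2 hη1)) hm0]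
    rcases hω with rfl | rfl
    · refine ⟨-(1 - η), by linarith, by linarith, ?_⟩
      calc 2 * (ω + -(1 - η) * ω) ^ 2 = 2 * (ω * η) ^ 2 := by ring
        _ < _ := hη3
        _ = _ := by ring
    · refine ⟨1 - η, by linarith, by linarith, ?_⟩
      calc 2 * (k + (1 - η) * -k) ^ 2 = 2 * (k * η) ^ 2 := by ring
        _ < _ := hη3
  · have hω : ω ≠ 0 := by rintro rfl; nlinarith [sq_nonneg k]
    have hω2 : 0 < ω ^ 2 := by positivity
    have hr : (k / ω) ^ 2 < 1 := by rw [div_pow, div_lt_one hω2]; linarith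
    have habs := abs_lt.1 ((sq_lt_one_iff_abs_lt_one _).1 hr)
    refine ⟨-(k / ω), by linarith [habs.2], by linarith [habs.1], ?_⟩
    have e1 : k + -(k / ω) * ω = 0 := by field_simp; ring
    rw [e1]
    have : 0 < (1 - (-(k / ω)) ^ 2) * μ := mul_pos (by linarith [neg_sq (k / ω)]) hm0
    linarith

end Energy

end KleinGordon

namespace KleinGordon

/-! ### Energy inequality, Sobolev bound and the continuity argument. -/

section Stability

/-- The squared modulus of `u`, relative to the amplitude `a`. -/
noncomputable def relMod (a : ℝ) (u : ℝ → ℝ → ℂ) (t x : ℝ) : ℝ := ‖u t x‖ ^ 2 / a ^ 2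

/-- A logarithmic derivative of `u`, relative to that of the periodic wave. -/
noncomputable def relDer (c : ℝ) (u p : ℝ → ℝ → ℂ) (t x : ℝ) : ℂ :=
  p t x / u t x - Complex.I * (c : ℂ)

/-- The quadratic form controlled by the energy. -/
noncomputable def quadDensity (a k ω : ℝ) (u p q : ℝ → ℝ → ℂ) (t x : ℝ) : ℝ :=
  ‖relDer (ω + k) u p t x‖ ^ 2 + ‖relDer (ω - k) u q t x‖ ^ 2 + (relMod a u t x - 1) ^ 2

variable {F : ℝ → ℝ} {a k ω : ℝ} {u p q : ℝ → ℝ → ℂ}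

theorem ne_zero_of_relMod {ε t x : ℝ} (hε : ε < 1) (h : |relMod a u t x - 1| ≤ ε) :
    u t x ≠ 0 := by
  intro h0
  simp only [relMod, h0, norm_zero, ne_eq, OfNat.ofNat_ne_zero, not_false_eq_true, zero_pow,
    zero_div, zero_sub, abs_neg, abs_one] at h
  linarith

namespace IsWave

variable {g : ℂ → ℂ}

theorem hasDerivAt_left (h : IsWave g u p q) (t ξ : ℝ) :
    HasDerivAt (fun s => u s (ξ - s)) (q t (ξ - t)) t := by
  have hp := h.cont_p
  have hq := h.cont_q
  have := hasDerivAt_comp_of_partial (f := u) (f₁ := fun t x => (p t x + q t x) / 2)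
    (f₂ := fun t x => (p t x - q t x) / 2) (τ := fun s => s) (ξ := fun s => ξ - s) (s := t)
    (Eventually.of_forall fun v => h.dt v.1 v.2) (Eventually.of_forall fun v => h.dx v.1 v.2)
    (by fun_prop) (by fun_prop) (hasDerivAt_id t) ((hasDerivAt_id t).const_sub ξ)
  refine this.of_eq (fun _ => rfl) ?_
  simp only [one_smul, neg_smul]
  ring

theorem hasDerivAt_right (h : IsWave g u p q) (t ξ : ℝ) :
    HasDerivAt (fun s => u s (ξ + s)) (p t (ξ + t)) t := by
  have hp := h.cont_p
  have hq := h.cont_q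
  have := hasDerivAt_comp_of_partial (f := u) (f₁ := fun t x => (p t x + q t x) / 2)
    (f₂ := fun t x => (p t x - q t x) / 2) (τ := fun s => s) (ξ := fun s => ξ + s) (s := t)
    (Eventually.of_forall fun v => h.dt v.1 v.2) (Eventually.of_forall fun v => h.dx v.1 v.2)
    (by fun_prop) (by fun_prop) (hasDerivAt_id t) ((hasDerivAt_id t).const_add ξ)
  refine this.of_eq (fun _ => rfl) ?_
  simp only [one_smul]
  ring

theorem continuous_relMod (h : IsWave g u p q) (a : ℝ) :
    Continuous fun v : ℝ × ℝ => relMod a u v.1 v.2 := by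
  have := h.cont_u
  unfold relMod
  fun_prop

theorem continuousOn_relDer {S : Set (ℝ × ℝ)} {p' : ℝ → ℝ → ℂ}
    (hu : Continuous fun v : ℝ × ℝ => u v.1 v.2) (hp : Continuous fun v : ℝ × ℝ => p' v.1 v.2)
    (h0 : ∀ v ∈ S, u v.1 v.2 ≠ 0) (c : ℝ) :
    ContinuousOn (fun v : ℝ × ℝ => relDer c u p' v.1 v.2) S :=
  (hp.continuousOn.div hu.continuousOn h0).sub continuousOn_const

theorem continuousOn_quadDensity (h : IsWave g u p q) {S : Set (ℝ × ℝ)}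
    (h0 : ∀ v ∈ S, u v.1 v.2 ≠ 0) :
    ContinuousOn (fun v : ℝ × ℝ => quadDensity a k ω u p q v.1 v.2) S :=
  (((continuousOn_relDer h.cont_u h.cont_p h0 _).norm.pow 2).add
    ((continuousOn_relDer h.cont_u h.cont_q h0 _).norm.pow 2)).add
    (((h.continuous_relMod a).continuousOn.sub continuousOn_const).pow 2)

/-- The cone inequality for the densities with parameters (k, α) and (-k, -α), sandwiched by their
coercivity bounds. The factor 2 on the right appears because both densities contain (s-1)², which
the quadratic form counts once. -/
theorem integral_quadDensity_le (hF : Continuous F) (ha : 0 < a)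
    (hdisp : ω ^ 2 = k ^ 2 + F (a ^ 2))
    (h : IsWave (fun z => (F (‖z‖ ^ 2) : ℂ) * z) u p q) {α ε c C : ℝ} (hε : ε < 1)
    (hc : 0 < c)
    (hd₁ : ∀ s, |s - 1| ≤ ε → ∀ P : ℂ,
      c * (‖P‖ ^ 2 + (s - 1) ^ 2) ≤ density F a α (k + α * ω) s P ∧
      density F a α (k + α * ω) s P ≤ C * (‖P‖ ^ 2 + (s - 1) ^ 2))
    (hd₂ : ∀ s, |s - 1| ≤ ε → ∀ P : ℂ,
      c * (‖P‖ ^ 2 + (s - 1) ^ 2) ≤ density F a (-α) (-k + -α * ω) s P ∧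
      density F a (-α) (-k + -α * ω) s P ≤ C * (‖P‖ ^ 2 + (s - 1) ^ 2))
    {τ : ℝ} (hτ : ∀ t ∈ Icc 0 τ, ∀ x, |relMod a u t x - 1| ≤ ε) {t : ℝ} (ht : t ∈ Icc 0 τ)
    {l r : ℝ} (hlr : l ≤ r) :
    c * ∫ x in l..r, quadDensity a k ω u p q t x ≤
      2 * C * ∫ x in (l - t)..(r + t), quadDensity a k ω u p q 0 x := by
  have h0 : ∀ v ∈ Icc 0 τ ×ˢ (univ : Set ℝ), u v.1 v.2 ≠ 0 := fun v hv =>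
    ne_zero_of_relMod hε (hτ v.1 hv.1 v.2)
  have cP := continuousOn_relDer h.cont_u h.cont_p h0 (ω + k)
  have cQ := continuousOn_relDer h.cont_u h.cont_q h0 (ω - k)
  have cs := (h.continuous_relMod a).continuousOn (s := Icc 0 τ ×ˢ (univ : Set ℝ))
  have cW : Continuous (potential F a) :=
    continuous_iff_continuousAt.2 fun s => (hasDerivAt_potential hF s).continuousAt
  have cre : Continuous Complex.re := Complex.continuous_re
  have cim : Continuous Complex.im := Complex.continuous_im
  have cdens : ∀ α κ : ℝ, Continuous fun z : ℝ × ℂ => density F a α κ z.1 z.2 := by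
    intro α κ
    unfold density
    fun_prop
  have csrc : Continuous fun z : ℝ × ℂ × ℂ => densitySource F a k ω α z.1 z.2.1 z.2.2 := by
    unfold densitySource
    fun_prop
  have ha0 : a ≠ 0 := ha.ne'
  have hC0 : 0 ≤ C := by
    have := (hd₁ 1 (by simpa using (abs_nonneg _).trans (hτ t ht 0)) 1)
    simp only [norm_one, one_pow, sub_self, ne_eq, OfNat.ofNat_ne_zero, not_false_eq_true,
      zero_pow, add_zero, mul_one] at this
    linarith
  have key := integral_cone_le (τ := τ)
    (Y := fun t x => density F a α (k + α * ω) (relMod a u t x) (relDer (ω + k) u p t x))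
    (Z := fun t x => density F a (-α) (-k + -α * ω) (relMod a u t x) (relDer (ω - k) u q t x))
    (S := fun t x => densitySource F a k ω α (relMod a u t x) (relDer (ω + k) u p t x)
      (relDer (ω - k) u q t x))
    ((cdens _ _).comp_continuousOn (cs.prodMk cP)) ((cdens _ _).comp_continuousOn (cs.prodMk cQ))
    (csrc.comp_continuousOn (cs.prodMk (cP.prodMk cQ)))
    (fun t ht ξ => by
      exact hasDerivAt_density hF ha0 hdisp (h.hasDerivAt_left t ξ)
        (h0 (t, ξ - t) ⟨Ioo_subset_Icc_self ht, mem_univ _⟩) (h.dp t ξ))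
    (fun t ht ξ => by
      have := hasDerivAt_density (k := -k) (ω := ω) (α := -α) hF ha0 (by rw [neg_sq]; exact hdisp)
        (h.hasDerivAt_right t ξ)
        (h0 (t, ξ + t) ⟨Ioo_subset_Icc_self ht, mem_univ _⟩) (h.dq t ξ)
      rw [densitySource_swap] at this
      simp only [← sub_eq_add_neg, sub_neg_eq_add] at this
      refine this.of_eq (fun s => ?_) rfl
      simp only [relMod, relDer, sub_eq_add_neg])
    (fun t ht x => by
      refine le_trans ?_ (hd₁ _ (hτ t ht x) _).1
      positivity)
    (fun t ht x => by
      refine le_trans ?_ (hd₂ _ (hτ t ht x) _).1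
      positivity) ht l r
  have hi : ∀ t ∈ Icc 0 τ, Continuous fun x => quadDensity a k ω u p q t x := fun t ht =>
    (h.continuousOn_quadDensity h0).comp_continuous (f := fun x : ℝ => (t, x)) (by fun_prop)
      (fun x => ⟨ht, mem_univ _⟩)
  have hj : ∀ t ∈ Icc 0 τ, Continuous fun x =>
      density F a α (k + α * ω) (relMod a u t x) (relDer (ω + k) u p t x) +
      density F a (-α) (-k + -α * ω) (relMod a u t x) (relDer (ω - k) u q t x) := fun t ht =>
    (((cdens _ _).comp_continuousOn (cs.prodMk cP)).add
      ((cdens _ _).comp_continuousOn (cs.prodMk cQ))).comp_continuous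
      (f := fun x : ℝ => (t, x)) (by fun_prop) (fun x => ⟨ht, mem_univ _⟩)
  have h00 : (0 : ℝ) ∈ Icc 0 τ := ⟨le_rfl, ht.1.trans ht.2⟩
  rw [← intervalIntegral.integral_const_mul, ← intervalIntegral.integral_const_mul]
  refine le_trans ?_ (key.trans ?_)
  · refine intervalIntegral.integral_mono_on hlr (((hi t ht).const_mul c).intervalIntegrable _ _)
      ((hj t ht).intervalIntegrable _ _) fun x _ => ?_
    have h1 := (hd₁ _ (hτ t ht x) (relDer (ω + k) u p t x)).1
    have h2 := (hd₂ _ (hτ t ht x) (relDer (ω - k) u q t x)).1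
    have h3 : 0 ≤ c * (relMod a u t x - 1) ^ 2 := by positivity
    unfold quadDensity
    linarith
  · refine intervalIntegral.integral_mono_on (by linarith [ht.1])
      ((hj 0 h00).intervalIntegrable _ _)
      (((hi 0 h00).const_mul (2 * C)).intervalIntegrable _ _) fun x _ => ?_
    have h1 := (hd₁ _ (hτ 0 h00 x) (relDer (ω + k) u p 0 x)).2
    have h2 := (hd₂ _ (hτ 0 h00 x) (relDer (ω - k) u q 0 x)).2
    have h3 : 0 ≤ C * ‖relDer (ω + k) u p 0 x‖ ^ 2 := by positivity
    have h4 : 0 ≤ C * ‖relDer (ω - k) u q 0 x‖ ^ 2 := by positivity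
    unfold quadDensity
    linarith

end IsWave

/-- Integrating 2mm' gives m(x)² ≤ m(y)² + ∫(m²+m'²) for every y in the unit interval; average over
y. The window has length one, so bounds on finite intervals suffice. -/
theorem sq_le_integral_sobolev {m m' : ℝ → ℝ} (hm : ∀ x, HasDerivAt m (m' x) x)
    (hc : Continuous m') (x : ℝ) :
    m x ^ 2 ≤ ∫ y in x..(x + 1), (2 * m y ^ 2 + m' y ^ 2) := by
  have cm : Continuous m := continuous_iff_continuousAt.2 fun x => (hm x).continuousAt
  have h1 : ∀ y ∈ Icc x (x + 1), m x ^ 2 ≤ m y ^ 2 + ∫ z in x..(x + 1), (m z ^ 2 + m' z ^ 2) := by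
    intro y hy
    have e : ∫ z in x..y, 2 * m z * m' z = m y ^ 2 - m x ^ 2 :=
      intervalIntegral.integral_eq_sub_of_hasDerivAt (f := fun z => m z ^ 2)
        (fun z _ => ((hm z).pow 2).of_eq (fun _ => rfl) (by simp))
        (by apply Continuous.intervalIntegrable; fun_prop)
    have h2 : -(∫ z in x..y, 2 * m z * m' z) ≤ ∫ z in x..y, (m z ^ 2 + m' z ^ 2) := by
      rw [← intervalIntegral.integral_neg]
      refine intervalIntegral.integral_mono_on hy.1
        (by apply Continuous.intervalIntegrable; fun_prop)
        (by apply Continuous.intervalIntegrable; fun_prop) fun z _ => ?_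
      nlinarith [sq_nonneg (m z + m' z)]
    have h3 : ∫ z in x..y, (m z ^ 2 + m' z ^ 2) ≤ ∫ z in x..(x + 1), (m z ^ 2 + m' z ^ 2) :=
      intervalIntegral.integral_mono_interval le_rfl hy.1 hy.2
        (Eventually.of_forall fun z => by positivity)
        (by apply Continuous.intervalIntegrable; fun_prop)
    linarith
  have h4 : ∫ _ in x..(x + 1), m x ^ 2 ≤
      ∫ y in x..(x + 1), (m y ^ 2 + ∫ z in x..(x + 1), (m z ^ 2 + m' z ^ 2)) :=
    intervalIntegral.integral_mono_on (by linarith) (by simp)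
      (by apply Continuous.intervalIntegrable; fun_prop) h1
  rw [intervalIntegral.integral_add (by apply Continuous.intervalIntegrable; fun_prop) (by simp),
    intervalIntegral.integral_const, intervalIntegral.integral_const, add_sub_cancel_left,
    one_smul, one_smul, ← intervalIntegral.integral_add
      (by apply Continuous.intervalIntegrable; fun_prop)
      (by apply Continuous.intervalIntegrable; fun_prop)] at h4
  refine h4.trans (le_of_eq ?_)
  congr 1
  funext y
  ring

/-- The modulus satisfies s_x = s·Re(P-Q), so the energy controls both s-1 and its derivative. For
|s-1| ≤ 1/4 one has s² ≤ 2, and Re(P-Q)² ≤ 2(|P|²+|Q|²) yields the constant 4. -/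
theorem IsWave.sq_relMod_le {g : ℂ → ℂ} (h : IsWave g u p q) {ε t : ℝ} (hε : ε ≤ 1 / 4)
    (hs : ∀ x, |relMod a u t x - 1| ≤ ε) (x : ℝ) :
    (relMod a u t x - 1) ^ 2 ≤ 4 * ∫ y in x..(x + 1), quadDensity a k ω u p q t y := by
  have h0 : ∀ y, u t y ≠ 0 := fun y => ne_zero_of_relMod (by linarith) (hs y)
  have hslice : Continuous fun y : ℝ => (t, y) := by fun_prop
  have cu : Continuous fun y => u t y := h.cont_u.comp hslice
  have cp : Continuous fun y => p t y := h.cont_p.comp hslice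
  have cq : Continuous fun y => q t y := h.cont_q.comp hslice
  have cP : Continuous fun y => relDer (ω + k) u p t y := (cp.div cu h0).sub continuous_const
  have cQ : Continuous fun y => relDer (ω - k) u q t y := (cq.div cu h0).sub continuous_const
  have cs : Continuous fun y => relMod a u t y := (h.continuous_relMod a).comp hslice
  have cre : Continuous Complex.re := Complex.continuous_re
  have hns : ∀ z : ℂ, ‖z‖ ^ 2 = z.re ^ 2 + z.im ^ 2 := fun z => by
    rw [← Complex.normSq_eq_norm_sq, Complex.normSq_apply]; ring
  have hd : ∀ y, HasDerivAt (fun y => relMod a u t y - 1)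
      (relMod a u t y * (relDer (ω + k) u p t y - relDer (ω - k) u q t y).re) y := by
    intro y
    have hUre : HasDerivAt (fun σ => (u t σ).re) _ y :=
      (Complex.reCLM.hasFDerivAt.comp_hasDerivAt y (h.dx t y))
    have hUim : HasDerivAt (fun σ => (u t σ).im) _ y :=
      (Complex.imCLM.hasFDerivAt.comp_hasDerivAt y (h.dx t y))
    refine ((((hUre.pow 2).add (hUim.pow 2)).div_const (a ^ 2)).sub_const 1).of_eq (fun σ => ?_) ?_
    · simp only [relMod, hns]; rfl
    · have e : (p t y - q t y) / 2 = u t y * ((relDer (ω + k) u p t y - relDer (ω - k) u q t y) / 2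
          + Complex.I * (k : ℂ)) := by
        simp only [relDer]
        have := h0 y
        field_simp
        push_cast
        ring
      rw [e]
      simp only [relMod, hns]
      set D := relDer (ω + k) u p t y - relDer (ω - k) u q t y
      have e2 : (u t y * (D / 2 + Complex.I * (k : ℂ))).re =
          (u t y).re * (D.re / 2) - (u t y).im * (D.im / 2 + k) := by simp
      have e3 : (u t y * (D / 2 + Complex.I * (k : ℂ))).im =
          (u t y).re * (D.im / 2 + k) + (u t y).im * (D.re / 2) := by simp
      simp only [Complex.reCLM_apply, Complex.imCLM_apply, e2, e3]
      ring
  refine (sq_le_integral_sobolev hd (by fun_prop) x).trans ?_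
  rw [← intervalIntegral.integral_const_mul]
  have cq' : Continuous fun y => quadDensity a k ω u p q t y := by
    unfold quadDensity; fun_prop
  refine intervalIntegral.integral_mono_on (by linarith)
    (by apply Continuous.intervalIntegrable; fun_prop)
    ((cq'.const_mul 4).intervalIntegrable _ _) fun y _ => ?_
  unfold quadDensity
  have hsy := abs_le.1 (hs y)
  have g1 : relMod a u t y ^ 2 ≤ 2 := by nlinarith [hsy.1, hsy.2]
  set P := relDer (ω + k) u p t y
  set Q := relDer (ω - k) u q t y
  have g2 : (P - Q).re ^ 2 ≤ 2 * (‖P‖ ^ 2 + ‖Q‖ ^ 2) := by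
    rw [hns, hns, Complex.sub_re]
    nlinarith [sq_nonneg (P.re + Q.re), sq_nonneg P.im, sq_nonneg Q.im]
  have g3 : relMod a u t y ^ 2 * (P - Q).re ^ 2 ≤ 2 * (2 * (‖P‖ ^ 2 + ‖Q‖ ^ 2)) :=
    mul_le_mul g1 g2 (sq_nonneg _) (by norm_num)
  rw [mul_pow]
  linarith [sq_nonneg (relMod a u t y - 1)]

/-- A continuity argument in time steps of fixed length: from a bound by ε/2, a Lipschitz constant
uniform in x keeps the bound ε for a time ε/(2Λ), and `step` restores ε/2. Uniformity replaces the
continuity of a supremum over the line. -/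
theorem forall_le_of_step {d : ℝ → ℝ → ℝ} {ε : ℝ} (hε : 0 < ε) (h₀ : ∀ x, d 0 x ≤ ε)
    (step : ∀ τ, 0 ≤ τ → (∀ t ∈ Icc 0 τ, ∀ x, d t x ≤ ε) → ∀ t ∈ Icc 0 τ, ∀ x, d t x ≤ ε / 2)
    (hLip : ∀ T, 0 ≤ T → ∃ Λ > 0, ∀ t ∈ Icc 0 T, ∀ t' ∈ Icc 0 T, ∀ x,
      d t x ≤ d t' x + Λ * |t - t'|) :
    ∀ t, 0 ≤ t → ∀ x, d t x ≤ ε / 2 := by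
  intro T hT
  obtain ⟨Λ, hΛ, hL⟩ := hLip T hT
  set h := ε / (2 * Λ) with hh
  have hh0 : 0 < h := by positivity
  have hΛh : Λ * h = ε / 2 := by rw [hh]; field_simp
  have key : ∀ n : ℕ, ∀ t ∈ Icc 0 (min T (n * h)), ∀ x, d t x ≤ ε / 2 := by
    intro n
    induction n with
    | zero =>
      have h1 : min T ((0 : ℕ) * h) = 0 := by simp [hT]
      rw [h1]
      refine step 0 le_rfl fun t ht x => ?_
      have : t = 0 := le_antisymm ht.2 ht.1
      rw [this]; exact h₀ x
    | succ n ih =>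
      have hnh : 0 ≤ (n : ℝ) * h := by positivity
      refine step _ (by positivity) fun t ht x => ?_
      have htT : t ≤ T := ht.2.trans (min_le_left _ _)
      have htn : t ≤ (n : ℝ) * h + h := by
        have := ht.2.trans (min_le_right _ _)
        push_cast at this
        linarith
      by_cases hc : t ≤ n * h
      · have := ih t ⟨ht.1, le_min htT hc⟩ x
        linarith
      · push Not at hc
        have h2 := ih (n * h) ⟨hnh, le_min (hc.le.trans htT) le_rfl⟩ x
        have h3 := hL t ⟨ht.1, htT⟩ (n * h) ⟨hnh, hc.le.trans htT⟩ x
        have h4 : |t - n * h| ≤ h := by rw [abs_of_pos (by linarith)]; linarith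
        have h5 : Λ * |t - n * h| ≤ Λ * h := by gcongr
        linarith
  intro x
  obtain ⟨n, hn⟩ := exists_nat_ge (T / h)
  refine key n T ⟨hT, le_min le_rfl ?_⟩ x
  rwa [div_le_iff₀ hh0] at hn

theorem IsWave.relMod_lipschitz {g : ℂ → ℂ} (h : IsWave g u p q) (ha : 0 < a) {T M : ℝ}
    (hu : ∀ t ∈ Icc 0 T, ∀ x, ‖u t x‖ ≤ M) (hp : ∀ t ∈ Icc 0 T, ∀ x, ‖p t x‖ ≤ M)
    (hq : ∀ t ∈ Icc 0 T, ∀ x, ‖q t x‖ ≤ M) {t t' : ℝ} (ht : t ∈ Icc 0 T) (ht' : t' ∈ Icc 0 T)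
    (x : ℝ) : |relMod a u t x - relMod a u t' x| ≤ 2 * M ^ 2 / a ^ 2 * |t - t'| := by
  have hM : 0 ≤ M := (norm_nonneg _).trans (hu t ht x)
  have h1 : ‖u t x - u t' x‖ ≤ M * |t - t'| :=
    (convex_Icc 0 T).norm_image_sub_le_of_norm_hasDerivWithin_le (f := fun s => u s x)
      (fun s _ => (h.dt s x).hasDerivWithinAt) (fun s hs => by
        rw [norm_div, Complex.norm_ofNat]
        have h3 := norm_add_le (p s x) (q s x)
        have h4 := hp s hs x
        have h5 := hq s hs x
        linarith) ht' ht
  have h2 : |‖u t x‖ - ‖u t' x‖| ≤ M * |t - t'| := (abs_norm_sub_norm_le _ _).trans h1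
  have h3 : |‖u t x‖ + ‖u t' x‖| ≤ 2 * M := by
    rw [abs_of_nonneg (by positivity)]
    linarith [hu t ht x, hu t' ht' x]
  have e : relMod a u t x - relMod a u t' x =
      (‖u t x‖ + ‖u t' x‖) * (‖u t x‖ - ‖u t' x‖) / a ^ 2 := by
    simp only [relMod]; ring
  rw [e, abs_div, abs_mul, abs_of_pos (by positivity : 0 < a ^ 2)]
  calc _ ≤ (2 * M) * (M * |t - t'|) / a ^ 2 := by gcongr
    _ = _ := by ring

/-- Nonlinear stability of the periodic wave, in terms of modulus and logarithmic derivatives. -/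
theorem exists_stability (hF : Continuous F) {F' : ℝ} (hd : HasDerivAt F F' (a ^ 2))
    (ha : 0 < a) (hkω : (k, ω) ≠ (0, 0)) (hdisp : ω ^ 2 = k ^ 2 + F (a ^ 2))
    (hspec : 2 * max 0 (-F (a ^ 2)) < a ^ 2 * F') :
    ∃ ε > 0, ε ≤ 1 / 4 ∧ ∃ K > 0, ∃ η > 0, ∀ u p q : ℝ → ℝ → ℂ,
      IsWave (fun z => (F (‖z‖ ^ 2) : ℂ) * z) u p q →
      (∀ T, 0 ≤ T → ∃ M, ∀ t ∈ Icc 0 T, ∀ x, ‖u t x‖ ≤ M ∧ ‖p t x‖ ≤ M ∧ ‖q t x‖ ≤ M) →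
      (∀ x, |relMod a u 0 x - 1| ≤ ε) →
      ∀ A ≤ η, (∀ l r, l ≤ r → ∫ x in l..r, quadDensity a k ω u p q 0 x ≤ A) →
      ∀ t, 0 ≤ t → (∀ x, |relMod a u t x - 1| ≤ ε) ∧
        ∀ l r, l ≤ r → ∫ x in l..r, quadDensity a k ω u p q t x ≤ K * A := by
  obtain ⟨α, hα1, hα2, hα⟩ := exists_moment hkω hdisp hspec
  obtain ⟨ε₁, hε₁, c₁, hc₁, C₁, hC₁, hb₁⟩ := exists_density_bounds hF hd hα1 hα2 hα
  obtain ⟨ε₂, hε₂, c₂, hc₂, C₂, hC₂, hb₂⟩ := exists_density_bounds hF hd (α := -α)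
    (κ := -k + -α * ω) (by linarith) (by linarith) (by
      rw [neg_sq, show -k + -α * ω = -(k + α * ω) by ring, neg_sq]; exact hα)
  -- The cap 1/4 serves the Sobolev step and, later, keeps |u|² where the truncated nonlinearity is
  -- the original one.
  set ε := min (min ε₁ ε₂) (1 / 4) with hε
  set c := min c₁ c₂ with hc
  set C := max C₁ C₂ with hC
  have hε0 : 0 < ε := by positivity
  have hε4 : ε ≤ 1 / 4 := min_le_right _ _
  have hc0 : 0 < c := by positivity
  have hC0 : 0 < C := lt_max_of_lt_left hC₁
  have hd₁ : ∀ s, |s - 1| ≤ ε → ∀ P : ℂ,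
      c * (‖P‖ ^ 2 + (s - 1) ^ 2) ≤ density F a α (k + α * ω) s P ∧
      density F a α (k + α * ω) s P ≤ C * (‖P‖ ^ 2 + (s - 1) ^ 2) := fun s hs P => by
    have h1 := hb₁ s (hs.trans ((min_le_left _ _).trans (min_le_left _ _))) P
    exact ⟨le_trans (by gcongr; exact min_le_left _ _) h1.1,
      h1.2.trans (by gcongr; exact le_max_left _ _)⟩
  have hd₂ : ∀ s, |s - 1| ≤ ε → ∀ P : ℂ,
      c * (‖P‖ ^ 2 + (s - 1) ^ 2) ≤ density F a (-α) (-k + -α * ω) s P ∧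
      density F a (-α) (-k + -α * ω) s P ≤ C * (‖P‖ ^ 2 + (s - 1) ^ 2) := fun s hs P => by
    have h1 := hb₂ s (hs.trans ((min_le_left _ _).trans (min_le_right _ _))) P
    exact ⟨le_trans (by gcongr; exact min_le_right _ _) h1.1,
      h1.2.trans (by gcongr; exact le_max_right _ _)⟩
  set K := 2 * C / c with hK
  have hK0 : 0 < K := by positivity
  -- The energy stays below K·A, so the threshold on A makes the Sobolev bound 4·K·A at most (ε/2)²,
  -- which improves ε to ε/2.
  refine ⟨ε, hε0, hε4, K, hK0, (ε / 2) ^ 2 / (4 * K), by positivity, ?_⟩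
  intro u p q h hM h0 A hA hA0
  have henergy : ∀ τ, 0 ≤ τ → (∀ t ∈ Icc 0 τ, ∀ x, |relMod a u t x - 1| ≤ ε) →
      ∀ t ∈ Icc 0 τ, ∀ l r, l ≤ r → ∫ x in l..r, quadDensity a k ω u p q t x ≤ K * A := by
    intro τ _ hs t ht l r hlr
    have h1 := h.integral_quadDensity_le hF ha hdisp (by linarith) hc0 hd₁ hd₂ hs ht hlr
    have h2 := hA0 (l - t) (r + t) (by linarith [ht.1])
    have h3 : c * ∫ x in l..r, quadDensity a k ω u p q t x ≤ c * (K * A) := by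
      refine h1.trans ?_
      rw [hK, show c * (2 * C / c * A) = 2 * C * A by field_simp]
      gcongr
    exact le_of_mul_le_mul_left h3 hc0
  have hmod : ∀ t, 0 ≤ t → ∀ x, |relMod a u t x - 1| ≤ ε / 2 := by
    refine forall_le_of_step hε0 h0 (fun τ hτ hs t ht x => ?_) (fun T hT => ?_)
    · have h1 := henergy τ hτ hs t ht x (x + 1) (by linarith)
      have h2 := h.sq_relMod_le (k := k) (ω := ω) hε4 (hs t ht) x
      have h3 : K * A ≤ (ε / 2) ^ 2 / 4 := by
        calc K * A ≤ K * ((ε / 2) ^ 2 / (4 * K)) := by gcongr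
          _ = _ := by field_simp
      exact abs_le_of_sq_le_sq (by linarith) (by positivity)
    · obtain ⟨M, hMT⟩ := hM T hT
      refine ⟨2 * M ^ 2 / a ^ 2 + 1, by positivity, fun t ht t' ht' x => ?_⟩
      have h1 := h.relMod_lipschitz ha (fun t ht x => (hMT t ht x).1)
        (fun t ht x => (hMT t ht x).2.1) (fun t ht x => (hMT t ht x).2.2) ht ht' x
      have h2 : |relMod a u t x - 1| ≤ |relMod a u t' x - 1| +
          |relMod a u t x - relMod a u t' x| := by
        rw [show relMod a u t x - 1 =
          (relMod a u t' x - 1) + (relMod a u t x - relMod a u t' x) by ring]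
        exact abs_add_le _ _
      linarith [abs_nonneg (t - t')]
  intro t ht
  have hε2 : ∀ t, 0 ≤ t → ∀ x, |relMod a u t x - 1| ≤ ε := fun t ht x =>
    (hmod t ht x).trans (by linarith)
  exact ⟨hε2 t ht, henergy t ht (fun s hs x => hε2 s hs.1 x) t ⟨ht, le_rfl⟩⟩

end Stability

end KleinGordon

namespace KleinGordon

/-! ### Curves in L²_loc: continuity, translations, difference quotients. -/

section SquareIntegrable

theorem eLpNorm_two_sq {α E : Type*} [MeasurableSpace α] [NormedAddCommGroup E] (v : α → E)
    (μ : Measure α) : eLpNorm v 2 μ ^ 2 = ∫⁻ x, ‖v x‖ₑ ^ 2 ∂μ := by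
  have := eLpNorm_nnreal_pow_eq_lintegral (f := v) (μ := μ) (p := 2) (by norm_num)
  simpa using this

theorem le_of_sq_le_sq_ennreal {x y : ℝ≥0∞} (h : x ^ 2 ≤ y ^ 2) : x ≤ y := by
  rw [← sq_rpow_half x, ← sq_rpow_half y]
  exact ENNReal.rpow_le_rpow h (by norm_num)

/-- Minkowski's integral inequality in `L²`. -/
theorem eLpNorm_intervalIntegral_le {E : Type*} [NormedAddCommGroup E] [NormedSpace ℝ E]
    {Φ : ℝ → ℝ → E} (hΦ : StronglyMeasurable fun z : ℝ × ℝ => Φ z.1 z.2) {ν : Measure ℝ}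
    [SFinite ν] {a b : ℝ} {M : ℝ≥0∞} (h : ∀ s ∈ uIoc a b, eLpNorm (Φ s) 2 ν ≤ M) :
    eLpNorm (fun x => ∫ s in a..b, Φ s x) 2 ν ≤ ENNReal.ofReal |b - a| * M := by
  apply le_of_sq_le_sq_ennreal
  rw [eLpNorm_two_sq]
  set μ := volume.restrict (uIoc a b) with hμ
  have hμu : μ univ = ENNReal.ofReal |b - a| := by simp [hμ, uIoc, Real.volume_Ioc, max_sub_min_eq_abs]
  have hm : Measurable fun z : ℝ × ℝ => ‖Φ z.1 z.2‖ₑ ^ 2 := hΦ.enorm.pow_const 2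
  have h1 : ∀ x, ‖∫ s in a..b, Φ s x‖ₑ ^ 2 ≤
      ENNReal.ofReal |b - a| * ∫⁻ s, ‖Φ s x‖ₑ ^ 2 ∂μ := by
    intro x
    have hx : StronglyMeasurable fun s => Φ s x :=
      hΦ.comp_measurable (g := fun s : ℝ => (s, x)) (by fun_prop)
    have h2 : ‖∫ s in a..b, Φ s x‖ₑ ≤ eLpNorm (fun s => Φ s x) 1 μ := by
      rw [intervalIntegral.intervalIntegral_eq_integral_uIoc, eLpNorm_one_eq_lintegral_enorm]
      have : ∀ z : E, ‖(if a ≤ b then (1 : ℝ) else -1) • z‖ₑ = ‖z‖ₑ := by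
        intro z; split_ifs <;> simp
      rw [this]
      exact enorm_integral_le_lintegral_enorm _
    have h3 := eLpNorm_le_eLpNorm_mul_rpow_measure_univ (p := 1) (q := 2) (by norm_num)
      hx.aestronglyMeasurable (μ := μ)
    have e : (1 / (1 : ℝ≥0∞).toReal - 1 / (2 : ℝ≥0∞).toReal) = (1 / 2 : ℝ) := by norm_num
    rw [hμu, e] at h3
    calc _ ≤ (eLpNorm (fun s => Φ s x) 2 μ * ENNReal.ofReal |b - a| ^ (1 / 2 : ℝ)) ^ 2 := by
          gcongr; exact h2.trans h3
      _ = _ := by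
          rw [mul_pow, eLpNorm_two_sq, mul_comm]
          congr 1
          rw [← ENNReal.rpow_natCast, ← ENNReal.rpow_mul]; simp
  calc _ ≤ ∫⁻ x, ENNReal.ofReal |b - a| * ∫⁻ s, ‖Φ s x‖ₑ ^ 2 ∂μ ∂ν := lintegral_mono h1
    _ = ENNReal.ofReal |b - a| * ∫⁻ x, ∫⁻ s, ‖Φ s x‖ₑ ^ 2 ∂μ ∂ν :=
        lintegral_const_mul' _ _ ENNReal.ofReal_ne_top
    _ = ENNReal.ofReal |b - a| * ∫⁻ s, ∫⁻ x, ‖Φ s x‖ₑ ^ 2 ∂ν ∂μ := by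
        rw [lintegral_lintegral_swap (f := fun x s => ‖Φ s x‖ₑ ^ 2)
          (hm.comp measurable_swap).aemeasurable]
    _ ≤ ENNReal.ofReal |b - a| * ∫⁻ _, M ^ 2 ∂μ := by
        gcongr _ * ?_
        refine lintegral_mono_ae ?_
        rw [hμ, ae_restrict_iff' measurableSet_uIoc]
        refine Eventually.of_forall fun s hs => ?_
        rw [← eLpNorm_two_sq]
        gcongr
        exact h s hs
    _ = _ := by rw [lintegral_const, hμu]; ring

/-- `v` is square integrable on bounded intervals. -/
def LocL2 (v : ℝ → ℂ) : Prop := ∀ r : ℝ, MemLp v 2 (volume.restrict (Ioo (-r) r))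

theorem LocL2.of_continuous {v : ℝ → ℂ} (hv : Continuous v) : LocL2 v := fun r => by
  obtain ⟨C, hC⟩ := (isCompact_Icc (a := -r) (b := r)).exists_bound_of_continuousOn hv.continuousOn
  refine MemLp.of_bound hv.aestronglyMeasurable C ?_
  rw [ae_restrict_iff' measurableSet_Ioo]
  exact Eventually.of_forall fun x hx => hC x (Ioo_subset_Icc_self hx)

/-- A jointly measurable `v` such that `t ↦ v t` is continuous with values in `L²_loc`. -/
structure L2Cont (v : ℝ → ℝ → ℂ) : Prop where
  meas : StronglyMeasurable fun z : ℝ × ℝ => v z.1 z.2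
  mem : ∀ t, LocL2 (v t)
  tendsto : ∀ t₀ r, Tendsto (fun t => eLpNorm (fun x => v t x - v t₀ x) 2
    (volume.restrict (Ioo (-r) r))) (𝓝 t₀) (𝓝 0)

namespace L2Cont

variable {v w : ℝ → ℝ → ℂ}

theorem of_continuous (hv : Continuous fun z : ℝ × ℝ => v z.1 z.2) : L2Cont v := by
  refine ⟨hv.stronglyMeasurable, fun t => LocL2.of_continuous
    (hv.comp (by fun_prop : Continuous fun x : ℝ => (t, x))), fun t₀ r => ?_⟩
  let f : C(ℝ × ℝ, ℂ) := ⟨_, hv⟩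
  have h1 : Tendsto (fun t => f.curry t) (𝓝 t₀) (𝓝 (f.curry t₀)) := f.curry.continuous.tendsto t₀
  rw [ContinuousMap.tendsto_iff_forall_isCompact_tendstoUniformlyOn] at h1
  have h2 := h1 (Icc (-r) r) isCompact_Icc
  rw [Metric.tendstoUniformlyOn_iff] at h2
  set κ : ℝ≥0∞ := volume.restrict (Ioo (-r) r) univ ^ (2 : ℝ≥0∞).toReal⁻¹ with hκ
  have hκt : κ ≠ ∞ := by
    rw [hκ]
    exact ENNReal.rpow_ne_top_of_nonneg (by positivity) (by simp)
  rw [ENNReal.tendsto_nhds_zero]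
  intro ε hε
  obtain ⟨η, hη, hηε⟩ : ∃ η : ℝ, 0 < η ∧ κ * ENNReal.ofReal η ≤ ε := by
    have h3 : Tendsto (fun η : ℝ => κ * ENNReal.ofReal η) (𝓝[>] 0) (𝓝 (κ * ENNReal.ofReal 0)) := by
      refine Tendsto.mono_left ?_ nhdsWithin_le_nhds
      exact ENNReal.Tendsto.const_mul (ENNReal.tendsto_ofReal tendsto_id) (Or.inr hκt)
    simp only [ENNReal.ofReal_zero, mul_zero] at h3
    obtain ⟨η, h4, h5⟩ := (((ENNReal.tendsto_nhds_zero.1 h3) ε hε).and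
      self_mem_nhdsWithin).exists
    exact ⟨η, h5, h4⟩
  filter_upwards [h2 η hη] with t ht
  refine (eLpNorm_le_of_ae_bound (C := η) ?_).trans hηε
  rw [ae_restrict_iff' measurableSet_Ioo]
  refine Eventually.of_forall fun x hx => ?_
  have := (ht x (Ioo_subset_Icc_self hx)).le
  rw [dist_comm, dist_eq_norm] at this
  exact this

theorem add (hv : L2Cont v) (hw : L2Cont w) : L2Cont fun t x => v t x + w t x := by
  refine ⟨hv.meas.add hw.meas, fun t r => (hv.mem t r).add (hw.mem t r), fun t₀ r => ?_⟩
  have h1 := (hv.tendsto t₀ r).add (hw.tendsto t₀ r)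
  rw [add_zero] at h1
  refine tendsto_of_tendsto_of_tendsto_of_le_of_le tendsto_const_nhds h1 (fun _ => zero_le)
    fun t => ?_
  refine le_trans (le_of_eq ?_) (eLpNorm_add_le
    ((hv.mem t r).sub (hv.mem t₀ r)).aestronglyMeasurable
    ((hw.mem t r).sub (hw.mem t₀ r)).aestronglyMeasurable (by norm_num))
  congr 1
  funext x
  simp only [Pi.add_apply]
  ring

theorem const_mul (hv : L2Cont v) (c : ℂ) : L2Cont fun t x => c * v t x := by
  refine ⟨hv.meas.const_mul c, fun t r => (hv.mem t r).const_mul c, fun t₀ r => ?_⟩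
  have h1 := ENNReal.Tendsto.const_mul (a := ‖c‖ₑ) (hv.tendsto t₀ r) (Or.inr enorm_ne_top)
  rw [mul_zero] at h1
  refine h1.congr fun t => ?_
  rw [← eLpNorm_const_smul]
  congr 1
  funext x
  simp [mul_sub]

theorem sub (hv : L2Cont v) (hw : L2Cont w) : L2Cont fun t x => v t x - w t x := by
  have := hv.add (hw.const_mul (-1))
  simpa [sub_eq_add_neg] using this

/-- Continuity of translations in L². Cutting A off at radius ρ makes it globally square integrable,
and on the window (-r, r) the cut-off is invisible for all times near t₀. -/
theorem of_translate {A : ℝ → ℂ} (hm : StronglyMeasurable A) (hA : LocL2 A) (σ : ℝ) :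
    L2Cont fun t x => A (x + σ * t) := by
  have hmp : ∀ c : ℝ, MeasurePreserving (fun x : ℝ => x + c) volume volume := fun c =>
    measurePreserving_add_right volume c
  have hG : ∀ ρ : ℝ, MemLp ((Ioo (-ρ) ρ).indicator A) 2 volume := fun ρ =>
    (memLp_indicator_iff_restrict measurableSet_Ioo).2 (hA ρ)
  have hae : ∀ c r ρ : ℝ, |c| + r ≤ ρ → ∀ x ∈ Ioo (-r) r,
      (Ioo (-ρ) ρ).indicator A (x + c) = A (x + c) := by
    intro c r ρ h x hx
    apply indicator_of_mem
    have := abs_le.1 (le_refl |c|)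
    exact ⟨by linarith [hx.1], by linarith [hx.2]⟩
  refine ⟨hm.comp_measurable (g := fun z : ℝ × ℝ => z.2 + σ * z.1) (by fun_prop),
    fun t r => ?_, fun t₀ r => ?_⟩
  · have h1 := ((hG (|σ * t| + r)).comp_measurePreserving (hmp (σ * t))).restrict (Ioo (-r) r)
    refine (memLp_congr_ae ?_).1 h1
    rw [Filter.EventuallyEq, ae_restrict_iff' measurableSet_Ioo]
    exact Eventually.of_forall fun x hx => hae _ _ _ le_rfl x hx
  · set ρ := |σ * t₀| + |σ| + r with hρ
    let g : ℝ → C(ℝ, ℝ) := fun t => ⟨fun x => x + σ * t, by fun_prop⟩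
    have hg : Continuous g := by
      let k : C(ℝ × ℝ, ℝ) := ⟨fun z => z.2 + σ * z.1, by fun_prop⟩
      exact k.curry.continuous
    have : Fact ((1 : ℝ≥0∞) ≤ 2) := ⟨by norm_num⟩
    have h1 := Filter.Tendsto.compMeasurePreservingLp (μ := volume) (ν := volume)
      (f := fun _ => (hG ρ).toLp) (f₀ := (hG ρ).toLp) tendsto_const_nhds (hg.tendsto t₀)
      (fun t => hmp (σ * t)) (hmp (σ * t₀)) (by norm_num)
    rw [tendsto_iff_edist_tendsto_0] at h1
    refine tendsto_of_tendsto_of_tendsto_of_le_of_le' tendsto_const_nhds h1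
      (Eventually.of_forall fun _ => zero_le) ?_
    filter_upwards [Metric.closedBall_mem_nhds t₀ one_pos] with t ht
    have e : ∀ t, Lp.compMeasurePreserving (g t) (hmp (σ * t)) (hG ρ).toLp =
        ((hG ρ).comp_measurePreserving (hmp (σ * t))).toLp := fun t =>
      Lp.toLp_compMeasurePreserving (hG ρ) (hmp (σ * t))
    rw [e t, e t₀, Lp.edist_toLp_toLp]
    refine le_trans (le_of_eq ?_) (eLpNorm_mono_measure _ Measure.restrict_le_self
      (ν := volume.restrict (Ioo (-r) r)))
    refine eLpNorm_congr_ae ?_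
    rw [Filter.EventuallyEq, ae_restrict_iff' measurableSet_Ioo]
    refine Eventually.of_forall fun x hx => ?_
    have h2 : |σ * t| ≤ |σ * t₀| + |σ| := by
      rw [Metric.mem_closedBall, Real.dist_eq] at ht
      calc |σ * t| = |σ * t₀ + σ * (t - t₀)| := by congr 1; ring
        _ ≤ |σ * t₀| + |σ * (t - t₀)| := abs_add_le _ _
        _ ≤ |σ * t₀| + |σ| * 1 := by rw [abs_mul σ (t - t₀)]; gcongr
        _ = _ := by ring
    simp only [Pi.sub_apply, Function.comp]
    rw [hae (σ * t) r ρ (by linarith) x hx, hae (σ * t₀) r ρ (by linarith [abs_nonneg σ]) x hx]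

/-- An indefinite time integral of an `L²_loc`-continuous function is differentiable in
`L²_loc`. -/
theorem tendsto_slope (hw : L2Cont w) (h : ∀ t t₀ x, v t x - v t₀ x = ∫ s in t₀..t, w s x)
    (hi : ∀ t t₀ x, IntervalIntegrable (fun s => w s x) volume t₀ t) (t₀ r : ℝ) :
    Tendsto (fun t => eLpNorm (fun x => (t - t₀)⁻¹ • (v t x - v t₀ x) - w t₀ x) 2
      (volume.restrict (Ioo (-r) r))) (𝓝[≠] t₀) (𝓝 0) := by
  rw [ENNReal.tendsto_nhds_zero]
  intro ε hε
  obtain ⟨δ, hδ, hb⟩ := Metric.eventually_nhds_iff_ball.1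
    ((ENNReal.tendsto_nhds_zero.1 (hw.tendsto t₀ r)) ε hε)
  filter_upwards [self_mem_nhdsWithin, mem_nhdsWithin_of_mem_nhds (Metric.ball_mem_nhds t₀ hδ)]
    with t htne ht
  have hne : t - t₀ ≠ 0 := sub_ne_zero.2 htne
  have hw0 : StronglyMeasurable (w t₀) :=
    hw.meas.comp_measurable (g := fun x : ℝ => (t₀, x)) (by fun_prop)
  -- The defect of the difference quotient is the time average of w(s) - w(t₀), which Minkowski's
  -- inequality bounds by its supremum over s.
  have e : (fun x => (t - t₀)⁻¹ • (v t x - v t₀ x) - w t₀ x) =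
      (t - t₀)⁻¹ • fun x => ∫ s in t₀..t, (w s x - w t₀ x) := by
    funext x
    rw [Pi.smul_apply, intervalIntegral.integral_sub (hi t t₀ x) (by simp), h,
      intervalIntegral.integral_const, smul_sub, smul_smul, inv_mul_cancel₀ hne, one_smul]
  rw [e, eLpNorm_const_smul]
  have h1 := eLpNorm_intervalIntegral_le (a := t₀) (b := t) (M := ε)
    (ν := volume.restrict (Ioo (-r) r)) (Φ := fun s x => w s x - w t₀ x)
    (hw.meas.sub (hw0.comp_measurable measurable_snd)) (fun s hs => hb s (by
      rw [Metric.mem_ball, Real.dist_eq] at ht ⊢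
      refine lt_of_le_of_lt ?_ ht
      rcases le_total t₀ t with hle | hle
      · rw [uIoc_of_le hle] at hs
        rw [abs_of_nonneg (by linarith [hs.1]), abs_of_nonneg (by linarith)]
        linarith [hs.2]
      · rw [uIoc_of_ge hle] at hs
        rw [abs_of_nonpos (by linarith [hs.2]), abs_of_nonpos (by linarith)]
        linarith [hs.1]))
  calc _ ≤ ‖(t - t₀)⁻¹‖ₑ * (ENNReal.ofReal |t - t₀| * ε) := by gcongr
    _ = ε := by
      rw [← mul_assoc, ← Real.enorm_eq_ofReal_abs, ← enorm_mul, inv_mul_cancel₀ hne]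
      simp

end L2Cont

end SquareIntegrable

end KleinGordon

namespace KleinGordon

/-! ### From the characteristic system to a classical solution. -/

section Regularity

theorem IsPrimitive.const_smul {w g : ℝ → ℂ} (h : IsPrimitive w g) (c : ℝ) :
    IsPrimitive (fun x => c • w x) (fun x => c • g x) :=
  h.clm (c • ContinuousLinearMap.id ℝ ℂ)

theorem IsPrimitive.const_mul {w g : ℝ → ℂ} (h : IsPrimitive w g) (c : ℂ) :
    IsPrimitive (fun x => c * w x) (fun x => c * g x) :=
  h.clm (c • ContinuousLinearMap.id ℝ ℂ)

variable {v w vx wx : ℝ → ℝ → ℂ}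

theorem L2Cont.contHLoc_zero (hv : L2Cont v) : ContHLoc 0 v := by
  refine ⟨fun t _ r _ => hv.mem t r, fun t₀ _ r _ => ?_⟩
  simp only [hNorm_zero]
  exact (hv.tendsto t₀ r).mono_left nhdsWithin_le_nhds

theorem L2Cont.contHLoc_succ {m : ℕ} (hv : L2Cont v) (hp : ∀ t, IsPrimitive (v t) (vx t))
    (hx : ContHLoc m vx) : ContHLoc (m + 1) v := by
  refine ⟨fun t ht r hr => ⟨hv.mem t r, vx t, (hp t).hasWeakDerivOn _, hx.1 t ht r hr⟩,
    fun t₀ ht₀ r hr => ?_⟩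
  have h1 := ((hv.tendsto t₀ r).mono_left nhdsWithin_le_nhds).add (hx.2 t₀ ht₀ r hr)
  rw [add_zero] at h1
  exact tendsto_of_tendsto_of_tendsto_of_le_of_le tendsto_const_nhds h1 (fun _ => zero_le)
    fun t => hNorm_succ_le (((hp t).sub (hp t₀)).hasWeakDerivOn _) m

theorem L2Cont.hasTimeDerivHLoc_zero (hw : L2Cont w)
    (h : ∀ t t₀ x, v t x - v t₀ x = ∫ s in t₀..t, w s x)
    (hi : ∀ t t₀ x, IntervalIntegrable (fun s => w s x) volume t₀ t) :
    HasTimeDerivHLoc 0 v w := by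
  refine ⟨fun t _ r _ => hw.mem t r, fun t₀ _ r _ => ?_⟩
  simp only [hNorm_zero]
  exact (hw.tendsto_slope h hi t₀ r).mono_left (nhdsWithin_mono _ fun t ht => ht.2)

theorem L2Cont.hasTimeDerivHLoc_succ {m : ℕ} (hw : L2Cont w)
    (h : ∀ t t₀ x, v t x - v t₀ x = ∫ s in t₀..t, w s x)
    (hi : ∀ t t₀ x, IntervalIntegrable (fun s => w s x) volume t₀ t)
    (hpv : ∀ t, IsPrimitive (v t) (vx t)) (hpw : ∀ t, IsPrimitive (w t) (wx t))
    (hx : HasTimeDerivHLoc m vx wx) : HasTimeDerivHLoc (m + 1) v w := by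
  refine ⟨fun t ht r hr => ⟨hw.mem t r, wx t, (hpw t).hasWeakDerivOn _, hx.1 t ht r hr⟩,
    fun t₀ ht₀ r hr => ?_⟩
  have h1 := ((hw.tendsto_slope h hi t₀ r).mono_left
    (nhdsWithin_mono _ fun t (ht : t ∈ Ici 0 \ {t₀}) => ht.2)).add (hx.2 t₀ ht₀ r hr)
  rw [add_zero] at h1
  exact tendsto_of_tendsto_of_tendsto_of_le_of_le tendsto_const_nhds h1 (fun _ => zero_le)
    fun t => hNorm_succ_le
      (((((hpv t).sub (hpv t₀)).const_smul (t - t₀)⁻¹).sub (hpw t₀)).hasWeakDerivOn _) m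

/-- Spatial and temporal derivatives of the characteristic variables. -/
theorem exists_charDeriv {h h' : ℝ → ℝ → ℂ} (ch : Continuous fun z : ℝ × ℝ => h z.1 z.2)
    (ch' : Continuous fun z : ℝ × ℝ => h' z.1 z.2)
    (hd : ∀ t x, HasDerivAt (fun y => h t y) (h' t x) x) {A A' : ℝ → ℂ} (hA : IsPrimitive A A')
    (hm : StronglyMeasurable A') (hl : LocL2 A') {σ : ℝ} (hσ : σ = 1 ∨ σ = -1)
    {P : ℝ → ℝ → ℂ}
    (hP : ∀ t x, P t x = A (x + σ * t) + ∫ s in (0 : ℝ)..t, h s (x + σ * (t - s))) :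
    ∃ Px : ℝ → ℝ → ℂ, L2Cont Px ∧ (∀ t, IsPrimitive (P t) (Px t)) ∧
      (∀ t t₀ x, IntervalIntegrable (fun s => Px s x) volume t₀ t) ∧
      ∀ t t₀ x, P t x - P t₀ x = ∫ s in t₀..t, (σ * Px s x + h s x) := by
  let Lf : ℝ → ℝ → ℂ := fun t x => ∫ s in (0 : ℝ)..t, h s (x + σ * (t - s))
  let R : ℝ → ℝ → ℂ := fun t x => ∫ s in (0 : ℝ)..t, h' s (x + σ * (t - s))
  have c3 : ∀ {k : ℝ → ℝ → ℂ}, (Continuous fun z : ℝ × ℝ => k z.1 z.2) →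
      Continuous fun z : (ℝ × ℝ) × ℝ => k z.2 (z.1.2 + σ * (z.1.1 - z.2)) := fun hk =>
    hk.comp (by fun_prop : Continuous fun z : (ℝ × ℝ) × ℝ => (z.2, z.1.2 + σ * (z.1.1 - z.2)))
  have cR : Continuous fun z : ℝ × ℝ => R z.1 z.2 :=
    intervalIntegral.continuous_parametric_intervalIntegral_of_continuous
      (f := fun (z : ℝ × ℝ) s => h' s (z.2 + σ * (z.1 - s))) (c3 ch') continuous_fst
  have dLx : ∀ t x, HasDerivAt (fun y => Lf t y) (R t x) x := fun t x =>
    hasDerivAt_intervalIntegral_param (S := univ) isOpen_univ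
      (h := fun y s => h s (y + σ * (t - s))) (h' := fun y s => h' s (y + σ * (t - s)))
      ((c3 ch).comp (by fun_prop : Continuous fun v : ℝ × ℝ => ((t, v.1), v.2))).continuousOn
      ((c3 ch').comp (by fun_prop : Continuous fun v : ℝ × ℝ => ((t, v.1), v.2))).continuousOn
      (fun y _ s => (hd s (y + σ * (t - s))).comp_add_const y _) (mem_univ x) 0 t
  have dLt : ∀ t x, HasDerivAt (fun t => Lf t x) (σ * R t x + h t x) t := by
    intro t x
    have := hasDerivAt_intervalIntegral_moving (S := univ) isOpen_univ
      (h := fun t s => h s (x + σ * (t - s))) (h' := fun t s => σ • h' s (x + σ * (t - s)))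
      ((c3 ch).comp (by fun_prop : Continuous fun v : ℝ × ℝ => ((v.1, x), v.2))).continuousOn
      (((c3 ch').comp
        (by fun_prop : Continuous fun v : ℝ × ℝ => ((v.1, x), v.2))).const_smul σ).continuousOn
      (fun t _ s => by
        have h1 : HasDerivAt (fun t => x + σ * (t - s)) σ t := by
          simpa using (((hasDerivAt_id t).sub_const s).const_mul σ).const_add x
        exact (hd s (x + σ * (t - s))).scomp t h1)
      (mem_univ t) (a := fun _ => 0) (b := fun t => t) (hasDerivAt_const _ _) (hasDerivAt_id t)
    refine this.of_eq (fun _ => rfl) ?_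
    rw [intervalIntegral.integral_smul, Complex.real_smul]
    simp [R]
    ring
  have hσ0 : σ ≠ 0 := by rcases hσ with h | h <;> rw [h] <;> norm_num
  have hAi : ∀ t t₀ x, IntervalIntegrable (fun s => A' (x + σ * s)) volume t₀ t := by
    intro t t₀ x
    rcases hσ with h | h
    · have := (hA.loc.intervalIntegrable' (x + t₀) (x + t)).comp_add_left x
      simpa [h] using this
    · have := (hA.loc.intervalIntegrable' (x - t₀) (x - t)).comp_sub_left x
      simpa [h, sub_eq_add_neg] using this
  have hAs : ∀ t t₀ x, A (x + σ * t) - A (x + σ * t₀) = ∫ s in t₀..t, σ * A' (x + σ * s) := by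
    intro t t₀ x
    rw [hA.sub_eq, intervalIntegral.integral_const_mul,
      intervalIntegral.integral_comp_add_mul (fun y => A' y) hσ0 x, Complex.real_smul, ← mul_assoc]
    rw [Complex.ofReal_inv, mul_inv_cancel₀ (by exact_mod_cast hσ0), one_mul]
  have hR1 : ∀ x, Continuous fun s => R s x := fun x =>
    cR.comp (by fun_prop : Continuous fun s : ℝ => (s, x))
  have hh1 : ∀ x, Continuous fun s => h s x := fun x =>
    ch.comp (by fun_prop : Continuous fun s : ℝ => (s, x))
  -- A' is only locally square integrable, so the transport equation P_t = σP_x + h is recorded in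
  -- integrated form. Strong measurability of A' makes its translates jointly measurable.
  refine ⟨fun t x => A' (x + σ * t) + R t x,
    (L2Cont.of_translate hm hl σ).add (L2Cont.of_continuous cR), fun t => ?_, fun t t₀ x => ?_,
    fun t t₀ x => ?_⟩
  · have h1 := (hA.comp_add (σ * t)).add (IsPrimitive.of_hasDerivAt (dLx t)
      (cR.comp (by fun_prop : Continuous fun y : ℝ => (t, y))))
    have e : P t = fun x => A (x + σ * t) + Lf t x := funext fun x => hP t x
    rw [e]; exact h1
  · exact (hAi t t₀ x).add ((hR1 x).intervalIntegrable _ _)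
  · have h1 : ∫ s in t₀..t, (σ * R s x + h s x) = Lf t x - Lf t₀ x :=
      intervalIntegral.integral_eq_sub_of_hasDerivAt (fun s _ => dLt s x)
        ((((hR1 x).const_mul _).add (hh1 x)).intervalIntegrable _ _)
    have e : ∀ s, (σ : ℂ) * (A' (x + σ * s) + R s x) + h s x =
        σ * A' (x + σ * s) + (σ * R s x + h s x) := fun s => by ring
    simp only [e]
    have i1 : IntervalIntegrable (fun s => (σ : ℂ) * A' (x + σ * s)) volume t₀ t :=
      (hAi t t₀ x).const_mul _
    have i2 : IntervalIntegrable (fun s => (σ : ℂ) * R s x + h s x) volume t₀ t :=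
      (((hR1 x).const_mul _).add (hh1 x)).intervalIntegrable _ _
    rw [intervalIntegral.integral_add i1 i2, h1, ← hAs, hP, hP]
    simp only [Lf]
    ring

/-- With u_x = (p-q)/2 and u_t = (p+q)/2, the transport equations p_t = p_x - g(u) and q_t = -q_x -
g(u) give u_xt and u_tt = u_xx - g(u). All continuity claims reduce to L²_loc continuity of p_x and
q_x. The equation with f is needed only at times t ≥ 0, where g and f agree along u. -/
theorem IsWave.isClassicalSolution {g : ℂ → ℂ} {u p q : ℝ → ℝ → ℂ} (hw : IsWave g u p q)
    (hg : ContDiff ℝ 1 g) {A A' B B' : ℝ → ℂ} (hA : IsPrimitive A A') (hB : IsPrimitive B B')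
    (mA : StronglyMeasurable A') (mB : StronglyMeasurable B') (lA : LocL2 A') (lB : LocL2 B')
    (hp : ∀ t x, p t x = A (x + t) + ∫ s in (0 : ℝ)..t, -g (u s (x + (t - s))))
    (hq : ∀ t x, q t x = B (x - t) + ∫ s in (0 : ℝ)..t, -g (u s (x - (t - s))))
    {f : ℝ → ℝ} (hf : ∀ t, 0 ≤ t → ∀ x, g (u t x) = (f (‖u t x‖ ^ 2) : ℂ) * u t x)
    {u₀ u₁ : ℝ → ℂ} (h₀ : u 0 =ᵐ[volume] u₀) (h₁ : (fun x => (A x + B x) / 2) =ᵐ[volume] u₁) :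
    IsClassicalSolution f u₀ u₁ u := by
  have cu := hw.cont_u
  have cp := hw.cont_p
  have cq := hw.cont_q
  have hgd : ∀ z, HasFDerivAt g (fderiv ℝ g z) z := fun z =>
    (hg.differentiable (by norm_num) z).hasFDerivAt
  have cgd : Continuous (fderiv ℝ g) := hg.continuous_fderiv (by norm_num)
  let G : ℝ → ℝ → ℂ := fun t x => fderiv ℝ g (u t x) ((p t x - q t x) / 2)
  have cG : Continuous fun z : ℝ × ℝ => -G z.1 z.2 :=
    ((cgd.comp cu).clm_apply (by fun_prop)).neg
  have cgu : Continuous fun z : ℝ × ℝ => -g (u z.1 z.2) := (hg.continuous.comp cu).neg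
  have dG : ∀ t x, HasDerivAt (fun y => -g (u t y)) (-G t x) x := fun t x =>
    ((hgd (u t x)).comp_hasDerivAt x (hw.dx t x)).neg
  obtain ⟨px, lpx, ppx, ipx, hpt⟩ := exists_charDeriv (h := fun t x => -g (u t x))
    (h' := fun t x => -G t x) cgu cG dG hA mA lA (σ := 1) (Or.inl rfl) (P := p)
    (fun t x => by rw [hp]; simp)
  obtain ⟨qx, lqx, pqx, iqx, hqt⟩ := exists_charDeriv (h := fun t x => -g (u t x))
    (h' := fun t x => -G t x) cgu cG dG hB mB lB (σ := -1) (Or.inr rfl) (P := q)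
    (fun t x => by rw [hq]; simp [sub_eq_add_neg])
  have slice : ∀ {k : ℝ → ℝ → ℂ}, (Continuous fun z : ℝ × ℝ => k z.1 z.2) →
      ∀ x, Continuous fun s => k s x := fun hk x =>
    hk.comp (by fun_prop : Continuous fun s : ℝ => (s, x))
  have slice' : ∀ {k : ℝ → ℝ → ℂ}, (Continuous fun z : ℝ × ℝ => k z.1 z.2) →
      ∀ t, Continuous fun x => k t x := fun hk t =>
    hk.comp (by fun_prop : Continuous fun x : ℝ => (t, x))
  let ux : ℝ → ℝ → ℂ := fun t x => (1 / 2) * (p t x - q t x)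
  let ut : ℝ → ℝ → ℂ := fun t x => (1 / 2) * (p t x + q t x)
  let uxx : ℝ → ℝ → ℂ := fun t x => (1 / 2) * (px t x - qx t x)
  let utx : ℝ → ℝ → ℂ := fun t x => (1 / 2) * (px t x + qx t x)
  let utt : ℝ → ℝ → ℂ := fun t x => (1 / 2) * (px t x - qx t x) + -g (u t x)
  have lu : L2Cont u := L2Cont.of_continuous cu
  have cux : Continuous fun z : ℝ × ℝ => ux z.1 z.2 := by simp only [ux]; fun_prop
  have cut : Continuous fun z : ℝ × ℝ => ut z.1 z.2 := by simp only [ut]; fun_prop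
  have lux : L2Cont ux := L2Cont.of_continuous cux
  have lut : L2Cont ut := L2Cont.of_continuous cut
  have luxx : L2Cont uxx := (lpx.sub lqx).const_mul _
  have lutx : L2Cont utx := (lpx.add lqx).const_mul _
  have lutt : L2Cont utt := luxx.add (L2Cont.of_continuous cgu)
  have pu : ∀ t, IsPrimitive (u t) (ux t) := fun t =>
    IsPrimitive.of_hasDerivAt (fun x => (hw.dx t x).of_eq (fun _ => rfl) (by simp only [ux]; ring))
      (slice' cux t)
  have pux : ∀ t, IsPrimitive (ux t) (uxx t) := fun t => ((ppx t).sub (pqx t)).const_mul _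
  have put : ∀ t, IsPrimitive (ut t) (utx t) := fun t => ((ppx t).add (pqx t)).const_mul _
  have iutx : ∀ t t₀ x, IntervalIntegrable (fun s => utx s x) volume t₀ t := fun t t₀ x =>
    ((ipx t t₀ x).add (iqx t t₀ x)).const_mul _
  have iutt : ∀ t t₀ x, IntervalIntegrable (fun s => utt s x) volume t₀ t := fun t t₀ x =>
    (((ipx t t₀ x).sub (iqx t t₀ x)).const_mul _).add ((slice (k := fun s y => -g (u s y)) cgu x).intervalIntegrable _ _)
  have iut : ∀ t t₀ x, IntervalIntegrable (fun s => ut s x) volume t₀ t := fun t t₀ x =>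
    (slice cut x).intervalIntegrable _ _
  have tu : ∀ t t₀ x, u t x - u t₀ x = ∫ s in t₀..t, ut s x := fun t t₀ x =>
    (intervalIntegral.integral_eq_sub_of_hasDerivAt
      (fun s _ => (hw.dt s x).of_eq (fun _ => rfl) (by simp only [ut]; ring)) (iut t t₀ x)).symm
  have ip1 : ∀ t t₀ x, IntervalIntegrable (fun s => ((1 : ℝ) : ℂ) * px s x + -g (u s x))
      volume t₀ t := fun t t₀ x =>
    ((ipx t t₀ x).const_mul _).add ((slice (k := fun s y => -g (u s y)) cgu x).intervalIntegrable _ _)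
  have iq1 : ∀ t t₀ x, IntervalIntegrable (fun s => ((-1 : ℝ) : ℂ) * qx s x + -g (u s x))
      volume t₀ t := fun t t₀ x =>
    ((iqx t t₀ x).const_mul _).add ((slice (k := fun s y => -g (u s y)) cgu x).intervalIntegrable _ _)
  have tux : ∀ t t₀ x, ux t x - ux t₀ x = ∫ s in t₀..t, utx s x := fun t t₀ x => by
    have e : ux t x - ux t₀ x = (1 / 2) * ((p t x - p t₀ x) - (q t x - q t₀ x)) := by
      simp only [ux]; ring
    rw [e, hpt, hqt, ← intervalIntegral.integral_sub (ip1 t t₀ x) (iq1 t t₀ x),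
      ← intervalIntegral.integral_const_mul]
    refine intervalIntegral.integral_congr fun s _ => ?_
    simp only [utx]
    push_cast
    ring
  have tut : ∀ t t₀ x, ut t x - ut t₀ x = ∫ s in t₀..t, utt s x := fun t t₀ x => by
    have e : ut t x - ut t₀ x = (1 / 2) * ((p t x - p t₀ x) + (q t x - q t₀ x)) := by
      simp only [ut]; ring
    rw [e, hpt, hqt, ← intervalIntegral.integral_add (ip1 t t₀ x) (iq1 t t₀ x),
      ← intervalIntegral.integral_const_mul]
    refine intervalIntegral.integral_congr fun s _ => ?_
    simp only [utt]
    push_cast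
    ring
  have D1 : HasTimeDerivHLoc 1 u ut := lut.hasTimeDerivHLoc_succ tu iut pu put
    (lutx.hasTimeDerivHLoc_zero tux iutx)
  have D0 : HasTimeDerivHLoc 0 u ut := lut.hasTimeDerivHLoc_zero tu iut
  have D2 : HasTimeDerivHLoc 0 ut utt := lutt.hasTimeDerivHLoc_zero tut iutt
  refine ⟨lu.contHLoc_succ pu (lux.contHLoc_succ pux luxx.contHLoc_zero),
    ⟨lu.contHLoc_succ pu lux.contHLoc_zero, ut, D1, lut.contHLoc_succ put lutx.contHLoc_zero⟩,
    ⟨lu.contHLoc_zero, ut, D0, lut.contHLoc_zero, utt, D2, lutt.contHLoc_zero⟩,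
    ut, utt, D1, D2, fun t ht => ⟨ux t, uxx t, (pu t).hasWeakDerivOn _, (pux t).hasWeakDerivOn _,
      Eventually.of_forall fun x => ?_⟩, h₀, ?_⟩
  · rw [← hf t ht x]
    simp only [utt, uxx]
    ring
  · refine EventuallyEq.trans (Eventually.of_forall fun x => ?_) h₁
    simp only [ut]
    rw [hp, hq]
    simp
    ring

end Regularity

end KleinGordon

namespace KleinGordon

/-! ### Spatial mollification of curves in L²_loc. -/

section Mollification

/-- The convolution of `v` with the kernel `ρ`. -/
noncomputable def mollify (ρ : ℝ → ℝ) (v : ℝ → ℂ) (x : ℝ) : ℂ := ∫ y, ρ (x - y) • v y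

theorem mollify_eq_convolution (ρ : ℝ → ℝ) (v : ℝ → ℂ) :
    mollify ρ v = convolution ρ v (ContinuousLinearMap.lsmul ℝ ℝ) volume := by
  ext x
  rw [convolution_lsmul_swap, mollify]

theorem mollify_congr_ae {ρ : ℝ → ℝ} {v w : ℝ → ℂ} (h : v =ᵐ[volume] w) :
    mollify ρ v = mollify ρ w := by
  ext x
  refine integral_congr_ae ?_
  filter_upwards [h] with y hy
  rw [hy]

variable {ρ : ℝ → ℝ} {v w : ℝ → ℂ}

theorem integrable_mollify (hρ : Continuous ρ) (hc : HasCompactSupport ρ)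
    (hv : LocallyIntegrable v volume) (x : ℝ) : Integrable (fun y => ρ (x - y) • v y) volume := by
  have h1 : HasCompactSupport fun y => ρ (x - y) := by
    exact hc.comp_homeomorph (Homeomorph.subLeft x)
  exact hv.integrable_smul_left_of_hasCompactSupport (by fun_prop) h1

theorem mollify_sub (hρ : Continuous ρ) (hc : HasCompactSupport ρ)
    (hv : LocallyIntegrable v volume) (hw : LocallyIntegrable w volume) (x : ℝ) :
    mollify ρ (fun y => v y - w y) x = mollify ρ v x - mollify ρ w x := by
  simp only [mollify, smul_sub]
  exact integral_sub (integrable_mollify hρ hc hv x) (integrable_mollify hρ hc hw x)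

theorem mollify_smul (c : ℝ) (x : ℝ) :
    mollify ρ (fun y => c • v y) x = c • mollify ρ v x := by
  simp only [mollify, ← integral_smul, smul_comm c]

theorem hasDerivAt_mollify (hρ : ContDiff ℝ 1 ρ) (hc : HasCompactSupport ρ)
    (hv : LocallyIntegrable v volume) (x : ℝ) :
    HasDerivAt (mollify ρ v) (mollify (deriv ρ) v x) x := by
  simp only [mollify_eq_convolution]
  exact hc.hasDerivAt_convolution_left _ hρ hv x

theorem mollify_deriv (hρ : ContDiff ℝ (⊤ : ℕ∞) ρ) (hc : HasCompactSupport ρ)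
    (h : HasWeakDerivOn univ v w) (x : ℝ) : mollify (deriv ρ) v x = mollify ρ w x := by
  have h1 : HasCompactSupport fun y => ρ (x - y) := hc.comp_homeomorph (Homeomorph.subLeft x)
  have h2 := h.2.2 (fun y => ρ (x - y)) (by fun_prop) h1 (subset_univ _)
  have h3 : ∀ y, deriv (fun y => ρ (x - y)) y = -deriv ρ (x - y) := fun y => deriv_comp_const_sub ..
  simp only [h3, neg_smul, integral_neg, neg_inj] at h2
  exact h2

/-- Mollification maps L²_loc to locally bounded functions with a constant uniform over |x| ≤ X.
This transfers limits in L²_loc, in particular time derivatives, to pointwise limits of the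
mollified functions. -/
theorem exists_enorm_mollify_le (hρ : Continuous ρ) (hc : HasCompactSupport ρ) (X : ℝ) :
    ∃ r > 0, ∃ C : ℝ≥0, ∀ x, |x| ≤ X → ∀ v : ℝ → ℂ,
      AEStronglyMeasurable v (volume.restrict (Ioo (-r) r)) →
      ‖mollify ρ v x‖ₑ ≤ C * eLpNorm v 2 (volume.restrict (Ioo (-r) r)) := by
  obtain ⟨B, hB⟩ := hc.exists_bound_of_continuous hρ
  obtain ⟨s, hs⟩ := hc.isBounded.subset_closedBall 0
  set r := |X| + |s| + 1 with hr
  have hr0 : 0 < r := by positivity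
  refine ⟨r, hr0, B.toNNReal * (2 * r).toNNReal ^ (1 / 2 : ℝ), fun x hx v hv => ?_⟩
  calc ‖mollify ρ v x‖ₑ ≤ ∫⁻ y, ‖ρ (x - y) • v y‖ₑ := enorm_integral_le_lintegral_enorm _
    _ ≤ ∫⁻ y, (Ioo (-r) r).indicator (fun y => (B.toNNReal : ℝ≥0∞) * ‖v y‖ₑ) y := by
        refine lintegral_mono fun y => ?_
        by_cases hy : y ∈ Ioo (-r) r
        · rw [indicator_of_mem hy, enorm_smul]
          gcongr
          rw [Real.enorm_eq_ofReal_abs]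
          exact ENNReal.ofReal_le_ofReal (hB _)
        · rw [indicator_of_notMem hy]
          have : ρ (x - y) = 0 := by
            by_contra h0
            apply hy
            have h1 := hs (subset_tsupport _ h0)
            rw [mem_closedBall_zero_iff, Real.norm_eq_abs] at h1
            have h2 := abs_le.1 (h1.trans (le_abs_self s))
            have h3 := abs_le.1 (hx.trans (le_abs_self X))
            constructor <;> linarith [h2.1, h2.2, h3.1, h3.2]
          rw [this]; simp
    _ = B.toNNReal * eLpNorm v 1 (volume.restrict (Ioo (-r) r)) := by
        rw [lintegral_indicator measurableSet_Ioo, lintegral_const_mul' _ _ (by simp),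
          eLpNorm_one_eq_lintegral_enorm]
    _ ≤ B.toNNReal * (eLpNorm v 2 (volume.restrict (Ioo (-r) r)) *
          ((2 * r).toNNReal : ℝ≥0∞) ^ (1 / 2 : ℝ)) := by
        gcongr
        refine (eLpNorm_le_eLpNorm_mul_rpow_measure_univ (by norm_num : (1 : ℝ≥0∞) ≤ 2)
          hv).trans (le_of_eq ?_)
        rw [Measure.restrict_apply MeasurableSet.univ, univ_inter, Real.volume_Ioo]
        congr 2
        · rw [ENNReal.ofReal]; congr 2; ring
        · norm_num
    _ = _ := by
        rw [ENNReal.coe_mul, ENNReal.coe_rpow_of_nonneg _ (by norm_num)]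
        ring

theorem MemHLoc.locallyIntegrable {m : ℕ} (h : MemHLoc m v) : LocallyIntegrable v volume := by
  rw [locallyIntegrable_iff]
  intro K hK
  obtain ⟨s, hs⟩ := hK.isBounded.subset_closedBall 0
  have h1 : MemLp v 2 (volume.restrict (Ioo (-(|s| + 1)) (|s| + 1))) := by
    have := h (|s| + 1) (by positivity)
    cases m with
    | zero => exact this
    | succ m => exact this.1
  have h2 : IntegrableOn v (Ioo (-(|s| + 1)) (|s| + 1)) volume := by
    rw [IntegrableOn, ← memLp_one_iff_integrable]
    exact h1.mono_exponent (by norm_num)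
  refine h2.mono_set fun y hy => ?_
  have := hs hy
  rw [mem_closedBall_zero_iff, Real.norm_eq_abs] at this
  have := abs_le.1 (this.trans (le_abs_self s))
  constructor <;> linarith [this.1, this.2]

theorem continuousOn_mollify (hρ : Continuous ρ) (hc : HasCompactSupport ρ) {U : ℝ → ℝ → ℂ}
    (hU : ContHLoc 0 U) :
    ContinuousOn (fun z : ℝ × ℝ => mollify ρ (U z.1) z.2) (Ici 0 ×ˢ univ) := by
  rintro ⟨s, x⟩ ⟨hs, -⟩
  obtain ⟨r, hr, C, hC⟩ := exists_enorm_mollify_le hρ hc (|x| + 1)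
  have h1 : Continuous (mollify ρ (U s)) := by
    rw [mollify_eq_convolution]
    exact hc.continuous_convolution_left _ hρ (hU.1 s hs).locallyIntegrable
  have h2 : Tendsto (fun z : ℝ × ℝ => mollify ρ (U z.1) z.2 - mollify ρ (U s) z.2)
      (𝓝[Ici 0 ×ˢ univ] (s, x)) (𝓝 0) := by
    rw [tendsto_zero_iff_enorm_tendsto_zero]
    have h3 : Tendsto (fun z : ℝ × ℝ => (C : ℝ≥0∞) * hNorm 0 (Ioo (-r) r)
        (fun y => U z.1 y - U s y)) (𝓝[Ici 0 ×ˢ univ] (s, x)) (𝓝 0) := by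
      have h4 := ENNReal.Tendsto.const_mul (hU.2 s hs r hr) (Or.inr (ENNReal.coe_ne_top (r := C)))
      rw [mul_zero] at h4
      refine h4.comp ?_
      rw [nhdsWithin_prod_eq]
      exact tendsto_fst
    refine tendsto_of_tendsto_of_tendsto_of_le_of_le' tendsto_const_nhds h3
      (Eventually.of_forall fun _ => zero_le) ?_
    have h5 : ∀ᶠ z : ℝ × ℝ in 𝓝[Ici 0 ×ˢ univ] (s, x), |z.2| ≤ |x| + 1 := by
      refine Filter.Eventually.filter_mono nhdsWithin_le_nhds ?_
      have : Continuous fun z : ℝ × ℝ => |z.2| := by fun_prop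
      exact this.continuousAt.eventually_le_const (by simp)
    filter_upwards [h5, self_mem_nhdsWithin] with z hz hz'
    rw [← mollify_sub hρ hc (hU.1 _ hz'.1).locallyIntegrable (hU.1 s hs).locallyIntegrable,
      hNorm_zero]
    refine hC _ hz _ ?_
    exact ((hU.1 _ hz'.1).locallyIntegrable.aestronglyMeasurable.sub
      (hU.1 s hs).locallyIntegrable.aestronglyMeasurable).restrict
  have h6 : Tendsto (fun z : ℝ × ℝ => mollify ρ (U s) z.2) (𝓝[Ici 0 ×ˢ univ] (s, x))
      (𝓝 (mollify ρ (U s) x)) := by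
    have : Continuous fun z : ℝ × ℝ => mollify ρ (U s) z.2 := h1.comp continuous_snd
    exact (this.tendsto (s, x)).mono_left nhdsWithin_le_nhds
  have := h2.add h6
  simpa [ContinuousWithinAt] using this

theorem hasDerivAt_mollify_time (hρ : Continuous ρ) (hc : HasCompactSupport ρ)
    {U V : ℝ → ℝ → ℂ} (hU : ContHLoc 0 U) (hV : HasTimeDerivHLoc 0 U V) {t : ℝ} (ht : 0 < t)
    (x : ℝ) : HasDerivAt (fun s => mollify ρ (U s) x) (mollify ρ (V t) x) t := by
  obtain ⟨r, hr, C, hC⟩ := exists_enorm_mollify_le hρ hc |x|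
  rw [hasDerivAt_iff_tendsto_slope, ← tendsto_sub_nhds_zero_iff,
    tendsto_zero_iff_enorm_tendsto_zero]
  have h0 : 𝓝[Ici 0 \ {t}] t = 𝓝[≠] t := by
    rw [sdiff_eq, nhdsWithin_inter, nhdsWithin_eq_nhds.2 (Ici_mem_nhds ht)]
    exact inf_eq_right.2 nhdsWithin_le_nhds
  have h4 := ENNReal.Tendsto.const_mul (hV.2 t ht.le r hr) (Or.inr (ENNReal.coe_ne_top (r := C)))
  rw [mul_zero, h0] at h4
  refine tendsto_of_tendsto_of_tendsto_of_le_of_le' tendsto_const_nhds h4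
      (Eventually.of_forall fun _ => zero_le) ?_
  have h5 : ∀ᶠ s in 𝓝[≠] t, 0 ≤ s :=
    Filter.Eventually.filter_mono nhdsWithin_le_nhds (Ici_mem_nhds ht)
  filter_upwards [h5] with s hs
  have l1 := (hU.1 s hs).locallyIntegrable
  have l2 := (hU.1 t ht.le).locallyIntegrable
  have l3 := (hV.1 t ht.le).locallyIntegrable
  have l4 : LocallyIntegrable (fun y => U s y - U t y) volume := l1.sub l2
  have l5 : LocallyIntegrable (fun y => (s - t)⁻¹ • (U s y - U t y)) volume := l4.smul (s - t)⁻¹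
  have l6 : LocallyIntegrable (fun y => (s - t)⁻¹ • (U s y - U t y) - V t y) volume := l5.sub l3
  rw [slope, vsub_eq_sub, ← mollify_sub hρ hc l1 l2, ← mollify_smul, ← mollify_sub hρ hc l5 l3,
    hNorm_zero]
  exact hC x le_rfl _ l6.aestronglyMeasurable.restrict

end Mollification

end KleinGordon

namespace KleinGordon

/-! ### Uniqueness of classical solutions. -/

section Uniqueness

/-- Limits in L²_loc are unique, and every t ≥ 0 is accumulated from the right. This identifies the
time derivatives supplied by the separate existential clauses in the notion of solution. -/
theorem HasTimeDerivHLoc.ae_eq {U U' V V' : ℝ → ℝ → ℂ} (hU : ContHLoc 0 U)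
    (h : HasTimeDerivHLoc 0 U V) (h' : HasTimeDerivHLoc 0 U' V')
    (e : ∀ t, 0 ≤ t → U t =ᵐ[volume] U' t) (t : ℝ) (ht : 0 ≤ t) : V t =ᵐ[volume] V' t := by
  have key : ∀ r : ℝ, 0 < r → V t =ᵐ[volume.restrict (Ioo (-r) r)] V' t := by
    intro r hr
    have l3 := (h.1 t ht).locallyIntegrable.aestronglyMeasurable
    have l4 := (h'.1 t ht).locallyIntegrable.aestronglyMeasurable
    have h1 := (h.2 t ht r hr).add (h'.2 t ht r hr)
    rw [add_zero] at h1
    have hne : (𝓝[Ici 0 \ {t}] t).NeBot := by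
      refine NeBot.mono (inferInstance : (𝓝[>] t).NeBot) (nhdsWithin_mono t fun s hs => ?_)
      exact ⟨ht.trans (le_of_lt hs), ne_of_gt hs⟩
    have h2 : eLpNorm (V t - V' t) 2 (volume.restrict (Ioo (-r) r)) ≤ 0 := by
      refine ge_of_tendsto h1 ?_
      filter_upwards [self_mem_nhdsWithin] with s hs
      have l1 := (hU.1 s hs.1).locallyIntegrable.aestronglyMeasurable
      have l2 := (hU.1 t ht).locallyIntegrable.aestronglyMeasurable
      have l5 : AEStronglyMeasurable (fun x => (s - t)⁻¹ • (U s x - U t x)) volume :=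
        (l1.sub l2).const_smul (s - t)⁻¹
      have l6 : AEStronglyMeasurable (fun x => (s - t)⁻¹ • (U s x - U t x) - V t x) volume :=
        l5.sub l3
      have l7 : AEStronglyMeasurable (fun x => (s - t)⁻¹ • (U s x - U t x) - V' t x) volume :=
        l5.sub l4
      have e1 : eLpNorm (fun x => (s - t)⁻¹ • (U' s x - U' t x) - V' t x) 2
          (volume.restrict (Ioo (-r) r)) =
          eLpNorm (fun x => (s - t)⁻¹ • (U s x - U t x) - V' t x) 2
          (volume.restrict (Ioo (-r) r)) := by
        refine eLpNorm_congr_ae (ae_restrict_of_ae ?_)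
        filter_upwards [e s hs.1, e t ht] with x h1 h2
        rw [h1, h2]
      rw [hNorm_zero, hNorm_zero, e1, add_comm]
      have e2 : V t - V' t = (fun x => (s - t)⁻¹ • (U s x - U t x) - V' t x) -
          (fun x => (s - t)⁻¹ • (U s x - U t x) - V t x) := by
        ext x; simp
      rw [e2]
      exact eLpNorm_sub_le l7.restrict l6.restrict (by norm_num)
    have h3 := (eLpNorm_eq_zero_iff (l3.sub l4).restrict (by norm_num)).1 (le_antisymm h2 zero_le)
    filter_upwards [h3] with x hx
    exact sub_eq_zero.1 hx
  have h1 : ∀ n : ℕ, ∀ᵐ x, x ∈ Ioo (-((n : ℝ) + 1)) ((n : ℝ) + 1) → V t x = V' t x := fun n =>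
    (ae_restrict_iff' measurableSet_Ioo).1 (key _ (by positivity))
  filter_upwards [ae_all_iff.2 h1] with x hx
  obtain ⟨n, hn⟩ := exists_nat_gt |x|
  have := abs_lt.1 hn
  exact hx n ⟨by linarith, by linarith⟩

/-- `u ∈ C²([0,∞), L²_loc)` solves `u_tt - u_xx + G = 0`, with `v = u_t` and `z = u_tt`. -/
structure IsRegular (G u v z : ℝ → ℝ → ℂ) : Prop where
  cu : ContHLoc 0 u
  cv : ContHLoc 0 v
  cz : ContHLoc 0 z
  du : HasTimeDerivHLoc 0 u v
  dv : HasTimeDerivHLoc 0 v z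
  eq : ∀ t, 0 ≤ t → ∃ ux uxx : ℝ → ℂ, HasWeakDerivOn univ (u t) ux ∧
    HasWeakDerivOn univ ux uxx ∧ ∀ᵐ x : ℝ, z t x - uxx x + G t x = 0

theorem IsClassicalSolution.exists_isRegular {f : ℝ → ℝ} {u₀ u₁ : ℝ → ℂ} {u : ℝ → ℝ → ℂ}
    (h : IsClassicalSolution f u₀ u₁ u) :
    ∃ v z, IsRegular (fun t x => (f (‖u t x‖ ^ 2) : ℂ) * u t x) u v z ∧ v 0 =ᵐ[volume] u₁ := by
  obtain ⟨-, -, ⟨cu, v, du, cv, z, dv, cz⟩, ut, utt, d1, d2, heq, -, h1⟩ := h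
  have d1' : HasTimeDerivHLoc 0 u ut := by
    refine ⟨fun t ht r hr => (d1.1 t ht r hr).1, fun t ht r hr => ?_⟩
    refine tendsto_of_tendsto_of_tendsto_of_le_of_le tendsto_const_nhds (d1.2 t ht r hr)
      (fun _ => zero_le) fun s => ?_
    dsimp only
    rw [hNorm_zero]
    exact eLpNorm_le_hNorm _ _ _
  -- The derivatives witnessing C² in L²_loc agree almost everywhere with those for which the
  -- equation is stated.
  have e1 := du.ae_eq cu d1' (fun _ _ => EventuallyEq.rfl)
  have e2 := dv.ae_eq cv d2 e1
  refine ⟨v, z, ⟨cu, cv, cz, du, dv, fun t ht => ?_⟩, (e1 0 le_rfl).trans h1⟩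
  obtain ⟨ux, uxx, w1, w2, hh⟩ := heq t ht
  refine ⟨ux, uxx, w1, w2, ?_⟩
  filter_upwards [hh, e2 t ht] with x h1 h2
  rw [h2, h1]

theorem IsRegular.locallyIntegrable {G u v z : ℝ → ℝ → ℂ} (h : IsRegular G u v z) (t : ℝ)
    (ht : 0 ≤ t) : LocallyIntegrable (G t) volume := by
  obtain ⟨ux, uxx, w1, w2, hh⟩ := h.eq t ht
  have h1 : LocallyIntegrable (fun x => uxx x - z t x) volume :=
    (locallyIntegrableOn_univ.1 w2.2.1).sub (h.cz.1 t ht).locallyIntegrable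
  refine h1.congr ?_
  filter_upwards [hh] with x hx
  linear_combination -hx

theorem IsRegular.mollify_eq {G u v z : ℝ → ℝ → ℂ} (h : IsRegular G u v z) {ρ : ℝ → ℝ}
    (hρ : ContDiff ℝ (⊤ : ℕ∞) ρ) (hc : HasCompactSupport ρ) (t : ℝ) (ht : 0 ≤ t) (x : ℝ) :
    mollify ρ (z t) x - mollify (deriv (deriv ρ)) (u t) x = -mollify ρ (G t) x := by
  obtain ⟨ux, uxx, w1, w2, hh⟩ := h.eq t ht
  have hρ' : ContDiff ℝ (⊤ : ℕ∞) (deriv ρ) := (contDiff_infty_iff_deriv.1 hρ).2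
  rw [mollify_deriv hρ' hc.deriv w1, mollify_deriv hρ hc w2]
  have e : G t =ᵐ[volume] fun x => uxx x - z t x := by
    filter_upwards [hh] with x hx
    linear_combination hx
  rw [mollify_congr_ae e, mollify_sub hρ.continuous hc (locallyIntegrableOn_univ.1 w2.2.1)
    (h.cz.1 t ht).locallyIntegrable]
  ring

/-- Mollification in x makes the function smooth enough for the chain rule; on the line x = ξ - σs
the mixed terms cancel, and σ² = 1 leaves the mollified u_tt - u_xx. -/
theorem IsRegular.hasDerivAt_char {G u v z : ℝ → ℝ → ℂ} (h : IsRegular G u v z) {ρ : ℝ → ℝ}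
    (hρ : ContDiff ℝ (⊤ : ℕ∞) ρ) (hc : HasCompactSupport ρ) {σ : ℝ} (hσ : σ * σ = 1) {s : ℝ}
    (hs : 0 < s) (ξ : ℝ) :
    HasDerivAt (fun s => mollify ρ (v s) (ξ - σ * s) + σ • mollify (deriv ρ) (u s) (ξ - σ * s))
      (mollify ρ (z s) (ξ - σ * s) - mollify (deriv (deriv ρ)) (u s) (ξ - σ * s)) s := by
  have hρ' : ContDiff ℝ (⊤ : ℕ∞) (deriv ρ) := (contDiff_infty_iff_deriv.1 hρ).2
  have hρ'' : ContDiff ℝ (⊤ : ℕ∞) (deriv (deriv ρ)) := (contDiff_infty_iff_deriv.1 hρ').2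
  have hξ : HasDerivAt (fun s => ξ - σ * s) (-σ) s := by
    simpa using ((hasDerivAt_id s).const_mul σ).const_sub ξ
  have hO : IsOpen (Ioi (0 : ℝ) ×ˢ (univ : Set ℝ)) := isOpen_Ioi.prod isOpen_univ
  have hmem : (s, ξ - σ * s) ∈ Ioi (0 : ℝ) ×ˢ (univ : Set ℝ) := ⟨hs, mem_univ _⟩
  have hev : ∀ᶠ w : ℝ × ℝ in 𝓝 (s, ξ - σ * s), 0 < w.1 := by
    filter_upwards [hO.mem_nhds hmem] with w hw using hw.1
  have hcont : ∀ {κ : ℝ → ℝ} {U : ℝ → ℝ → ℂ}, Continuous κ → HasCompactSupport κ →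
      ContHLoc 0 U → ContinuousAt (fun w : ℝ × ℝ => mollify κ (U w.1) w.2) (s, ξ - σ * s) :=
    fun h1 h2 h3 => (continuousOn_mollify h1 h2 h3).continuousAt
      (mem_of_superset (hO.mem_nhds hmem) (prod_mono Ioi_subset_Ici_self subset_rfl))
  have d1 := hasDerivAt_comp_of_partial (f := fun s x => mollify ρ (v s) x)
    (f₁ := fun s x => mollify ρ (z s) x) (f₂ := fun s x => mollify (deriv ρ) (v s) x) (s := s)
    (τ := fun s => s)
    (hev.mono fun w hw => hasDerivAt_mollify_time hρ.continuous hc h.cv h.dv hw w.2)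
    (hev.mono fun w hw => hasDerivAt_mollify (hρ.of_le (by norm_num)) hc
      (h.cv.1 w.1 hw.le).locallyIntegrable w.2)
    (hcont hρ.continuous hc h.cz) (hcont hρ'.continuous hc.deriv h.cv) (hasDerivAt_id s) hξ
  have d2 := hasDerivAt_comp_of_partial (f := fun s x => mollify (deriv ρ) (u s) x)
    (f₁ := fun s x => mollify (deriv ρ) (v s) x)
    (f₂ := fun s x => mollify (deriv (deriv ρ)) (u s) x) (s := s) (τ := fun s => s)
    (hev.mono fun w hw => hasDerivAt_mollify_time hρ'.continuous hc.deriv h.cu h.du hw w.2)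
    (hev.mono fun w hw => hasDerivAt_mollify (hρ'.of_le (by norm_num)) hc.deriv
      (h.cu.1 w.1 hw.le).locallyIntegrable w.2)
    (hcont hρ'.continuous hc.deriv h.cv) (hcont hρ''.continuous hc.deriv.deriv h.cu)
    (hasDerivAt_id s) hξ
  refine (d1.add (d2.const_smul σ)).of_eq (fun _ => rfl) ?_
  simp only [one_smul, smul_add, smul_smul]
  rw [mul_neg, hσ]
  module

theorem norm_le_exp_of_hasDerivAt {φ φ' : ℝ → ℂ} {t κ lam : ℝ} (ht : 0 ≤ t) (hlam : 0 < lam)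
    (hκ : 0 ≤ κ) (hc : ContinuousOn φ (Icc 0 t)) (h0 : φ 0 = 0)
    (hd : ∀ s ∈ Ioo 0 t, HasDerivAt φ (φ' s) s) (hc' : ContinuousOn φ' (Icc 0 t))
    (hb : ∀ s ∈ Icc 0 t, ‖φ' s‖ ≤ κ * Real.exp (lam * s)) :
    ‖φ t‖ ≤ κ / lam * Real.exp (lam * t) := by
  have h1 := intervalIntegral.integral_eq_sub_of_hasDerivAt_of_le ht hc hd
    (hc'.intervalIntegrable_of_Icc ht)
  rw [h0, sub_zero] at h1
  have e1 : ∫ s in (0 : ℝ)..t, κ * Real.exp (lam * s) =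
      κ / lam * Real.exp (lam * t) - κ / lam * Real.exp (lam * 0) := by
    refine intervalIntegral.integral_eq_sub_of_hasDerivAt
      (f := fun s => κ / lam * Real.exp (lam * s)) (fun s _ => ?_)
      (Continuous.intervalIntegrable (by fun_prop) _ _)
    have := (((hasDerivAt_id s).const_mul lam).exp).const_mul (κ / lam)
    refine this.congr_deriv ?_
    simp only [id, mul_one]
    field_simp
  rw [← h1]
  refine (intervalIntegral.norm_integral_le_of_norm_le ht
    (Eventually.of_forall fun s hs => hb s (Ioc_subset_Icc_self hs))
    (Continuous.intervalIntegrable (by fun_prop) _ _)).trans ?_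
  rw [e1]
  simp only [mul_zero, Real.exp_zero, mul_one]
  linarith [div_nonneg hκ hlam.le]

/-- Two integrations in time, each gaining 1/λ: first along both characteristics inside the cone,
giving u_t ± u_x and hence u_t of the difference, then at fixed x, giving the difference itself. -/
theorem IsRegular.norm_mollify_sub_le {G₁ u₁ v₁ z₁ G₂ u₂ v₂ z₂ : ℝ → ℝ → ℂ}
    (h₁ : IsRegular G₁ u₁ v₁ z₁) (h₂ : IsRegular G₂ u₂ v₂ z₂) (hu : u₁ 0 =ᵐ[volume] u₂ 0)
    (hv : v₁ 0 =ᵐ[volume] v₂ 0) {ρ : ℝ → ℝ} (hρ : ContDiff ℝ (⊤ : ℕ∞) ρ)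
    (hc : HasCompactSupport ρ) {r κ lam : ℝ} (hlam : 0 < lam) (hκ : 0 ≤ κ)
    (hb : ∀ s, 0 ≤ s → ∀ y, |y| ≤ r - s →
      ‖mollify ρ (G₁ s) y - mollify ρ (G₂ s) y‖ ≤ κ * Real.exp (lam * s))
    {t x : ℝ} (ht : 0 ≤ t) (hx : |x| ≤ r - t) :
    ‖mollify ρ (u₁ t) x - mollify ρ (u₂ t) x‖ ≤ κ / lam / lam * Real.exp (lam * t) := by
  have hρ' : ContDiff ℝ (⊤ : ℕ∞) (deriv ρ) := (contDiff_infty_iff_deriv.1 hρ).2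
  have hρ'' : ContDiff ℝ (⊤ : ℕ∞) (deriv (deriv ρ)) := (contDiff_infty_iff_deriv.1 hρ').2
  have hline : ∀ {κ : ℝ → ℝ} {U : ℝ → ℝ → ℂ}, Continuous κ → HasCompactSupport κ →
      ContHLoc 0 U → ∀ ξ σ : ℝ, ContinuousOn (fun s => mollify κ (U s) (ξ - σ * s)) (Ici 0) :=
    fun k1 k2 k3 ξ σ => (continuousOn_mollify k1 k2 k3).comp
      (by fun_prop : Continuous fun s : ℝ => (s, ξ - σ * s)).continuousOn
      (fun s hs => ⟨hs, mem_univ _⟩)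
  have key : ∀ σ : ℝ, σ * σ = 1 → |σ| = 1 → ∀ s, 0 ≤ s → ∀ y, |y| ≤ r - s →
      ‖(mollify ρ (v₁ s) y + σ • mollify (deriv ρ) (u₁ s) y) -
        (mollify ρ (v₂ s) y + σ • mollify (deriv ρ) (u₂ s) y)‖ ≤
        κ / lam * Real.exp (lam * s) := by
    intro σ hσ hσ' s hs y hy
    set ξ := y + σ * s with hξ
    have hsub : Icc 0 s ⊆ Ici (0 : ℝ) := Icc_subset_Ici_self
    have hP : ∀ {G u v z : ℝ → ℝ → ℂ}, IsRegular G u v z → ContinuousOn (fun s =>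
        mollify ρ (v s) (ξ - σ * s) + σ • mollify (deriv ρ) (u s) (ξ - σ * s)) (Icc 0 s) :=
      fun h => ((hline hρ.continuous hc h.cv ξ σ).add
        ((hline hρ'.continuous hc.deriv h.cu ξ σ).const_smul σ)).mono hsub
    have hN : ∀ {G u v z : ℝ → ℝ → ℂ}, IsRegular G u v z → ContinuousOn (fun s =>
        mollify ρ (z s) (ξ - σ * s) - mollify (deriv (deriv ρ)) (u s) (ξ - σ * s)) (Icc 0 s) :=
      fun h => ((hline hρ.continuous hc h.cz ξ σ).sub
        (hline hρ''.continuous hc.deriv.deriv h.cu ξ σ)).mono hsub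
    have := norm_le_exp_of_hasDerivAt (φ := fun s =>
        (mollify ρ (v₁ s) (ξ - σ * s) + σ • mollify (deriv ρ) (u₁ s) (ξ - σ * s)) -
        (mollify ρ (v₂ s) (ξ - σ * s) + σ • mollify (deriv ρ) (u₂ s) (ξ - σ * s)))
      hs hlam hκ ((hP h₁).sub (hP h₂)) ?_
      (fun τ hτ => (h₁.hasDerivAt_char hρ hc hσ hτ.1 ξ).sub (h₂.hasDerivAt_char hρ hc hσ hτ.1 ξ))
      ((hN h₁).sub (hN h₂)) ?_
    · have e : ξ - σ * s = y := by rw [hξ]; ring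
      simpa only [e] using this
    · simp only [mollify_congr_ae hu, mollify_congr_ae hv, sub_self]
    · intro τ hτ
      rw [h₁.mollify_eq hρ hc τ hτ.1, h₂.mollify_eq hρ hc τ hτ.1, ← neg_sub', norm_neg]
      refine hb τ hτ.1 _ ?_
      have e : ξ - σ * τ = y + σ * (s - τ) := by rw [hξ]; ring
      rw [e]
      refine (abs_add_le _ _).trans ?_
      rw [abs_mul, hσ', one_mul, abs_of_nonneg (sub_nonneg.2 hτ.2)]
      linarith
  have hU : ∀ {G u v z : ℝ → ℝ → ℂ}, IsRegular G u v z →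
      ContinuousOn (fun s => mollify ρ (u s) x) (Icc 0 t) := fun h => by
    simpa using (hline hρ.continuous hc h.cu x 0).mono (Icc_subset_Ici_self : Icc 0 t ⊆ _)
  have hV : ∀ {G u v z : ℝ → ℝ → ℂ}, IsRegular G u v z →
      ContinuousOn (fun s => mollify ρ (v s) x) (Icc 0 t) := fun h => by
    simpa using (hline hρ.continuous hc h.cv x 0).mono (Icc_subset_Ici_self : Icc 0 t ⊆ _)
  refine norm_le_exp_of_hasDerivAt (φ := fun s => mollify ρ (u₁ s) x - mollify ρ (u₂ s) x)
    ht hlam (div_nonneg hκ hlam.le) ((hU h₁).sub (hU h₂)) ?_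
    (fun τ hτ => (hasDerivAt_mollify_time hρ.continuous hc h₁.cu h₁.du hτ.1 x).sub
      (hasDerivAt_mollify_time hρ.continuous hc h₂.cu h₂.du hτ.1 x))
    ((hV h₁).sub (hV h₂)) ?_
  · simp only [mollify_congr_ae hu, sub_self]
  · intro s hs
    have hx' : |x| ≤ r - s := by linarith [hs.2]
    have k1 := key 1 (by norm_num) (by norm_num) s hs.1 x hx'
    have k2 := key (-1) (by norm_num) (by norm_num) s hs.1 x hx'
    set A := mollify ρ (v₁ s) x - mollify ρ (v₂ s) x with hA
    set B := mollify (deriv ρ) (u₁ s) x - mollify (deriv ρ) (u₂ s) x with hB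
    have e1 : (mollify ρ (v₁ s) x + (1 : ℝ) • mollify (deriv ρ) (u₁ s) x) -
        (mollify ρ (v₂ s) x + (1 : ℝ) • mollify (deriv ρ) (u₂ s) x) = A + B := by
      rw [hA, hB]; module
    have e2 : (mollify ρ (v₁ s) x + (-1 : ℝ) • mollify (deriv ρ) (u₁ s) x) -
        (mollify ρ (v₂ s) x + (-1 : ℝ) • mollify (deriv ρ) (u₂ s) x) = A - B := by
      rw [hA, hB]; module
    rw [e1] at k1
    rw [e2] at k2
    have h3 : ‖(2 : ℂ) * A‖ ≤ ‖A + B‖ + ‖A - B‖ := by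
      have : (2 : ℂ) * A = (A + B) + (A - B) := by ring
      rw [this]; exact norm_add_le _ _
    rw [norm_mul, Complex.norm_ofNat] at h3
    linarith

theorem exists_ae_enorm_le_hNorm {r : ℝ} (hr : 0 < r) : ∃ C : ℝ≥0, ∀ v : ℝ → ℂ,
    ∀ᵐ y, y ∈ Ioo (-r) r → ‖v y‖ₑ ≤ C * hNorm 1 (Ioo (-r) r) v := by
  set D : ℝ≥0 := (r - -r).toNNReal with hD
  have hD0 : D ≠ 0 := by rw [hD]; simp; linarith
  -- The first two terms are the Sobolev constant. The summand 1 keeps the constant nonzero, so that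
  -- the claim is trivial when the norm is infinite.
  refine ⟨D⁻¹ * D ^ (1 / 2 : ℝ) + D ^ (1 / 2 : ℝ) + 1, fun v => ?_⟩
  by_cases htop : hNorm 1 (Ioo (-r) r) v = ⊤
  · rw [htop]
    refine Eventually.of_forall fun y _ => ?_
    rw [ENNReal.mul_top (by simp)]
    exact le_top
  have h1 : ∃ g, HasWeakDerivOn (Ioo (-r) r) v g := by
    by_contra h
    push Not at h
    apply htop
    simp [hNorm, hNormSq, h]
  obtain ⟨g, hg⟩ := h1
  have hgn : eLpNorm g 2 (volume.restrict (Ioo (-r) r)) ≤ hNorm 1 (Ioo (-r) r) v := by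
    rw [← hNorm_zero]
    exact hNorm_weakDeriv_le isOpen_Ioo hg 0
  have hgm : MemLp g 2 (volume.restrict (Ioo (-r) r)) :=
    ⟨hg.2.1.aestronglyMeasurable, hgn.trans_lt (lt_top_iff_ne_top.2 htop)⟩
  have hi : ∀ x ∈ Ioo (-r) r, (Ioo (-r) r).indicator g x = g x := fun x hx => indicator_of_mem hx _
  have hae : (Ioo (-r) r).indicator g =ᵐ[volume.restrict (Ioo (-r) r)] g :=
    (ae_restrict_iff' measurableSet_Ioo).2 (Eventually.of_forall hi)
  have hgi : LocallyIntegrable ((Ioo (-r) r).indicator g) volume := by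
    refine Integrable.locallyIntegrable ?_
    rw [integrable_indicator_iff measurableSet_Ioo, IntegrableOn, ← memLp_one_iff_integrable]
    exact hgm.mono_exponent (by norm_num)
  obtain ⟨W, hW, hvW⟩ := HasWeakDerivOn.exists_isPrimitive isOpen_Ioo ordConnected_Ioo
    ⟨0, by simpa using hr⟩ (hg.congr measurableSet_Ioo EventuallyEq.rfl hae.symm) hgi
  have hvW' := (ae_restrict_iff' measurableSet_Ioo).1 hvW
  filter_upwards [hvW'] with y hy hmem
  rw [hy hmem]
  refine (hW.enorm_le (by linarith) (Ioo_subset_Icc_self hmem)).trans ?_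
  rw [eLpNorm_congr_ae hae, ← eLpNorm_congr_ae hvW]
  have hvn := eLpNorm_le_hNorm 1 (Ioo (-r) r) v
  have e : ENNReal.ofReal (r - -r) = (D : ℝ≥0∞) := rfl
  rw [e]
  have e2 : ((D⁻¹ * D ^ (1 / 2 : ℝ) + D ^ (1 / 2 : ℝ) + 1 : ℝ≥0) : ℝ≥0∞) =
      (D : ℝ≥0∞)⁻¹ * (D : ℝ≥0∞) ^ (1 / 2 : ℝ) + (D : ℝ≥0∞) ^ (1 / 2 : ℝ) + 1 := by
    push_cast
    rw [ENNReal.coe_inv hD0, ENNReal.coe_rpow_of_nonneg _ (by norm_num)]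
  rw [e2, add_mul, add_mul]
  refine le_trans ?_ le_self_add
  refine add_le_add ?_ ?_
  · rw [mul_assoc, mul_comm ((D : ℝ≥0∞) ^ (1 / 2 : ℝ)) (hNorm _ _ _)]
    gcongr
  · rw [mul_comm]
    gcongr

/-- The one-dimensional Sobolev embedding bounds the function near each time, and compactness of [0,
T] makes the bound uniform. This makes the nonlinearity Lipschitz along two given solutions. -/
theorem ContHLoc.exists_ae_bound {u : ℝ → ℝ → ℂ} (h : ContHLoc 1 u) (T : ℝ) {r : ℝ}
    (hr : 0 < r) :
    ∃ M : ℝ, ∀ t ∈ Icc 0 T, ∀ᵐ y, y ∈ Ioo (-r) r → ‖u t y‖ ≤ M := by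
  obtain ⟨C, hC⟩ := exists_ae_enorm_le_hNorm hr
  refine (isCompact_Icc (a := (0 : ℝ)) (b := T)).induction_on
    (p := fun s => ∃ M : ℝ, ∀ t ∈ s, ∀ᵐ y, y ∈ Ioo (-r) r → ‖u t y‖ ≤ M) ⟨0, by simp⟩ ?_ ?_ ?_
  · rintro s s' hs ⟨M, hM⟩
    exact ⟨M, fun t ht => hM t (hs ht)⟩
  · rintro s s' ⟨M, hM⟩ ⟨M', hM'⟩
    refine ⟨max M M', fun t ht => ?_⟩
    rcases ht with ht | ht
    · filter_upwards [hM t ht] with y hy hm using (hy hm).trans (le_max_left _ _)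
    · filter_upwards [hM' t ht] with y hy hm using (hy hm).trans (le_max_right _ _)
  · intro t₀ ht₀
    have hfin : hNorm 1 (Ioo (-r) r) (u t₀) ≠ ⊤ := by
      obtain ⟨m1, g, hg, m2⟩ := h.1 t₀ ht₀.1 r hr
      refine ne_top_of_le_ne_top ?_ (hNorm_succ_le hg 0)
      rw [hNorm_zero]
      exact ENNReal.add_ne_top.2 ⟨m1.2.ne, m2.2.ne⟩
    have h1 : ∀ᶠ t in 𝓝[Ici 0] t₀, hNorm 1 (Ioo (-r) r) (fun x => u t x - u t₀ x) < 1 :=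
      (h.2 t₀ ht₀.1 r hr).eventually_lt_const (by norm_num)
    have h2 : {t | hNorm 1 (Ioo (-r) r) (fun x => u t x - u t₀ x) < 1} ∈ 𝓝[Icc 0 T] t₀ :=
      nhdsWithin_mono t₀ Icc_subset_Ici_self h1
    refine ⟨_, h2, (C * hNorm 1 (Ioo (-r) r) (u t₀)).toReal + C, fun t ht => ?_⟩
    filter_upwards [hC (u t₀), hC (fun x => u t x - u t₀ x)] with y hy hy' hm
    have e1 : ‖u t₀ y‖ ≤ (C * hNorm 1 (Ioo (-r) r) (u t₀)).toReal := by
      have := ENNReal.toReal_mono (ENNReal.mul_ne_top (by simp) hfin) (hy hm)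
      simpa using this
    have e2 : ‖u t y - u t₀ y‖ ≤ C := by
      have h3 : ‖u t y - u t₀ y‖ₑ ≤ C :=
        (hy' hm).trans ((mul_le_mul_right (le_of_lt ht) _).trans (by simp))
      have := ENNReal.toReal_mono (by simp) h3
      simpa using this
    have := norm_add_le (u t₀ y) (u t y - u t₀ y)
    rw [add_sub_cancel] at this
    linarith

theorem exists_lipschitz_nonlinearity {f : ℝ → ℝ} (hf : ContDiffOn ℝ 2 f (Ici 0)) {M : ℝ}
    (hM : 0 ≤ M) :
    ∃ L > 0, ∀ z w : ℂ, ‖z‖ ≤ M → ‖w‖ ≤ M →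
      ‖(f (‖z‖ ^ 2) : ℂ) * z - (f (‖w‖ ^ 2) : ℂ) * w‖ ≤ L * ‖z - w‖ := by
  have hsub : Icc 0 (M ^ 2) ⊆ Ici (0 : ℝ) := Icc_subset_Ici_self
  obtain ⟨K, hK⟩ := (hf.mono hsub).exists_lipschitzOnWith (by norm_num) (convex_Icc _ _)
    isCompact_Icc
  obtain ⟨B, hB⟩ := isCompact_Icc.exists_bound_of_continuousOn (hf.mono hsub).continuousOn
  have hB0 : 0 ≤ B := (norm_nonneg _).trans (hB 0 ⟨le_rfl, by positivity⟩)
  refine ⟨B + K * (2 * M) * M + 1, by positivity, fun z w hz hw => ?_⟩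
  have m : ∀ {v : ℂ}, ‖v‖ ≤ M → ‖v‖ ^ 2 ∈ Icc 0 (M ^ 2) := fun h =>
    ⟨by positivity, pow_le_pow_left₀ (norm_nonneg _) h 2⟩
  have e : (f (‖z‖ ^ 2) : ℂ) * z - (f (‖w‖ ^ 2) : ℂ) * w =
      (f (‖z‖ ^ 2) : ℂ) * (z - w) + ((f (‖z‖ ^ 2) - f (‖w‖ ^ 2) : ℝ) : ℂ) * w := by
    push_cast; ring
  have h1 : |f (‖z‖ ^ 2) - f (‖w‖ ^ 2)| ≤ K * (2 * M * ‖z - w‖) := by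
    have := hK.dist_le_mul _ (m hz) _ (m hw)
    rw [Real.dist_eq, Real.dist_eq] at this
    refine this.trans ?_
    gcongr
    have e2 : ‖z‖ ^ 2 - ‖w‖ ^ 2 = (‖z‖ + ‖w‖) * (‖z‖ - ‖w‖) := by ring
    rw [e2, abs_mul, abs_of_nonneg (by positivity)]
    exact mul_le_mul (by linarith) (abs_norm_sub_norm_le z w) (abs_nonneg _) (by positivity)
  rw [e]
  refine (norm_add_le _ _).trans ?_
  rw [norm_mul, norm_mul, Complex.norm_real, Complex.norm_real, Real.norm_eq_abs (_ - _)]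
  have h2 : ‖f (‖z‖ ^ 2)‖ * ‖z - w‖ ≤ B * ‖z - w‖ := by gcongr; exact hB _ (m hz)
  have h3 : |f (‖z‖ ^ 2) - f (‖w‖ ^ 2)| * ‖w‖ ≤ K * (2 * M * ‖z - w‖) * M := by
    gcongr
  have h4 := norm_nonneg (z - w)
  linear_combination h2 + h3 + h4

theorem norm_mollify_normed_le (φ : ContDiffBump (0 : ℝ)) {v : ℝ → ℂ} {x b : ℝ}
    (h : ∀ᵐ y, |x - y| ≤ φ.rOut → ‖v y‖ ≤ b) : ‖mollify (φ.normed volume) v x‖ ≤ b := by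
  have h1 : ‖mollify (φ.normed volume) v x‖ ≤ ∫ y, φ.normed volume (x - y) * b := by
    refine norm_integral_le_of_norm_le ?_ ?_
    · exact (φ.integrable_normed.comp_sub_left x).mul_const b
    · filter_upwards [h] with y hy
      rw [norm_smul, Real.norm_of_nonneg (φ.nonneg_normed _)]
      by_cases hxy : |x - y| ≤ φ.rOut
      · exact mul_le_mul_of_nonneg_left (hy hxy) (φ.nonneg_normed _)
      · have : φ.normed volume (x - y) = 0 := by
          by_contra h0
          have : x - y ∈ Function.support (φ.normed volume) := h0
          rw [φ.support_normed_eq, mem_ball_zero_iff, Real.norm_eq_abs] at this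
          exact hxy this.le
        rw [this]; simp
  rwa [integral_mul_const, integral_sub_left_eq_self, φ.integral_normed, one_mul] at h1

/-- The double time integration gains L/λ² = 1/2. The mollification radius must fit between r and
r'; letting it tend to zero recovers the functions almost everywhere, at the price of an arbitrarily
small loss of cone. -/
theorem IsRegular.ae_bound_half {G₁ u₁ v₁ z₁ G₂ u₂ v₂ z₂ : ℝ → ℝ → ℂ}
    (h₁ : IsRegular G₁ u₁ v₁ z₁) (h₂ : IsRegular G₂ u₂ v₂ z₂) (hu : u₁ 0 =ᵐ[volume] u₂ 0)
    (hv : v₁ 0 =ᵐ[volume] v₂ 0) {r r' L M lam : ℝ} (hrr : r < r') (hlam : 0 < lam)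
    (hL : lam ^ 2 = 2 * L) (hM : 0 ≤ M)
    (hG : ∀ s, 0 ≤ s → ∀ᵐ y, |y| ≤ r' - s → ‖G₁ s y - G₂ s y‖ ≤ L * ‖u₁ s y - u₂ s y‖)
    (hb : ∀ s, 0 ≤ s → ∀ᵐ y, |y| ≤ r' - s → ‖u₁ s y - u₂ s y‖ ≤ M * Real.exp (lam * s))
    (t : ℝ) (ht : 0 ≤ t) :
    ∀ᵐ y, |y| ≤ r - t → ‖u₁ t y - u₂ t y‖ ≤ M / 2 * Real.exp (lam * t) := by
  have hL0 : 0 ≤ L := by nlinarith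
  let φ : ℕ → ContDiffBump (0 : ℝ) := fun n =>
    ⟨1 / (n + 1 : ℝ), 2 * (1 / (n + 1 : ℝ)), by positivity, by
      have : 0 < 1 / (n + 1 : ℝ) := by positivity
      linarith⟩
  have hφ : Tendsto (fun n => (φ n).rOut) atTop (𝓝 0) := by
    have := (tendsto_one_div_add_atTop_nhds_zero_nat (𝕜 := ℝ)).const_mul 2
    rwa [mul_zero] at this
  have hlim : ∀ {v : ℝ → ℂ}, LocallyIntegrable v volume →
      ∀ᵐ x, Tendsto (fun n => mollify ((φ n).normed volume) v x) atTop (𝓝 (v x)) := fun hv => by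
    simp only [mollify_eq_convolution]
    exact ContDiffBump.ae_convolution_tendsto_right_of_locallyIntegrable (K := 2) hφ
      (Eventually.of_forall fun n => le_rfl) hv
  filter_upwards [hlim (h₁.cu.1 t ht).locallyIntegrable,
    hlim (h₂.cu.1 t ht).locallyIntegrable] with x hx1 hx2 hx
  refine le_of_tendsto (hx1.sub hx2).norm ?_
  filter_upwards [hφ.eventually_lt_const (sub_pos.2 hrr)] with n hn
  have hb' := h₁.norm_mollify_sub_le h₂ hu hv (ρ := (φ n).normed volume) (φ n).contDiff_normed
    (φ n).hasCompactSupport_normed (κ := L * M) hlam (by positivity) (r := r) ?_ ht hx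
  · refine hb'.trans (le_of_eq ?_)
    have : L * M / lam / lam = M / 2 := by
      rw [div_div, ← sq, hL]
      have : L ≠ 0 := by intro h0; rw [h0] at hL; nlinarith
      field_simp
    rw [this]
  · intro s hs y hy
    rw [← mollify_sub (φ n).continuous_normed (φ n).hasCompactSupport_normed
      (h₁.locallyIntegrable s hs) (h₂.locallyIntegrable s hs)]
    refine norm_mollify_normed_le (φ n) ?_
    filter_upwards [hG s hs, hb s hs] with y' e1 e2 hy'
    have h3 : |y'| ≤ r' - s := by
      have := abs_sub_abs_le_abs_sub y' y
      rw [abs_sub_comm] at this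
      linarith
    refine (e1 h3).trans ?_
    rw [mul_assoc]
    exact mul_le_mul_of_nonneg_left (e2 h3) hL0

/-- On a bounded backward cone both solutions are bounded, so the halving lemma can be iterated; the
difference is then below 2^{-N} times a constant for every N. -/
theorem IsClassicalSolution.ae_eq {f : ℝ → ℝ} (hf : ContDiffOn ℝ 2 f (Ici 0)) {u₀ u₁ : ℝ → ℂ}
    {u u' : ℝ → ℝ → ℂ} (h : IsClassicalSolution f u₀ u₁ u) (h' : IsClassicalSolution f u₀ u₁ u')
    (t : ℝ) (ht : 0 ≤ t) : u t =ᵐ[volume] u' t := by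
  obtain ⟨v, z, hr, hv⟩ := h.exists_isRegular
  obtain ⟨v', z', hr', hv'⟩ := h'.exists_isRegular
  have hu0 : u 0 =ᵐ[volume] u' 0 := by
    obtain ⟨-, -, -, _, _, -, -, -, e, -⟩ := h
    obtain ⟨-, -, -, _, _, -, -, -, e', -⟩ := h'
    exact e.trans e'.symm
  have hv0 := hv.trans hv'.symm
  have key : ∀ n : ℕ, ∀ᵐ y, |y| ≤ (n : ℝ) → u t y = u' t y := by
    intro n
    set r : ℝ := n + t with hrdef
    have hr0 : 0 ≤ r := by positivity
    obtain ⟨M₁, hM₁⟩ := h.2.1.1.exists_ae_bound (r + 1) (r := r + 2) (by linarith)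
    obtain ⟨M₂, hM₂⟩ := h'.2.1.1.exists_ae_bound (r + 1) (r := r + 2) (by linarith)
    set M := max 0 (max M₁ M₂) with hM
    have hM0 : 0 ≤ M := le_max_left _ _
    have hbd : ∀ s, 0 ≤ s → ∀ᵐ y, |y| ≤ (r + 1) - s → ‖u s y‖ ≤ M ∧ ‖u' s y‖ ≤ M := by
      intro s hs
      by_cases hs' : s ≤ r + 1
      · filter_upwards [hM₁ s ⟨hs, hs'⟩, hM₂ s ⟨hs, hs'⟩] with y e1 e2 hy
        have := abs_le.1 hy
        have hm : y ∈ Ioo (-(r + 2)) (r + 2) := ⟨by linarith, by linarith⟩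
        exact ⟨(e1 hm).trans ((le_max_left _ _).trans (le_max_right _ _)),
          (e2 hm).trans ((le_max_right _ _).trans (le_max_right _ _))⟩
      · refine Eventually.of_forall fun y hy => ?_
        have := abs_nonneg y
        linarith
    obtain ⟨L, hL0, hL⟩ := exists_lipschitz_nonlinearity hf hM0
    set lam := Real.sqrt (2 * L) with hlam
    have hlam0 : 0 < lam := Real.sqrt_pos.2 (by linarith)
    have hlam2 : lam ^ 2 = 2 * L := Real.sq_sqrt (by linarith)
    -- For fixed N the radius shrinks by 1/N at each of N halvings. The total loss is 1 whatever N
    -- is, so the cone of radius r = n + t always remains.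
    have step : ∀ N : ℕ, 0 < N → ∀ j : ℕ, j ≤ N → ∀ s, 0 ≤ s →
        ∀ᵐ y, |y| ≤ (r + 1 - j / N) - s →
          ‖u s y - u' s y‖ ≤ 2 * M / 2 ^ j * Real.exp (lam * s) := by
      intro N hN j
      have hN' : (0 : ℝ) < N := by exact_mod_cast hN
      induction j with
      | zero =>
        intro _ s hs
        filter_upwards [hbd s hs] with y e hy
        obtain ⟨e1, e2⟩ := e (by simpa using hy)
        have h1 : ‖u s y - u' s y‖ ≤ 2 * M := (norm_sub_le _ _).trans (by linarith)
        have h2 : 1 ≤ Real.exp (lam * s) := Real.one_le_exp (by positivity)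
        rw [pow_zero, div_one]
        nlinarith
      | succ j ih =>
        intro hj s hs
        have ih' := ih (by omega)
        have hlt : r + 1 - ((j + 1 : ℕ) : ℝ) / N < r + 1 - (j : ℝ) / N := by
          have : (j : ℝ) / N < ((j + 1 : ℕ) : ℝ) / N := by
            gcongr
            simp
          linarith
        have := hr.ae_bound_half hr' hu0 hv0 hlt hlam0 hlam2 (M := 2 * M / 2 ^ j) (by positivity)
          (fun s hs => ?_) ih' s hs
        · filter_upwards [this] with y hy hy'
          refine (hy hy').trans (le_of_eq ?_)
          rw [pow_succ]; field_simp
        · filter_upwards [hbd s hs] with y e hy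
          have hjN : 0 ≤ (j : ℝ) / N := by positivity
          obtain ⟨e1, e2⟩ := e (by linarith)
          exact hL _ _ e1 e2
    have hfin : ∀ᵐ y, ∀ N : ℕ, |y| ≤ (n : ℝ) →
        ‖u t y - u' t y‖ ≤ 2 * M / 2 ^ (N + 1) * Real.exp (lam * t) := by
      refine ae_all_iff.2 fun N => ?_
      filter_upwards [step (N + 1) (by omega) (N + 1) le_rfl t ht] with y e hy
      refine e (hy.trans (le_of_eq ?_))
      have : ((N + 1 : ℕ) : ℝ) ≠ 0 := by positivity
      rw [div_self this, hrdef]; ring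
    filter_upwards [hfin] with y hy hy'
    have h0 : Tendsto (fun N : ℕ => 2 * M / 2 ^ (N + 1) * Real.exp (lam * t)) atTop (𝓝 0) := by
      have h1 : Tendsto (fun N : ℕ => (1 / 2 : ℝ) ^ (N + 1)) atTop (𝓝 0) :=
        (tendsto_pow_atTop_nhds_zero_of_lt_one (by norm_num) (by norm_num)).comp
          (tendsto_add_atTop_nat 1)
      have h2 := (h1.const_mul (2 * M)).mul_const (Real.exp (lam * t))
      simp only [mul_zero, zero_mul] at h2
      refine h2.congr fun N => ?_
      rw [one_div_pow]; ring
    have h3 : ‖u t y - u' t y‖ ≤ 0 := ge_of_tendsto h0 (Eventually.of_forall fun N => hy N hy')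
    exact sub_eq_zero.1 (norm_le_zero_iff.1 h3)
  filter_upwards [ae_all_iff.2 key] with y hy
  obtain ⟨n, hn⟩ := exists_nat_gt |y|
  exact hy n hn.le

end Uniqueness

end KleinGordon

namespace KleinGordon

/-! ### Cut-off of the nonlinearity. -/

section Truncation

/-- The cut-off is supported in (0, ∞), so F is C¹ on the whole line although f is regular only on
[0, ∞), and z ↦ F(|z|²)z becomes bounded and Lipschitz. -/
theorem exists_truncation {f : ℝ → ℝ} (hf : ContDiffOn ℝ 2 f (Ici 0)) {c : ℝ} (hc : 0 < c) :
    ∃ F : ℝ → ℝ, ContDiff ℝ 1 F ∧ HasCompactSupport F ∧ (F =ᶠ[𝓝 c] f) ∧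
      ∀ s, |s - c| ≤ c / 4 → F s = f s := by
  let φ : ContDiffBump c := ⟨c / 3, c / 2, by positivity, by linarith⟩
  have e : ∀ s, |s - c| ≤ c / 3 → φ s * f s = f s := fun s hs => by
    rw [φ.one_of_mem_closedBall (by rwa [mem_closedBall_iff_norm, Real.norm_eq_abs]), one_mul]
  refine ⟨fun s => φ s * f s, contDiff_iff_contDiffAt.2 fun s => ?_, φ.hasCompactSupport.mul_right,
    ?_, fun s hs => e s (by linarith)⟩
  · by_cases hs : s ∈ tsupport φ
    · have hs0 : 0 < s := by
        rw [φ.tsupport_eq, mem_closedBall_iff_norm, Real.norm_eq_abs] at hs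
        have := (abs_le.1 hs).1
        change -(c / 2) ≤ _ at this
        linarith
      exact φ.contDiff.contDiffAt.mul ((hf.contDiffAt (Ici_mem_nhds hs0)).of_le (by norm_num))
    · have h0 : (fun s => φ s * f s) =ᶠ[𝓝 s] fun _ => 0 := by
        filter_upwards [notMem_tsupport_iff_eventuallyEq.1 hs] with y hy
        rw [hy]; simp
      exact contDiffAt_const.congr_of_eventuallyEq h0
  · filter_upwards [Metric.closedBall_mem_nhds c (by positivity : 0 < c / 3)] with s hs
    rw [mem_closedBall_iff_norm, Real.norm_eq_abs] at hs
    exact e s hs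

theorem contDiff_radial {F : ℝ → ℝ} (hF : ContDiff ℝ 1 F) :
    ContDiff ℝ 1 fun z : ℂ => (F (‖z‖ ^ 2) : ℂ) * z :=
  (Complex.ofRealCLM.contDiff.comp (hF.comp (contDiff_norm_sq ℝ))).mul contDiff_id

theorem hasCompactSupport_radial {F : ℝ → ℝ} (hF : HasCompactSupport F) :
    HasCompactSupport fun z : ℂ => (F (‖z‖ ^ 2) : ℂ) * z := by
  obtain ⟨S, hS⟩ := hF.isBounded.subset_closedBall 0
  refine HasCompactSupport.intro (isCompact_closedBall (0 : ℂ) (|S| + 1)) fun z hz => ?_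
  rw [mem_closedBall_zero_iff, not_le] at hz
  have : F (‖z‖ ^ 2) = 0 := by
    by_contra h0
    have h1 := hS (subset_tsupport _ h0)
    rw [mem_closedBall_zero_iff, Real.norm_of_nonneg (by positivity)] at h1
    have h2 := le_abs_self S
    have h3 := abs_nonneg S
    nlinarith
  rw [this]; simp

end Truncation

/-! ### L² norms against integrals over bounded intervals. -/

section SquareIntegrals

variable {E : Type*} [NormedAddCommGroup E]

theorem eLpNorm_two_le_of_integral_le {h : ℝ → E} (hc : Continuous h) {K : ℝ} (hK : 0 ≤ K)
    (hb : ∀ l r, l ≤ r → ∫ x in l..r, ‖h x‖ ^ 2 ≤ K ^ 2) :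
    eLpNorm h 2 volume ≤ ENNReal.ofReal K := by
  refine le_of_sq_le_sq_ennreal ?_
  rw [eLpNorm_two_sq, ← ENNReal.ofReal_pow hK]
  have h1 := (aecover_Ioc (μ := (volume : Measure ℝ)) tendsto_neg_atTop_atBot
    (tendsto_id (α := ℝ))).lintegral_tendsto_of_countably_generated
    (f := fun x => ‖h x‖ₑ ^ 2) (by fun_prop)
  refine le_of_tendsto h1 ?_
  filter_upwards [eventually_ge_atTop 0] with r hr
  have h2 : -r ≤ id r := by simp only [id]; linarith
  have h3 := hb _ _ h2
  rw [intervalIntegral.integral_of_le h2] at h3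
  have hi : IntegrableOn (fun x => ‖h x‖ ^ 2) (Ioc (-r) (id r)) volume :=
    (Continuous.integrableOn_Icc (by fun_prop)).mono_set Ioc_subset_Icc_self
  have h4 := ofReal_integral_eq_lintegral_ofReal hi (Eventually.of_forall fun x => by positivity)
  have h5 : ∀ x, ENNReal.ofReal (‖h x‖ ^ 2) = ‖h x‖ₑ ^ 2 := fun x => by
    rw [ENNReal.ofReal_pow (norm_nonneg _), ofReal_norm]
  simp only [h5] at h4
  rw [← h4]
  exact ENNReal.ofReal_le_ofReal h3

theorem integral_sq_le_of_eLpNorm_le {h : ℝ → E} (hc : Continuous h) {K : ℝ} (hK : 0 ≤ K)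
    (hb : eLpNorm h 2 volume ≤ ENNReal.ofReal K) (l r : ℝ) (hlr : l ≤ r) :
    ∫ x in l..r, ‖h x‖ ^ 2 ≤ K ^ 2 := by
  rw [intervalIntegral.integral_of_le hlr]
  have hi : IntegrableOn (fun x => ‖h x‖ ^ 2) (Ioc l r) volume :=
    (Continuous.integrableOn_Icc (by fun_prop)).mono_set Ioc_subset_Icc_self
  have h4 := ofReal_integral_eq_lintegral_ofReal hi (Eventually.of_forall fun x => by positivity)
  have h5 : ∀ x, ENNReal.ofReal (‖h x‖ ^ 2) = ‖h x‖ₑ ^ 2 := fun x => by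
    rw [ENNReal.ofReal_pow (norm_nonneg _), ofReal_norm]
  simp only [h5] at h4
  rw [← ENNReal.ofReal_le_ofReal_iff (by positivity), h4, ENNReal.ofReal_pow hK]
  refine (setLIntegral_le_lintegral _ _).trans ?_
  rw [← eLpNorm_two_sq]
  gcongr

theorem IsPrimitive.enorm_le_add [NormedSpace ℝ E] {w g : ℝ → E} (h : IsPrimitive w g) (x : ℝ) :
    ‖w x‖ₑ ≤ eLpNorm w 2 volume + eLpNorm g 2 volume := by
  have h1 := h.enorm_le (c := x) (d := x + 1) (by linarith) ⟨le_rfl, by linarith⟩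
  have e : ENNReal.ofReal (x + 1 - x) = 1 := by simp
  rw [e] at h1
  simp only [inv_one, ENNReal.one_rpow, mul_one, one_mul] at h1
  exact h1.trans (add_le_add (eLpNorm_mono_measure _ Measure.restrict_le_self)
    (eLpNorm_mono_measure _ Measure.restrict_le_self))

theorem IsPrimitive.exists_bound [NormedSpace ℝ E] {w g : ℝ → E} (h : IsPrimitive w g)
    (hw : MemLp w 2 volume) (hg : MemLp g 2 volume) : ∃ C, ∀ x, ‖w x‖ ≤ C := by
  refine ⟨(eLpNorm w 2 volume + eLpNorm g 2 volume).toReal, fun x => ?_⟩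
  have := ENNReal.toReal_mono (ENNReal.add_ne_top.2 ⟨hw.2.ne, hg.2.ne⟩) (h.enorm_le_add x)
  simpa using this

end SquareIntegrals

/-! ### Global solutions for compactly supported nonlinearities. -/

section Existence

theorem IsPrimitive.exists_stronglyMeasurable {w g : ℝ → ℂ} (h : IsPrimitive w g)
    (hg : LocL2 g) : ∃ g', StronglyMeasurable g' ∧ LocL2 g' ∧ IsPrimitive w g' := by
  have hm := h.loc.aestronglyMeasurable
  have e := hm.ae_eq_mk
  refine ⟨hm.mk g, hm.stronglyMeasurable_mk, fun r => (hg r).ae_eq (ae_restrict_of_ae e),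
    h.loc.congr e, fun x => ?_⟩
  rw [h.eq x]
  congr 1
  exact intervalIntegral.integral_congr_ae (by filter_upwards [e] with y hy _ using hy)

theorem LocL2.add {v w : ℝ → ℂ} (hv : LocL2 v) (hw : LocL2 w) : LocL2 fun x => v x + w x :=
  fun r => (hv r).add (hw r)

theorem LocL2.sub {v w : ℝ → ℂ} (hv : LocL2 v) (hw : LocL2 w) : LocL2 fun x => v x - w x :=
  fun r => (hv r).sub (hw r)

/-- The last clause is conditional: that g coincides with the original nonlinearity along u is known
only after stability has been proved for this same u, uniformly bounded on compact time intervals.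
-/
theorem exists_wave_solution {g : ℂ → ℂ} (hg : ContDiff ℝ 1 g) (hgc : HasCompactSupport g)
    {u₀ u₀' u₀'' u₁ u₁' : ℝ → ℂ} (h₀ : ∀ x, HasDerivAt u₀ (u₀' x) x)
    (p₀ : IsPrimitive u₀' u₀'') (p₁ : IsPrimitive u₁ u₁') (l₀ : LocL2 u₀'') (l₁ : LocL2 u₁')
    {C : ℝ} (b₀ : ∀ x, ‖u₀ x‖ ≤ C) (b₀' : ∀ x, ‖u₀' x‖ ≤ C) (b₁ : ∀ x, ‖u₁ x‖ ≤ C) :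
    ∃ u p q, IsWave g u p q ∧ (∀ x, u 0 x = u₀ x) ∧ (∀ x, p 0 x = u₁ x + u₀' x) ∧
      (∀ x, q 0 x = u₁ x - u₀' x) ∧
      (∀ T, 0 ≤ T → ∃ M, ∀ t, |t| ≤ T → ∀ x, ‖u t x‖ ≤ M ∧ ‖p t x‖ ≤ M ∧ ‖q t x‖ ≤ M) ∧
      ∀ (f : ℝ → ℝ) (U₀ U₁ : ℝ → ℂ),
        (∀ t, 0 ≤ t → ∀ x, g (u t x) = (f (‖u t x‖ ^ 2) : ℂ) * u t x) →
        u₀ =ᵐ[volume] U₀ → u₁ =ᵐ[volume] U₁ → IsClassicalSolution f U₀ U₁ u := by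
  obtain ⟨L, hL⟩ := hg.lipschitzWith_of_hasCompactSupport hgc (by norm_num)
  obtain ⟨B, hB⟩ := hgc.exists_bound_of_continuous hg.continuous
  obtain ⟨u, p, q, hw, e0, ep, eq⟩ := exists_isWave hL hB h₀ p₀.continuous p₁.continuous b₀ b₁
  have hB0 : 0 ≤ B := (norm_nonneg _).trans (hB 0)
  have hC0 : 0 ≤ C := (norm_nonneg _).trans (b₁ 0)
  have hI : ∀ t (k : ℝ → ℂ), ‖∫ s in (0 : ℝ)..t, -g (k s)‖ ≤ B * |t| := fun t k => by
    have := intervalIntegral.norm_integral_le_of_norm_le_const (a := 0) (b := t)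
      (f := fun s => -g (k s)) (C := B) (fun s _ => by rw [norm_neg]; exact hB _)
    simpa using this
  have bp : ∀ t x, ‖p t x‖ ≤ C + C + B * |t| := fun t x => by
    rw [ep]
    exact (norm_add_le _ _).trans (add_le_add ((norm_add_le _ _).trans
      (add_le_add (b₁ _) (b₀' _))) (hI _ _))
  have bq : ∀ t x, ‖q t x‖ ≤ C + C + B * |t| := fun t x => by
    rw [eq]
    exact (norm_add_le _ _).trans (add_le_add ((norm_sub_le _ _).trans
      (add_le_add (b₁ _) (b₀' _))) (hI _ _))
  have bu : ∀ T, 0 ≤ T → ∀ t, |t| ≤ T → ∀ x, ‖u t x‖ ≤ C + (C + C + B * T) * T := by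
    intro T hT t ht x
    have h1 := (convex_Icc (-T) T).norm_image_sub_le_of_norm_hasDerivWithin_le
      (f := fun s => u s x) (C := C + C + B * T)
      (fun s _ => (hw.dt s x).hasDerivWithinAt) (fun s hs => ?_)
      (show (0 : ℝ) ∈ Icc (-T) T from ⟨by linarith, hT⟩) (abs_le.1 ht)
    · rw [sub_zero, Real.norm_eq_abs, e0] at h1
      have h2 := norm_le_norm_add_norm_sub' (u t x) (u₀ x)
      have h3 : (C + C + B * T) * |t| ≤ (C + C + B * T) * T := by gcongr
      linarith [b₀ x]
    · have hs' : |s| ≤ T := abs_le.2 hs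
      have h1 : B * |s| ≤ B * T := by gcongr
      rw [norm_div, Complex.norm_ofNat]
      have := norm_add_le (p s x) (q s x)
      linarith [bp s x, bq s x]
  obtain ⟨A', mA, lA, pA⟩ := (p₁.add p₀).exists_stronglyMeasurable (l₁.add l₀)
  obtain ⟨B', mB, lB, pB⟩ := (p₁.sub p₀).exists_stronglyMeasurable (l₁.sub l₀)
  refine ⟨u, p, q, hw, e0, fun x => by rw [ep]; simp, fun x => by rw [eq]; simp,
    fun T hT => ⟨C + (C + C + B * T) * T + (C + C + B * T), fun t ht x => ?_⟩,
    fun f U₀ U₁ hf h0 h1 => hw.isClassicalSolution hg pA pB mA mB lA lB ep eq hf ?_ ?_⟩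
  · have h1 : B * |t| ≤ B * T := by gcongr
    have h2 : 0 ≤ (C + C + B * T) * T := by positivity
    have h3 : 0 ≤ B * T := by positivity
    exact ⟨by linarith [bu T hT t ht x], by linarith [bp t x], by linarith [bq t x]⟩
  · filter_upwards [h0] with x hx
    rw [e0, hx]
  · filter_upwards [h1] with x hx
    rw [← hx]; ring

end Existence

/-! ### The modulated periodic profile. -/

section Data

/-- The modulated periodic profile. -/
noncomputable def carrier (a k : ℝ) (θ : ℝ → ℝ) (x : ℝ) : ℂ :=
  a * Complex.exp (Complex.I * (k * x - θ x))

variable {a k : ℝ} {θ : ℝ → ℝ}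

theorem norm_carrier (ha : 0 < a) (x : ℝ) : ‖carrier a k θ x‖ = a := by
  have : Complex.I * ((k : ℂ) * x - θ x) = ((k * x - θ x : ℝ) : ℂ) * Complex.I := by
    push_cast; ring
  rw [carrier, norm_mul, this, Complex.norm_exp_ofReal_mul_I, mul_one, Complex.norm_real,
    Real.norm_of_nonneg ha.le]

theorem hasDerivAt_carrier {T : ℝ → ℝ} (hθ : ∀ x, HasDerivAt θ (T x) x) (x : ℝ) :
    HasDerivAt (carrier a k θ) ((k - T x) • (Complex.I * carrier a k θ x)) x := by
  have h1 : HasDerivAt (fun x : ℝ => (k : ℂ) * x - θ x) ((k : ℂ) * 1 - T x) x :=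
    ((Complex.ofRealCLM.hasDerivAt (x := x)).const_mul (k : ℂ)).sub (hθ x).ofReal_comp
  refine (((h1.const_mul Complex.I).cexp).const_mul (a : ℂ)).of_eq (fun _ => rfl) ?_
  rw [carrier, Complex.real_smul]
  push_cast
  ring

theorem isPrimitive_carrier_deriv {T T' : ℝ → ℝ} (hθ : ∀ x, HasDerivAt θ (T x) x)
    (hT : IsPrimitive T T') (ha : 0 < a) (hT' : MemLp T' 2 volume) :
    ∃ b, IsPrimitive (fun x => (k - T x) • (Complex.I * carrier a k θ x)) b ∧ LocL2 b := by
  have cb : Continuous (carrier a k θ) :=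
    continuous_iff_continuousAt.2 fun x => (hasDerivAt_carrier hθ x).continuousAt
  have cT := hT.continuous
  have c1 : Continuous fun x => Complex.I * ((k - T x) • (Complex.I * carrier a k θ x)) := by
    fun_prop
  have p1 : IsPrimitive (fun x => Complex.I * carrier a k θ x)
      (fun x => Complex.I * ((k - T x) • (Complex.I * carrier a k θ x))) :=
    IsPrimitive.of_hasDerivAt (fun x => (hasDerivAt_carrier hθ x).const_mul _) c1
  have p2 : IsPrimitive (fun x => k - T x) (fun x => 0 - T' x) :=
    (IsPrimitive.of_hasDerivAt (fun x => hasDerivAt_const x k) continuous_const).sub hT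
  refine ⟨_, p2.smul p1, LocL2.add (fun r => ?_) (LocL2.of_continuous (by fun_prop))⟩
  refine MemLp.of_le_mul (c := a) (hT'.restrict _) ?_ (Eventually.of_forall fun x => ?_)
  · exact (aestronglyMeasurable_const.sub hT'.1.restrict).smul
      (by fun_prop : Continuous fun x => Complex.I * carrier a k θ x).aestronglyMeasurable
  · rw [norm_smul, norm_mul, Complex.norm_I, one_mul, norm_carrier ha, zero_sub, norm_neg, mul_comm]

end Data

end KleinGordon

namespace KleinGordon

/-! ### Initial energy in terms of the data. -/

section InitialSize

theorem norm_sq_div_sub_le {a c : ℝ} (ha : 0 < a) {b W V W' : ℂ} {T : ℝ} (hb : ‖b‖ = a)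
    (hW : ‖W‖ ≤ a / 2) {p : ℂ}
    (hp : ‖p - Complex.I * c * (b + W)‖ ≤ ‖V‖ + ‖W'‖ + a * |T| + |c| * ‖W‖) :
    ‖p / (b + W) - Complex.I * c‖ ^ 2 ≤
      16 / a ^ 2 * (1 + a ^ 2 + c ^ 2) * (‖V‖ ^ 2 + ‖W'‖ ^ 2 + T ^ 2 + ‖W‖ ^ 2) := by
  have h1 : a / 2 ≤ ‖b + W‖ := by
    have := norm_sub_le_norm_add b W
    rw [hb] at this
    linarith
  have h0 : b + W ≠ 0 := norm_pos_iff.1 (by linarith)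
  have e : p / (b + W) - Complex.I * c = (p - Complex.I * c * (b + W)) / (b + W) := by
    field_simp
  set N := ‖V‖ + ‖W'‖ + a * |T| + |c| * ‖W‖ with hN
  have hN0 : 0 ≤ N := by positivity
  have h2 : ‖p / (b + W) - Complex.I * c‖ ≤ 2 / a * N := by
    rw [e, norm_div, div_le_iff₀ (by linarith)]
    calc _ ≤ N := hp
      _ = 2 / a * N * (a / 2) := by field_simp
      _ ≤ _ := by gcongr
  have h3 : N ^ 2 ≤ 4 * (‖V‖ ^ 2 + ‖W'‖ ^ 2 + a ^ 2 * T ^ 2 + c ^ 2 * ‖W‖ ^ 2) := by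
    have e1 : (a * |T|) ^ 2 = a ^ 2 * T ^ 2 := by rw [mul_pow, sq_abs]
    have e2 : (|c| * ‖W‖) ^ 2 = c ^ 2 * ‖W‖ ^ 2 := by rw [mul_pow, sq_abs]
    rw [← e1, ← e2, hN]
    generalize a * |T| = y
    generalize |c| * ‖W‖ = z
    nlinarith [sq_nonneg (‖V‖ - ‖W'‖), sq_nonneg (‖V‖ - y), sq_nonneg (‖V‖ - z),
      sq_nonneg (‖W'‖ - y), sq_nonneg (‖W'‖ - z), sq_nonneg (y - z)]
  have h4 : ‖V‖ ^ 2 + ‖W'‖ ^ 2 + a ^ 2 * T ^ 2 + c ^ 2 * ‖W‖ ^ 2 ≤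
      (1 + a ^ 2 + c ^ 2) * (‖V‖ ^ 2 + ‖W'‖ ^ 2 + T ^ 2 + ‖W‖ ^ 2) := by
    have h5 : 0 ≤ (a ^ 2 + c ^ 2) * (‖V‖ ^ 2 + ‖W'‖ ^ 2) := by positivity
    have h6 : 0 ≤ (1 + c ^ 2) * T ^ 2 := by positivity
    have h7 : 0 ≤ (1 + a ^ 2) * ‖W‖ ^ 2 := by positivity
    linear_combination h5 + h6 + h7
  calc _ ≤ (2 / a * N) ^ 2 := by gcongr
    _ = 4 / a ^ 2 * N ^ 2 := by rw [mul_pow, div_pow]; norm_num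
    _ ≤ 4 / a ^ 2 * (4 * ((1 + a ^ 2 + c ^ 2) * (‖V‖ ^ 2 + ‖W'‖ ^ 2 + T ^ 2 + ‖W‖ ^ 2))) := by
        gcongr
        linarith
    _ = _ := by ring

theorem abs_norm_sq_div_sub_one_le {a : ℝ} (ha : 0 < a) {b W : ℂ} (hb : ‖b‖ = a)
    (hW : ‖W‖ ≤ a / 2) : |‖b + W‖ ^ 2 / a ^ 2 - 1| ≤ 3 / a * ‖W‖ := by
  have h1 := norm_add_le b W
  have h2 := norm_sub_le_norm_add b W
  rw [hb] at h1 h2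
  have h3 := norm_nonneg W
  have h4 := norm_nonneg (b + W)
  have e : ‖b + W‖ ^ 2 / a ^ 2 - 1 = (‖b + W‖ ^ 2 - a ^ 2) / a ^ 2 := by field_simp
  have e' : 3 / a * ‖W‖ = (3 * a * ‖W‖) / a ^ 2 := by field_simp
  rw [e, e', abs_div, abs_of_pos (by positivity : 0 < a ^ 2)]
  gcongr
  rw [abs_le]
  constructor <;> nlinarith

/-- For the exact wave P and Q vanish, so subtracting i(ω±k)u(0) from p and q removes the carrier
except for its θ' term, and only V, W', T and W remain. The factors 1+a²+(ω±k)² add up to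
2(1+a²+ω²+k²); the term 9/a² comes from s-1. -/
theorem quadDensity_zero_le {a k ω : ℝ} (ha : 0 < a) {θ : ℝ → ℝ} {u p q : ℝ → ℝ → ℂ}
    {W W' V : ℝ → ℂ} {T : ℝ → ℝ} (hu : ∀ x, u 0 x = carrier a k θ x + W x)
    (hp : ∀ x, p 0 x = (carrier a k θ x * (Complex.I * ω) + V x) +
      ((k - T x) • (Complex.I * carrier a k θ x) + W' x))
    (hq : ∀ x, q 0 x = (carrier a k θ x * (Complex.I * ω) + V x) -
      ((k - T x) • (Complex.I * carrier a k θ x) + W' x))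
    {x : ℝ} (hW : ‖W x‖ ≤ a / 2) :
    quadDensity a k ω u p q 0 x ≤ (32 / a ^ 2 * (1 + a ^ 2 + ω ^ 2 + k ^ 2) + 9 / a ^ 2) *
      (‖V x‖ ^ 2 + ‖W' x‖ ^ 2 + T x ^ 2 + ‖W x‖ ^ 2) := by
  set b := carrier a k θ x with hb
  have hbn : ‖b‖ = a := norm_carrier ha x
  have tri : ∀ (c : ℝ) (s : ℂ), ‖s‖ = 1 →
      ‖V x + s * W' x - s * (Complex.I * (T x : ℂ) * b) - Complex.I * (c : ℂ) * W x‖ ≤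
      ‖V x‖ + ‖W' x‖ + a * |T x| + |c| * ‖W x‖ := by
    intro c s hs
    refine (norm_sub_le _ _).trans (add_le_add ((norm_sub_le _ _).trans
      (add_le_add ((norm_add_le _ _).trans (add_le_add le_rfl ?_)) ?_)) ?_)
    · rw [norm_mul, hs, one_mul]
    · rw [norm_mul, norm_mul, norm_mul, hs, hbn, Complex.norm_I, Complex.norm_real,
        Real.norm_eq_abs]
      exact le_of_eq (by ring)
    · rw [norm_mul, norm_mul, Complex.norm_I, Complex.norm_real, Real.norm_eq_abs, one_mul]
  have h1 : ‖relDer (ω + k) u p 0 x‖ ^ 2 ≤ 16 / a ^ 2 * (1 + a ^ 2 + (ω + k) ^ 2) *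
      (‖V x‖ ^ 2 + ‖W' x‖ ^ 2 + T x ^ 2 + ‖W x‖ ^ 2) := by
    rw [relDer, hu]
    refine norm_sq_div_sub_le ha hbn hW ?_
    refine le_trans (le_of_eq ?_) (tri (ω + k) 1 (by simp))
    congr 1
    rw [hp, Complex.real_smul]
    push_cast
    ring
  have h2 : ‖relDer (ω - k) u q 0 x‖ ^ 2 ≤ 16 / a ^ 2 * (1 + a ^ 2 + (ω - k) ^ 2) *
      (‖V x‖ ^ 2 + ‖W' x‖ ^ 2 + T x ^ 2 + ‖W x‖ ^ 2) := by
    rw [relDer, hu]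
    refine norm_sq_div_sub_le ha hbn hW ?_
    refine le_trans (le_of_eq ?_) (tri (ω - k) (-1) (by simp))
    congr 1
    rw [hq, Complex.real_smul]
    push_cast
    ring
  have h3 : (relMod a u 0 x - 1) ^ 2 ≤ 9 / a ^ 2 * ‖W x‖ ^ 2 := by
    rw [relMod, hu, ← sq_abs]
    calc _ ≤ (3 / a * ‖W x‖) ^ 2 := by
          gcongr
          exact abs_norm_sq_div_sub_one_le ha hbn hW
      _ = _ := by rw [mul_pow, div_pow]; norm_num
  have h4 : 9 / a ^ 2 * ‖W x‖ ^ 2 ≤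
      9 / a ^ 2 * (‖V x‖ ^ 2 + ‖W' x‖ ^ 2 + T x ^ 2 + ‖W x‖ ^ 2) := by
    gcongr
    have : 0 ≤ ‖V x‖ ^ 2 + ‖W' x‖ ^ 2 + T x ^ 2 := by positivity
    linarith
  rw [quadDensity]
  linear_combination h1 + h2 + h3 + h4

end InitialSize

/-! ### Logarithmic lift of the solution. -/

section PolarLift

/-- A continuous logarithm is locally a fixed value plus the principal logarithm of a quotient near
1: z varies by less than 1 < π nearby, so the branch cannot jump. -/
theorem hasDerivAt_of_exp_eq {z R : ℝ → ℂ} {R' : ℂ} {x : ℝ} (hz : ContinuousAt z x)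
    (hR : HasDerivAt R R' x) (h : ∀ y, Complex.exp (z y) = R y) :
    HasDerivAt z (R' / R x) x := by
  have h0 : R x ≠ 0 := by rw [← h]; exact Complex.exp_ne_zero _
  have h1 : ∀ᶠ y in 𝓝 x, z x + Complex.log (R y / R x) = z y := by
    have h2 : ∀ᶠ y in 𝓝 x, ‖z y - z x‖ < 1 := by
      have : ContinuousAt (fun y => ‖z y - z x‖) x := (hz.sub continuousAt_const).norm
      exact this.eventually_lt_const (by simp)
    filter_upwards [h2] with y hy
    have h3 := (Complex.abs_im_le_norm (z y - z x)).trans hy.le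
    have h4 := abs_le.1 h3
    rw [← h, ← h, ← Complex.exp_sub, Complex.log_exp (by linarith [Real.pi_gt_three])
      (by linarith [Real.pi_gt_three])]
    ring
  have h5 : HasDerivAt (fun y => z x + Complex.log (R y / R x)) (R' / R x) x := by
    have h6 := (hR.div_const (R x)).clog_real (by rw [div_self h0]; exact Complex.one_mem_slitPlane)
    refine (h6.const_add (z x)).of_eq (fun _ => rfl) ?_
    rw [div_self h0, div_one]
  exact h5.congr_of_eventuallyEq (h1.mono fun y hy => hy.symm)

/-- The average of P and Q is u_t/u - iω, so integrating it in time from the principal logarithm of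
u(0)/carrier gives a single-valued z. Differentiability in x then follows from e^z being a
differentiable quotient. -/
theorem IsWave.exists_polar {g : ℂ → ℂ} {u p q : ℝ → ℝ → ℂ} (hw : IsWave g u p q) {a k ω : ℝ}
    (ha : 0 < a) {M : ℝ}
    (hM : ∀ t, |t| ≤ 1 → ∀ x, ‖u t x‖ ≤ M ∧ ‖p t x‖ ≤ M ∧ ‖q t x‖ ≤ M)
    (hlow : ∀ t, 0 ≤ t → ∀ x, a / 2 ≤ ‖u t x‖) {θ T : ℝ → ℝ}
    (hθ : ∀ x, HasDerivAt θ (T x) x) (cT : Continuous T) {W : ℝ → ℂ} (cW : Continuous W)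
    (hu : ∀ x, u 0 x = carrier a k θ x + W x) (hW : ∀ x, ‖W x‖ ≤ a / 2) :
    ∃ z : ℝ → ℝ → ℂ,
      (∀ t, 0 ≤ t → ∀ x, HasDerivAt (fun s => z s x)
        ((relDer (ω + k) u p t x + relDer (ω - k) u q t x) / 2) t) ∧
      (∀ t, 0 ≤ t → ∀ x, HasDerivAt (z t)
        ((relDer (ω + k) u p t x - relDer (ω - k) u q t x) / 2 + Complex.I * T x) x) ∧
      ContDiffOn ℝ 1 (fun v : ℝ × ℝ => z v.2 v.1) (univ ×ˢ Ici 0) ∧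
      (∀ t, 0 ≤ t → ∀ x, u t x = carrier a k θ x * Complex.exp (Complex.I * (ω * t)) *
        Complex.exp (z t x)) ∧
      ∀ t, 0 ≤ t → ∀ x, z t x = Complex.log (1 + W x / carrier a k θ x) +
        ∫ s in (0 : ℝ)..t,
          (relDer (ω + k) u p (max s 0) x + relDer (ω - k) u q (max s 0) x) / 2 := by
  set b := carrier a k θ with hb
  have hbn : ∀ x, ‖b x‖ = a := fun x => norm_carrier ha x
  have hb0 : ∀ x, b x ≠ 0 := fun x => norm_pos_iff.1 (by rw [hbn]; exact ha)
  have cb : Continuous b :=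
    continuous_iff_continuousAt.2 fun x => (hasDerivAt_carrier hθ x).continuousAt
  have hM0 : 0 < M := by linarith [hlow 0 le_rfl 0, (hM 0 (by simp) 0).1]
  -- Since |u_t| ≤ M, the modulus falls by at most a/4 from its lower bound a/2 during [-η, 0].
  -- Working on t > -η makes z of class C¹ across t = 0, hence up to the boundary.
  set η := min 1 (a / (4 * M)) with hη
  have hη0 : 0 < η := by positivity
  have hne : ∀ t, -η ≤ t → ∀ x, u t x ≠ 0 := by
    intro t ht x
    rcases le_or_gt 0 t with h0 | h0
    · exact norm_pos_iff.1 (by linarith [hlow t h0 x])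
    · have h1 := (convex_Icc (-1 : ℝ) 1).norm_image_sub_le_of_norm_hasDerivWithin_le
        (f := fun s => u s x) (C := M)
        (fun s _ => (hw.dt s x).hasDerivWithinAt) (fun s hs => ?_)
        (show (0 : ℝ) ∈ Icc (-1) 1 by simp)
        (show t ∈ Icc (-1 : ℝ) 1 from ⟨by linarith [min_le_left 1 (a / (4 * M))], by linarith⟩)
      · rw [sub_zero, Real.norm_eq_abs, abs_of_neg h0] at h1
        have h2 : -t ≤ a / (4 * M) := by linarith [min_le_right 1 (a / (4 * M))]
        have h3 : M * -t ≤ a / 4 := by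
          calc M * -t ≤ M * (a / (4 * M)) := by gcongr
            _ = a / 4 := by field_simp
        have h4 := norm_sub_norm_le (u 0 x) (u t x)
        rw [norm_sub_rev] at h4
        have h5 := hlow 0 le_rfl x
        exact norm_pos_iff.1 (by linarith)
      · obtain ⟨-, h1, h2⟩ := hM s (abs_le.2 hs) x
        rw [norm_div, Complex.norm_ofNat]
        linarith [norm_add_le (p s x) (q s x)]
  obtain ⟨K, hK⟩ : ∃ K : ℝ → ℝ → ℂ, ∀ t x,
      K t x = (relDer (ω + k) u p t x + relDer (ω - k) u q t x) / 2 := ⟨_, fun _ _ => rfl⟩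
  obtain ⟨D, hD⟩ : ∃ D : ℝ → ℝ → ℂ, ∀ t x,
      D t x = (relDer (ω + k) u p t x - relDer (ω - k) u q t x) / 2 + Complex.I * T x :=
    ⟨_, fun _ _ => rfl⟩
  have hO : IsOpen (Ioi (-η) ×ˢ (univ : Set ℝ)) := isOpen_Ioi.prod isOpen_univ
  have cP : ContinuousOn (fun v : ℝ × ℝ => relDer (ω + k) u p v.1 v.2)
      (Ici (-η) ×ˢ (univ : Set ℝ)) :=
    continuousOn_relDer hw.cont_u hw.cont_p (fun v hv => hne _ hv.1 _) _
  have cQ : ContinuousOn (fun v : ℝ × ℝ => relDer (ω - k) u q v.1 v.2)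
      (Ici (-η) ×ˢ (univ : Set ℝ)) :=
    continuousOn_relDer hw.cont_u hw.cont_q (fun v hv => hne _ hv.1 _) _
  have cK : ContinuousOn (fun v : ℝ × ℝ => K v.1 v.2) (Ici (-η) ×ˢ (univ : Set ℝ)) :=
    ((cP.add cQ).div_const 2).congr fun v _ => hK v.1 v.2
  have cD : ContinuousOn (fun v : ℝ × ℝ => D v.1 v.2) (Ici (-η) ×ˢ (univ : Set ℝ)) :=
    (((cP.sub cQ).div_const 2).add (Continuous.continuousOn
      (by fun_prop : Continuous fun v : ℝ × ℝ => Complex.I * (T v.2 : ℂ)))).congr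
      fun v _ => hD v.1 v.2
  have cKm : Continuous fun v : ℝ × ℝ => K (max v.1 (-η)) v.2 :=
    cK.comp_continuous (by fun_prop : Continuous fun v : ℝ × ℝ => (max v.1 (-η), v.2))
      (fun v => ⟨mem_Ici.2 (le_max_right _ _), mem_univ _⟩)
  -- Freezing the integrand below -η makes it continuous everywhere without changing it on the
  -- relevant times. The logarithm is regular because |W/b| ≤ 1/2.
  let z : ℝ → ℝ → ℂ := fun t x => Complex.log (1 + W x / b x) +
    ∫ s in (0 : ℝ)..t, K (max s (-η)) x
  have hsl : ∀ x, 1 + W x / b x ∈ Complex.slitPlane := fun x => by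
    refine Complex.mem_slitPlane_of_norm_lt_one ?_
    rw [norm_div, hbn, div_lt_one ha]
    linarith [hW x]
  have cz : ∀ t, Continuous (z t) := fun t => by
    refine Continuous.add ?_ ?_
    · exact Continuous.clog (continuous_const.add (cW.div cb hb0)) hsl
    · have h1 : Continuous fun v : ℝ × ℝ => K (max v.2 (-η)) v.1 :=
        cKm.comp (by fun_prop : Continuous fun v : ℝ × ℝ => (v.2, v.1))
      exact intervalIntegral.continuous_parametric_intervalIntegral_of_continuous'
        (f := fun x s => K (max s (-η)) x) h1 0 t
  have dt : ∀ t, -η ≤ t → ∀ x, HasDerivAt (fun s => z s x) (K t x) t := fun t ht x => by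
    have h1 : Continuous fun s => K (max s (-η)) x :=
      cKm.comp (by fun_prop : Continuous fun s : ℝ => (s, x))
    have h2 := (h1.integral_hasStrictDerivAt 0 t).hasDerivAt.const_add
      (Complex.log (1 + W x / b x))
    rwa [max_eq_left ht] at h2
  have hKu : ∀ t, -η ≤ t → ∀ x, K t x * u t x = (p t x + q t x) / 2 - Complex.I * ω * u t x := by
    intro t ht x
    have := hne t ht x
    simp only [hK, relDer]
    push_cast
    field_simp
    ring
  have hDu : ∀ t, -η ≤ t → ∀ x, D t x =
      ((p t x - q t x) / 2) / u t x - Complex.I * (k - T x) := by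
    intro t ht x
    have := hne t ht x
    simp only [hD, relDer]
    push_cast
    field_simp
    ring
  have hexp : ∀ t, -η < t → ∀ x,
      u t x = b x * Complex.exp (Complex.I * (ω * t)) * Complex.exp (z t x) := by
    intro t ht x
    have dE : ∀ s : ℝ, HasDerivAt (fun s : ℝ => Complex.exp (-(Complex.I * (ω * s))))
        (Complex.exp (-(Complex.I * (ω * s))) * -(Complex.I * (ω * 1))) s := fun s =>
      (((Complex.ofRealCLM.hasDerivAt (x := s)).const_mul (ω : ℂ)).const_mul
        Complex.I).neg.cexp
    -- The product e^{-z}·u·e^{-iωt} has zero time derivative and equals the carrier at t = 0.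
    have h1 := (convex_Ioi (-η)).norm_image_sub_le_of_norm_hasDerivWithin_le
      (f := fun s : ℝ => Complex.exp (-z s x) * u s x * Complex.exp (-(Complex.I * (ω * s))))
      (f' := fun _ => 0) (C := 0)
      (fun s hs => ((((dt s (le_of_lt hs) x).neg.cexp.mul (hw.dt s x)).mul (dE s)).of_eq
        (fun _ => rfl) ?_).hasDerivWithinAt) (fun _ _ => by simp)
      (show (0 : ℝ) ∈ Ioi (-η) by simpa using hη0) ht
    · rw [zero_mul, norm_le_zero_iff, sub_eq_zero] at h1
      have hz0 : Complex.exp (-z 0 x) * u 0 x = b x := by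
        have e1 : z 0 x = Complex.log (1 + W x / b x) := by simp [z]
        rw [e1, Complex.exp_neg, Complex.exp_log (Complex.slitPlane_ne_zero (hsl x)), hu]
        have h3 := Complex.slitPlane_ne_zero (hsl x)
        have h4 : b x + W x = b x * (1 + W x / b x) := by
          have := hb0 x
          field_simp
        rw [h4]
        field_simp
      rw [hz0] at h1
      simp only [Complex.ofReal_zero, mul_zero, neg_zero, Complex.exp_zero, mul_one] at h1
      rw [← h1]
      have e2 : Complex.exp (-z t x) * Complex.exp (z t x) = 1 := by
        rw [← Complex.exp_add]; simp
      have e3 : Complex.exp (-(Complex.I * (ω * t))) * Complex.exp (Complex.I * (ω * t)) = 1 := by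
        rw [← Complex.exp_add]; simp
      linear_combination (-u t x) * e2 * Complex.exp (-(Complex.I * (ω * t))) *
        Complex.exp (Complex.I * (ω * t)) - u t x * e3
    · have e1 := hKu s (le_of_lt hs) x
      simp only [Pi.mul_apply, Pi.neg_apply]
      linear_combination (Complex.exp (-z s x) * Complex.exp (-(Complex.I * (ω * s)))) * e1
  have dx : ∀ t, -η < t → ∀ x, HasDerivAt (z t) (D t x) x := by
    intro t ht x
    have hE : Complex.exp (Complex.I * (ω * t)) ≠ 0 := Complex.exp_ne_zero _
    have hR : HasDerivAt (fun y => u t y / (b y * Complex.exp (Complex.I * (ω * t)))) _ x :=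
      (hw.dx t x).fun_div ((hasDerivAt_carrier hθ x).mul_const _) (mul_ne_zero (hb0 x) hE)
    refine (hasDerivAt_of_exp_eq (cz t).continuousAt hR fun y => ?_).of_eq (fun _ => rfl) ?_
    · rw [hexp t ht y]
      have := hb0 y
      field_simp
    · rw [hDu t (le_of_lt ht) x]
      have h1 := hb0 x
      have h2 := hne t (le_of_lt ht) x
      rw [Complex.real_smul, ← hb]
      push_cast
      field_simp
  refine ⟨z, fun t ht x => hK t x ▸ dt t (by linarith) x,
    fun t ht x => hD t x ▸ dx t (by linarith) x, ?_,
    fun t ht x => hexp t (by linarith) x, fun t ht x => ?_⟩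
  · have h1 := contDiffOn_of_partial hO (f := z) (f₁ := K) (f₂ := D)
      (fun v hv => dt v.1 (le_of_lt hv.1) v.2) (fun v hv => dx v.1 hv.1 v.2)
      (cK.mono (prod_mono Ioi_subset_Ici_self subset_rfl))
      (cD.mono (prod_mono Ioi_subset_Ici_self subset_rfl))
    refine h1.comp (t := Ioi (-η) ×ˢ (univ : Set ℝ)) (f := fun v : ℝ × ℝ => (v.2, v.1))
      (by fun_prop) fun v hv => ⟨?_, mem_univ _⟩
    have : (0 : ℝ) ≤ v.2 := hv.2
    exact mem_Ioi.2 (by linarith)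
  · simp only [z]
    congr 1
    refine intervalIntegral.integral_congr fun s hs => ?_
    rw [uIcc_of_le ht] at hs
    simp only [hK]
    rw [max_eq_left hs.1, max_eq_left (by linarith [hs.1])]

end PolarLift

end KleinGordon

namespace KleinGordon

/-! ### Bounds on radius and phase; orbital stability. -/

section Bounds

variable {g : ℂ → ℂ} {u p q : ℝ → ℝ → ℂ} {a k ω B : ℝ} {t : ℝ}

theorem abs_le_of_exp_two_mul {ρ s : ℝ} (h : s = Real.exp (2 * ρ)) (hs : |s - 1| ≤ 1 / 4) :
    |ρ| ≤ |s - 1| := by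
  have hs' := abs_le.1 hs
  have h0 : 0 < s := by linarith
  have hl : Real.log s = 2 * ρ := by rw [h, Real.log_exp]
  have h1 := Real.log_le_sub_one_of_pos h0
  have h2 := Real.one_sub_inv_le_log_of_pos h0
  have h3 : -2 * |s - 1| ≤ 1 - s⁻¹ := by
    have e : 1 - s⁻¹ = (s - 1) / s := by field_simp
    rw [e, le_div_iff₀ h0]
    have := neg_abs_le (s - 1)
    have := abs_nonneg (s - 1)
    nlinarith
  have h4 := le_abs_self (s - 1)
  have h5 := abs_nonneg (s - 1)
  rw [abs_le]
  constructor <;> linarith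

theorem IsWave.continuous_relDer_slice (hw : IsWave g u p q) (h0 : ∀ x, u t x ≠ 0) (c : ℝ) :
    Continuous (relDer c u p t) ∧ Continuous (relDer c u q t) := by
  have m : ∀ v ∈ ({t} : Set ℝ) ×ˢ (univ : Set ℝ), u v.1 v.2 ≠ 0 := fun v hv => by
    rw [show v.1 = t from hv.1]; exact h0 _
  exact ⟨(continuousOn_relDer hw.cont_u hw.cont_p m c).comp_continuous
      (by fun_prop : Continuous fun x : ℝ => (t, x)) fun x => ⟨rfl, mem_univ _⟩,
    (continuousOn_relDer hw.cont_u hw.cont_q m c).comp_continuous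
      (by fun_prop : Continuous fun x : ℝ => (t, x)) fun x => ⟨rfl, mem_univ _⟩⟩

theorem IsWave.eLpNorm_le_of_quadDensity (hw : IsWave g u p q) (h0 : ∀ x, u t x ≠ 0)
    (hB0 : 0 ≤ B) (hB : ∀ l r, l ≤ r → ∫ x in l..r, quadDensity a k ω u p q t x ≤ B ^ 2)
    {E : Type*} [NormedAddCommGroup E] {h : ℝ → E} (hc : Continuous h)
    (hle : ∀ x, ‖h x‖ ^ 2 ≤ quadDensity a k ω u p q t x) :
    eLpNorm h 2 volume ≤ ENNReal.ofReal B := by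
  have cq : Continuous fun x => quadDensity a k ω u p q t x := by
    have m : ∀ v ∈ ({t} : Set ℝ) ×ˢ (univ : Set ℝ), u v.1 v.2 ≠ 0 := fun v hv => by
      rw [show v.1 = t from hv.1]; exact h0 _
    have h1 := hw.continuousOn_quadDensity (a := a) (k := k) (ω := ω) m
    exact h1.comp_continuous (f := fun x : ℝ => (t, x))
      (by fun_prop : Continuous fun x : ℝ => (t, x)) fun x => ⟨rfl, mem_univ _⟩
  refine eLpNorm_two_le_of_integral_le hc hB0 fun l r hlr => le_trans ?_ (hB l r hlr)
  exact intervalIntegral.integral_mono_on hlr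
    (Continuous.intervalIntegrable (by fun_prop) _ _) (cq.intervalIntegrable _ _) fun x _ => hle x

theorem norm_half_add_sq_le (P Q : ℂ) {s : ℝ} (hs : 0 ≤ s) :
    ‖(P + Q) / 2‖ ^ 2 ≤ ‖P‖ ^ 2 + ‖Q‖ ^ 2 + s ∧ ‖(P - Q) / 2‖ ^ 2 ≤ ‖P‖ ^ 2 + ‖Q‖ ^ 2 + s := by
  rw [norm_div, norm_div, Complex.norm_ofNat]
  have h1 := norm_add_le P Q
  have h2 := norm_sub_le P Q
  have h3 := norm_nonneg (P + Q)
  have h4 := norm_nonneg (P - Q)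
  constructor <;> nlinarith [sq_nonneg (‖P‖ - ‖Q‖), norm_nonneg P, norm_nonneg Q]

theorem memH_one_univ {E : Type*} [NormedAddCommGroup E] [NormedSpace ℝ E] [CompleteSpace E]
    {w g : ℝ → E} (hd : ∀ x, HasDerivAt w (g x) x) (hg : Continuous g) {A B : ℝ≥0∞}
    (hA : eLpNorm w 2 volume ≤ A) (hB : eLpNorm g 2 volume ≤ B) (hA' : A < ⊤) (hB' : B < ⊤) :
    MemH 1 univ w ∧ hNorm 1 univ w ≤ A + B := by
  have hp := IsPrimitive.of_hasDerivAt hd hg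
  have hwd := hp.hasWeakDerivOn univ
  refine ⟨⟨?_, g, hwd, ?_⟩, (hNorm_one_le hwd).trans ?_⟩
  · rw [Measure.restrict_univ]
    exact ⟨hp.continuous.aestronglyMeasurable, hA.trans_lt hA'⟩
  · rw [MemH, Measure.restrict_univ]
    exact ⟨hg.aestronglyMeasurable, hB.trans_lt hB'⟩
  · rw [Measure.restrict_univ]
    gcongr

theorem abs_intervalIntegral_le_sqrt {h : ℝ → ℝ} (hc : Continuous h) (hB0 : 0 ≤ B)
    (hB : eLpNorm h 2 volume ≤ ENNReal.ofReal B) {y x R : ℝ} (hR : 0 ≤ R) (hx : |x - y| ≤ R) :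
    |∫ s in y..x, h s| ≤ B * √R := by
  have h1 : ‖∫ s in y..x, h s‖ₑ ≤ ENNReal.ofReal (B * √R) := by
    rw [← ofReal_norm, intervalIntegral.norm_integral_eq_norm_integral_uIoc, ofReal_norm]
    refine (enorm_integral_le_lintegral_enorm _).trans ?_
    rw [← eLpNorm_one_eq_lintegral_enorm]
    refine (eLpNorm_le_eLpNorm_mul_rpow_measure_univ (by norm_num : (1 : ℝ≥0∞) ≤ 2)
      hc.aestronglyMeasurable).trans ?_
    rw [ENNReal.ofReal_mul hB0]
    refine mul_le_mul' ((eLpNorm_mono_measure _ Measure.restrict_le_self).trans hB) ?_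
    rw [Measure.restrict_apply MeasurableSet.univ, univ_inter, Real.volume_uIoc, Real.sqrt_eq_rpow,
      ← ENNReal.ofReal_rpow_of_nonneg hR (by norm_num)]
    norm_num
    gcongr
  rw [Real.enorm_eq_ofReal_abs] at h1
  exact (ENNReal.ofReal_le_ofReal_iff (by positivity)).1 h1

/-- The bounds for the radius and the phase, in terms of `z = ϱ + i ϑ`. -/
theorem IsWave.polar_bounds (hw : IsWave g u p q) (ha : 0 < a) (ht : 0 ≤ t)
    (hmod : ∀ t, 0 ≤ t → ∀ x, |relMod a u t x - 1| ≤ 1 / 4) (hB0 : 0 ≤ B)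
    (hB : ∀ t, 0 ≤ t → ∀ l r, l ≤ r → ∫ x in l..r, quadDensity a k ω u p q t x ≤ B ^ 2)
    {θ T : ℝ → ℝ} {W : ℝ → ℂ} (cT : Continuous T)
    (cW : Continuous W) (hW : ∀ x, ‖W x‖ ≤ a / 2) {e : ℝ} (he : 0 ≤ e)
    (eW : eLpNorm W 2 volume ≤ ENNReal.ofReal e) (eT : eLpNorm T 2 volume ≤ ENNReal.ofReal e)
    {z : ℝ → ℝ → ℂ}
    (dt : ∀ t, 0 ≤ t → ∀ x, HasDerivAt (fun s => z s x)
        ((relDer (ω + k) u p t x + relDer (ω - k) u q t x) / 2) t)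
    (dx : ∀ t, 0 ≤ t → ∀ x, HasDerivAt (z t)
        ((relDer (ω + k) u p t x - relDer (ω - k) u q t x) / 2 + Complex.I * T x) x)
    (hexp : ∀ t, 0 ≤ t → ∀ x, u t x = carrier a k θ x * Complex.exp (Complex.I * (ω * t)) *
        Complex.exp (z t x))
    (hz : ∀ t, 0 ≤ t → ∀ x, z t x = Complex.log (1 + W x / carrier a k θ x) +
        ∫ s in (0 : ℝ)..t,
          (relDer (ω + k) u p (max s 0) x + relDer (ω - k) u q (max s 0) x) / 2) :
    MemH 1 univ (fun x => (z t x).re) ∧ MemH 1 univ (fun x => (z t x).im) ∧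
    MemLp (fun x => derivWithin (fun s => (z s x).re) (Ici 0) t) 2 ∧
    MemLp (fun x => derivWithin (fun s => (z s x).im) (Ici 0) t) 2 ∧
    eLpNorm (fun x => derivWithin (fun s => (z s x).re) (Ici 0) t) 2 +
        eLpNorm (fun x => derivWithin (fun s => (z s x).im) (Ici 0) t) 2 +
        hNorm 1 univ (fun x => (z t x).re) +
        eLpNorm (deriv (fun x => (z t x).im)) 2 ≤ ENNReal.ofReal (5 * B + e) ∧
    eLpNorm (fun x => (z t x).im) 2 ≤
      ENNReal.ofReal (3 / (2 * a) * e + B) * ENNReal.ofReal (t + 1) ∧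
    eLpNorm (fun x => (z t x).re) 2 volume ≤ ENNReal.ofReal B ∧
    (∀ x, |(z t x).re| ≤ 1 / 4) := by
  have hne : ∀ t, 0 ≤ t → ∀ x, u t x ≠ 0 := fun t ht x h0 => by
    have := hmod t ht x
    rw [relMod, h0] at this
    norm_num at this
  have hcar : ∀ x, ‖carrier a k θ x‖ = a := fun x => norm_carrier ha x
  have hPQ : ∀ t, 0 ≤ t →
      (Continuous fun x => (relDer (ω + k) u p t x + relDer (ω - k) u q t x) / 2) ∧
      (Continuous fun x => (relDer (ω + k) u p t x - relDer (ω - k) u q t x) / 2) := fun t ht => by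
    have h1 := (hw.continuous_relDer_slice (hne t ht) (ω + k)).1
    have h2 := (hw.continuous_relDer_slice (hne t ht) (ω - k)).2
    exact ⟨(h1.add h2).div_const 2, (h1.sub h2).div_const 2⟩
  have eK : ∀ t, 0 ≤ t → eLpNorm (fun x => (relDer (ω + k) u p t x + relDer (ω - k) u q t x) / 2)
      2 volume ≤ ENNReal.ofReal B := fun t ht =>
    hw.eLpNorm_le_of_quadDensity (hne t ht) hB0 (hB t ht) (hPQ t ht).1
      fun x => (norm_half_add_sq_le _ _ (sq_nonneg _)).1
  have eD : eLpNorm (fun x => (relDer (ω + k) u p t x - relDer (ω - k) u q t x) / 2)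
      2 volume ≤ ENNReal.ofReal B :=
    hw.eLpNorm_le_of_quadDensity (hne t ht) hB0 (hB t ht) (hPQ t ht).2
      fun x => (norm_half_add_sq_le _ _ (sq_nonneg _)).2
  have eM : eLpNorm (fun x => relMod a u t x - 1) 2 volume ≤ ENNReal.ofReal B := by
    refine hw.eLpNorm_le_of_quadDensity (hne t ht) hB0 (hB t ht) ?_ fun x => ?_
    · exact ((hw.continuous_relMod a).comp
        (by fun_prop : Continuous fun x : ℝ => (t, x))).sub continuous_const
    · rw [Real.norm_eq_abs, sq_abs, quadDensity]
      have := sq_nonneg ‖relDer (ω + k) u p t x‖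
      have := sq_nonneg ‖relDer (ω - k) u q t x‖
      linarith
  -- Taking moduli in the polar form gives s = e^{2·Re z}, so Re z is comparable to s-1 near s = 1.
  have hre : ∀ x, |(z t x).re| ≤ |relMod a u t x - 1| := fun x => by
    refine abs_le_of_exp_two_mul ?_ (hmod t ht x)
    have e1 : Complex.I * ((ω : ℂ) * t) = ((ω * t : ℝ) : ℂ) * Complex.I := by push_cast; ring
    rw [relMod, hexp t ht x, norm_mul, norm_mul, hcar, e1, Complex.norm_exp_ofReal_mul_I,
      Complex.norm_exp, mul_one, two_mul, Real.exp_add]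
    field_simp
  have eR : eLpNorm (fun x => (z t x).re) 2 volume ≤ ENNReal.ofReal B :=
    (eLpNorm_mono fun x => by simpa only [Real.norm_eq_abs] using hre x).trans eM
  have dre : ∀ x, HasDerivAt (fun x => (z t x).re)
      ((relDer (ω + k) u p t x - relDer (ω - k) u q t x) / 2).re x := fun x => by
    refine (Complex.reCLM.hasFDerivAt.comp_hasDerivAt x (dx t ht x)).congr_deriv ?_
    simp
  have dim : ∀ x, HasDerivAt (fun x => (z t x).im)
      (((relDer (ω + k) u p t x - relDer (ω - k) u q t x) / 2).im + T x) x := fun x => by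
    refine (Complex.imCLM.hasFDerivAt.comp_hasDerivAt x (dx t ht x)).congr_deriv ?_
    simp
  have wre : ∀ x, derivWithin (fun s => (z s x).re) (Ici 0) t =
      ((relDer (ω + k) u p t x + relDer (ω - k) u q t x) / 2).re := fun x =>
    (Complex.reCLM.hasFDerivAt.comp_hasDerivAt t (dt t ht x)).hasDerivWithinAt.derivWithin
      (uniqueDiffOn_Ici 0 t ht)
  have wim : ∀ x, derivWithin (fun s => (z s x).im) (Ici 0) t =
      ((relDer (ω + k) u p t x + relDer (ω - k) u q t x) / 2).im := fun x =>
    (Complex.imCLM.hasFDerivAt.comp_hasDerivAt t (dt t ht x)).hasDerivWithinAt.derivWithin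
      (uniqueDiffOn_Ici 0 t ht)
  have cDre := Complex.continuous_re.comp (hPQ t ht).2
  have cDim := Complex.continuous_im.comp (hPQ t ht).2
  have ewre : eLpNorm (fun x => derivWithin (fun s => (z s x).re) (Ici 0) t) 2 volume ≤
      ENNReal.ofReal B := by
    simp only [wre]
    exact (eLpNorm_mono fun x => by
      rw [Real.norm_eq_abs]; exact Complex.abs_re_le_norm _).trans (eK t ht)
  have ewim : eLpNorm (fun x => derivWithin (fun s => (z s x).im) (Ici 0) t) 2 volume ≤
      ENNReal.ofReal B := by
    simp only [wim]
    exact (eLpNorm_mono fun x => by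
      rw [Real.norm_eq_abs]; exact Complex.abs_im_le_norm _).trans (eK t ht)
  have eDre : eLpNorm (fun x => ((relDer (ω + k) u p t x - relDer (ω - k) u q t x) / 2).re) 2
      volume ≤ ENNReal.ofReal B :=
    (eLpNorm_mono fun x => by
      rw [Real.norm_eq_abs]; exact Complex.abs_re_le_norm _).trans eD
  have eDim : eLpNorm (fun x => ((relDer (ω + k) u p t x - relDer (ω - k) u q t x) / 2).im) 2
      volume ≤ ENNReal.ofReal B :=
    (eLpNorm_mono fun x => by
      rw [Real.norm_eq_abs]; exact Complex.abs_im_le_norm _).trans eD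
  have eDimT : eLpNorm (fun x => ((relDer (ω + k) u p t x - relDer (ω - k) u q t x) / 2).im + T x)
      2 volume ≤ ENNReal.ofReal (B + e) := by
    rw [ENNReal.ofReal_add hB0 he]
    exact (eLpNorm_add_le cDim.aestronglyMeasurable cT.aestronglyMeasurable (by norm_num)).trans
      (add_le_add eDim eT)
  -- The initial phase is at most 3/(2a)·|W|, from |log(1+w)| ≤ (3/2)|w| for |w| ≤ 1/2. Minkowski's
  -- inequality for the time integral adds t·B: only z_t, not Im z, is controlled by the energy.
  have eI : eLpNorm (fun x => (z t x).im) 2 volume ≤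
      ENNReal.ofReal (3 / (2 * a) * e + B) * ENNReal.ofReal (t + 1) := by
    let Φ : ℝ → ℝ → ℂ := fun s x =>
      (relDer (ω + k) u p (max s 0) x + relDer (ω - k) u q (max s 0) x) / 2
    have cΦ : Continuous fun v : ℝ × ℝ => Φ v.1 v.2 := by
      have m : ∀ v ∈ Ici (0 : ℝ) ×ˢ (univ : Set ℝ), u v.1 v.2 ≠ 0 := fun v hv => hne _ hv.1 _
      have c0 : Continuous fun v : ℝ × ℝ => (max v.1 0, v.2) := by fun_prop
      have mm : ∀ v : ℝ × ℝ, (max v.1 0, v.2) ∈ Ici (0 : ℝ) ×ˢ (univ : Set ℝ) := fun v =>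
        ⟨mem_Ici.2 (le_max_right _ _), mem_univ _⟩
      exact (((continuousOn_relDer hw.cont_u hw.cont_p m (ω + k)).comp_continuous c0 mm).add
        ((continuousOn_relDer hw.cont_u hw.cont_q m (ω - k)).comp_continuous c0 mm)).div_const 2
    have h1 : eLpNorm (fun x => ∫ s in (0 : ℝ)..t, Φ s x) 2 volume ≤
        ENNReal.ofReal |t - 0| * ENNReal.ofReal B :=
      eLpNorm_intervalIntegral_le cΦ.stronglyMeasurable fun s _ => eK _ (le_max_right _ _)
    have cI : Continuous fun x => ∫ s in (0 : ℝ)..t, Φ s x := by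
      have c1 : Continuous fun v : ℝ × ℝ => Φ v.2 v.1 :=
        cΦ.comp (by fun_prop : Continuous fun v : ℝ × ℝ => (v.2, v.1))
      exact intervalIntegral.continuous_parametric_intervalIntegral_of_continuous'
        (f := fun x s => Φ s x) c1 0 t
    have h2 : ∀ x, ‖(z t x).im‖ ≤ ‖3 / (2 * a) * ‖W x‖ + ‖∫ s in (0 : ℝ)..t, Φ s x‖‖ := fun x => by
      rw [Real.norm_of_nonneg (by positivity : (0 : ℝ) ≤
        3 / (2 * a) * ‖W x‖ + ‖∫ s in (0 : ℝ)..t, Φ s x‖), Real.norm_eq_abs]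
      refine (Complex.abs_im_le_norm _).trans ?_
      rw [hz t ht x]
      refine (norm_add_le _ _).trans (add_le_add ?_ le_rfl)
      have h3 : ‖W x / carrier a k θ x‖ ≤ 1 / 2 := by
        rw [norm_div, hcar, div_le_iff₀ ha]
        linarith [hW x]
      refine (Complex.norm_log_one_add_half_le_self h3).trans (le_of_eq ?_)
      rw [norm_div, hcar]
      field_simp
    have h4 : eLpNorm (fun x => 3 / (2 * a) * ‖W x‖) 2 volume ≤
        ENNReal.ofReal (3 / (2 * a) * e) := by
      have h5 : eLpNorm (fun x => 3 / (2 * a) * ‖W x‖) 2 volume =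
          ‖3 / (2 * a)‖ₑ * eLpNorm (fun x => ‖W x‖) 2 volume :=
        eLpNorm_const_smul (3 / (2 * a)) (fun x => ‖W x‖) 2 volume
      rw [h5, eLpNorm_norm, ENNReal.ofReal_mul (by positivity), Real.enorm_eq_ofReal_abs,
        abs_of_nonneg (by positivity)]
      gcongr
    calc eLpNorm (fun x => (z t x).im) 2 volume
        ≤ eLpNorm (fun x => 3 / (2 * a) * ‖W x‖ + ‖∫ s in (0 : ℝ)..t, Φ s x‖) 2 volume :=
          eLpNorm_mono h2
      _ ≤ ENNReal.ofReal (3 / (2 * a) * e) + ENNReal.ofReal |t - 0| * ENNReal.ofReal B := by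
          refine (eLpNorm_add_le ?_ ?_ (by norm_num)).trans (add_le_add h4 ?_)
          · exact (by fun_prop : Continuous fun x => 3 / (2 * a) * ‖W x‖).aestronglyMeasurable
          · exact cI.norm.aestronglyMeasurable
          · rw [eLpNorm_norm]; exact h1
      _ ≤ _ := by
          rw [sub_zero, abs_of_nonneg ht, ← ENNReal.ofReal_mul ht,
            ← ENNReal.ofReal_add (by positivity) (by positivity),
            ← ENNReal.ofReal_mul (by positivity)]
          refine ENNReal.ofReal_le_ofReal ?_
          have h5 : 0 ≤ 3 / (2 * a) * e * t := by positivity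
          linear_combination h5 + hB0
  have Hre := memH_one_univ dre cDre eR eDre ENNReal.ofReal_lt_top ENNReal.ofReal_lt_top
  have Him := memH_one_univ dim (cDim.add cT) eI eDimT
    (ENNReal.mul_lt_top ENNReal.ofReal_lt_top ENNReal.ofReal_lt_top) ENNReal.ofReal_lt_top
  refine ⟨Hre.1, Him.1, ⟨?_, ewre.trans_lt ENNReal.ofReal_lt_top⟩,
    ⟨?_, ewim.trans_lt ENNReal.ofReal_lt_top⟩, ?_, eI, eR, fun x => (hre x).trans (hmod t ht x)⟩
  · simp only [wre]
    exact (Complex.continuous_re.comp (hPQ t ht).1).aestronglyMeasurable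
  · simp only [wim]
    exact (Complex.continuous_im.comp (hPQ t ht).1).aestronglyMeasurable
  · have e1 : deriv (fun x => (z t x).im) = fun x =>
        ((relDer (ω + k) u p t x - relDer (ω - k) u q t x) / 2).im + T x :=
      funext fun x => (dim x).deriv
    rw [e1]
    refine (add_le_add (add_le_add (add_le_add ewre ewim) Hre.2) eDimT).trans (le_of_eq ?_)
    rw [← ENNReal.ofReal_add hB0 hB0, ← ENNReal.ofReal_add (by positivity) (by positivity),
      ← ENNReal.ofReal_add (by positivity) (by positivity)]
    congr 1
    ring

theorem norm_exp_sub_one_le_add {r y : ℝ} (hr : |r| ≤ 1 / 4) :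
    ‖Complex.exp (r + Complex.I * y) - 1‖ ≤ 2 * |r| + |y| := by
  have e : Complex.exp (r + Complex.I * y) - 1 =
      (Complex.exp r - 1) * Complex.exp (Complex.I * y) + (Complex.exp (Complex.I * y) - 1) := by
    rw [Complex.exp_add]; ring
  rw [e]
  refine (norm_add_le _ _).trans (add_le_add ?_ ?_)
  · rw [norm_mul, mul_comm Complex.I, Complex.norm_exp_ofReal_mul_I, mul_one]
    have := Complex.norm_exp_sub_one_le (x := (r : ℂ))
      (by rw [Complex.norm_real, Real.norm_eq_abs]; linarith)
    rwa [Complex.norm_real, Real.norm_eq_abs] at this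
  · have := Real.norm_exp_I_mul_ofReal_sub_one_le (x := y)
    rwa [Real.norm_eq_abs] at this

/-- The total phase Im z - θ has derivative Im((P-Q)/2), because the θ' in z_x cancels. By
Cauchy–Schwarz it varies by at most B√R from its value at the centre, which is taken as γ; so the
oscillation of θ itself never has to be estimated. -/
theorem IsWave.orbital_bound (hw : IsWave g u p q) (ha : 0 < a)
    (hmod : ∀ x, |relMod a u t x - 1| ≤ 1 / 4) (hB0 : 0 ≤ B)
    (hB : ∀ l r, l ≤ r → ∫ x in l..r, quadDensity a k ω u p q t x ≤ B ^ 2)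
    {θ T : ℝ → ℝ} (hθ : ∀ x, HasDerivAt θ (T x) x) {z : ℝ → ℂ}
    (dx : ∀ x, HasDerivAt z
        ((relDer (ω + k) u p t x - relDer (ω - k) u q t x) / 2 + Complex.I * T x) x)
    (hexp : ∀ x, u t x = carrier a k θ x * Complex.exp (Complex.I * (ω * t)) *
        Complex.exp (z x))
    (eR : eLpNorm (fun x => (z x).re) 2 volume ≤ ENNReal.ofReal B)
    (hre : ∀ x, |(z x).re| ≤ 1 / 4) {R : ℝ} (hR : 0 < R) (y : ℝ) :
    ∃ γ : ℝ, hNorm 1 (Ioo (y - R) (y + R))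
      (fun x => u t x - a * Complex.exp (Complex.I * (k * x + ω * t + γ))) ≤
      ENNReal.ofReal ((a * (2 + √R * √(2 * R)) * (1 + |k|) + 2 * a) * B) := by
  have hne : ∀ x, u t x ≠ 0 := fun x h0 => by
    have := hmod x
    rw [relMod, h0] at this
    norm_num at this
  let φ : ℝ → ℝ := fun x => (z x).im - θ x
  let G : ℝ → ℂ := fun x => (relDer (ω + k) u p t x - relDer (ω - k) u q t x) / 2
  have cG : Continuous G := by
    have h1 := (hw.continuous_relDer_slice hne (ω + k)).1
    have h2 := (hw.continuous_relDer_slice hne (ω - k)).2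
    exact (h1.sub h2).div_const 2
  have eG : eLpNorm G 2 volume ≤ ENNReal.ofReal B :=
    hw.eLpNorm_le_of_quadDensity hne hB0 hB cG fun x => (norm_half_add_sq_le _ _ (sq_nonneg _)).2
  have dφ : ∀ x, HasDerivAt φ (G x).im x := fun x => by
    have := (Complex.imCLM.hasFDerivAt.comp_hasDerivAt x (dx x)).sub (hθ x)
    refine this.congr_deriv ?_
    simp [G]
  have eGim : eLpNorm (fun x => (G x).im) 2 volume ≤ ENNReal.ofReal B :=
    (eLpNorm_mono fun x => by
      rw [Real.norm_eq_abs]; exact Complex.abs_im_le_norm _).trans eG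
  have cGim : Continuous fun x => (G x).im := Complex.continuous_im.comp cG
  have hφ : ∀ x ∈ Ioo (y - R) (y + R), |φ x - φ y| ≤ B * √R := fun x hx => by
    rw [← intervalIntegral.integral_eq_sub_of_hasDerivAt (fun s _ => dφ s)
      (cGim.intervalIntegrable _ _)]
    refine abs_intervalIntegral_le_sqrt cGim hB0 eGim hR.le (abs_le.2 ⟨?_, ?_⟩) <;>
      linarith [hx.1, hx.2]
  set γ := φ y with hγ
  refine ⟨γ, ?_⟩
  let Ψ : ℝ → ℂ := fun x => a * Complex.exp (Complex.I * (k * x + ω * t + γ))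
  let D : ℝ → ℂ := fun x => u t x - Ψ x
  have dΨ : ∀ x, HasDerivAt Ψ (Complex.I * k * Ψ x) x := fun x => by
    have h1 : HasDerivAt (fun x : ℝ => (k : ℂ) * x + ω * t + γ) ((k : ℂ) * 1) x :=
      (((Complex.ofRealCLM.hasDerivAt (x := x)).const_mul (k : ℂ)).add_const _).add_const _
    refine (((h1.const_mul Complex.I).cexp).const_mul (a : ℂ)).of_eq (fun _ => rfl) ?_
    simp only [Ψ]
    ring
  have cu : Continuous (u t) := hw.cont_u.comp (by fun_prop : Continuous fun x : ℝ => (t, x))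
  have cΨ : Continuous Ψ := continuous_iff_continuousAt.2 fun x => (dΨ x).continuousAt
  have cD : Continuous D := cu.sub cΨ
  -- Since u_x = (G + ik)u and the reference wave has logarithmic derivative ik, the derivative of
  -- the difference is uG + ikD, which needs only G and D in L².
  have dD : ∀ x, HasDerivAt D (u t x * G x + Complex.I * k * D x) x := fun x => by
    refine ((hw.dx t x).sub (dΨ x)).of_eq (fun _ => rfl) ?_
    have := hne x
    simp only [G, D, relDer]
    push_cast
    field_simp
    ring
  have hDn : ∀ x ∈ Ioo (y - R) (y + R), ‖D x‖ ≤ 2 * a * |(z x).re| + a * (B * √R) := by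
    intro x hx
    have e1 : D x = Ψ x * (Complex.exp ((z x).re + Complex.I * ((φ x - γ : ℝ) : ℂ)) - 1) := by
      have e2 : u t x = Ψ x * Complex.exp ((z x).re + Complex.I * ((φ x - γ : ℝ) : ℂ)) := by
        rw [hexp x]
        simp only [carrier, Ψ]
        rw [mul_assoc, mul_assoc, mul_assoc, ← Complex.exp_add, ← Complex.exp_add,
          ← Complex.exp_add]
        congr 2
        have e3 : z x = (z x).re + Complex.I * (z x).im := by
          rw [mul_comm]; exact (Complex.re_add_im (z x)).symm
        have e4 : (φ x : ℂ) = (z x).im - θ x := by simp only [φ]; push_cast; ring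
        push_cast
        rw [e4]
        linear_combination e3
      simp only [D]
      rw [e2]; ring
    have e5 : ‖Ψ x‖ = a := by
      have : Complex.I * ((k : ℂ) * x + ω * t + γ) = ((k * x + ω * t + γ : ℝ) : ℂ) * Complex.I := by
        push_cast; ring
      simp only [Ψ]
      rw [norm_mul, this, Complex.norm_exp_ofReal_mul_I, mul_one, Complex.norm_real,
        Real.norm_of_nonneg ha.le]
    rw [e1, norm_mul, e5]
    have h1 := norm_exp_sub_one_le_add (y := φ x - γ) (hre x)
    have h2 := hφ x hx
    calc _ ≤ a * (2 * |(z x).re| + B * √R) := by gcongr; linarith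
      _ = _ := by ring
  have czr : Continuous fun x => (z x).re :=
    Complex.continuous_re.comp (continuous_iff_continuousAt.2 fun x => (dx x).continuousAt)
  set Ω := Ioo (y - R) (y + R) with hΩ
  have N1 : eLpNorm D 2 (volume.restrict Ω) ≤
      ENNReal.ofReal (a * (2 + √R * √(2 * R)) * B) := by
    have h1 : eLpNorm D 2 (volume.restrict Ω) ≤
        eLpNorm (fun x => 2 * a * |(z x).re| + a * (B * √R)) 2 (volume.restrict Ω) := by
      refine eLpNorm_mono_ae_real ?_
      rw [ae_restrict_iff' measurableSet_Ioo]
      exact Eventually.of_forall hDn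
    refine h1.trans ((eLpNorm_add_le
      (by fun_prop : Continuous fun x => 2 * a * |(z x).re|).aestronglyMeasurable
      aestronglyMeasurable_const (by norm_num)).trans ?_)
    have h2 : eLpNorm (fun x => 2 * a * |(z x).re|) 2 (volume.restrict Ω) ≤
        ENNReal.ofReal (2 * a * B) := by
      have h3 : eLpNorm (fun x => 2 * a * |(z x).re|) 2 (volume.restrict Ω) =
          ‖2 * a‖ₑ * eLpNorm (fun x => ‖(z x).re‖) 2 (volume.restrict Ω) :=
        eLpNorm_const_smul (2 * a) (fun x => ‖(z x).re‖) 2 _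
      rw [h3, eLpNorm_norm, ENNReal.ofReal_mul (by positivity), Real.enorm_eq_ofReal_abs,
        abs_of_nonneg (by positivity)]
      gcongr
      exact (eLpNorm_mono_measure _ Measure.restrict_le_self).trans eR
    have h4 : eLpNorm (fun _ : ℝ => a * (B * √R)) 2 (volume.restrict Ω) =
        ENNReal.ofReal (a * (B * √R) * √(2 * R)) := by
      rw [eLpNorm_const' _ (by norm_num) (by norm_num), Measure.restrict_apply MeasurableSet.univ,
        univ_inter, Real.volume_Ioo, Real.enorm_eq_ofReal_abs, abs_of_nonneg (by positivity),
        ENNReal.ofReal_mul (p := a * (B * √R)) (by positivity), Real.sqrt_eq_rpow (2 * R),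
        ← ENNReal.ofReal_rpow_of_nonneg (by positivity) (by norm_num)]
      congr 2
      congr 1
      ring
    refine (add_le_add h2 h4.le).trans (le_of_eq ?_)
    rw [← ENNReal.ofReal_add (by positivity) (by positivity)]
    congr 1
    ring
  have hun : ∀ x, ‖u t x‖ ≤ 2 * a := fun x => by
    have h1 := (abs_le.1 (hmod x)).2
    rw [relMod] at h1
    have h2 : ‖u t x‖ ^ 2 / a ^ 2 ≤ 2 := by linarith
    rw [div_le_iff₀ (by positivity)] at h2
    refine le_of_sq_le_sq ?_ (by positivity)
    nlinarith
  have N2 : eLpNorm (fun x => u t x * G x + Complex.I * k * D x) 2 (volume.restrict Ω) ≤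
      ENNReal.ofReal (2 * a * B + |k| * (a * (2 + √R * √(2 * R)) * B)) := by
    refine (eLpNorm_add_le (cu.mul cG).aestronglyMeasurable
      (by fun_prop : Continuous fun x => Complex.I * k * D x).aestronglyMeasurable
      (by norm_num)).trans ?_
    rw [ENNReal.ofReal_add (by positivity) (by positivity)]
    refine add_le_add ?_ ?_
    · have h1 := eLpNorm_le_mul_eLpNorm_of_ae_le_mul (p := 2) (μ := volume.restrict Ω)
        (f := fun x => u t x * G x) (g := G) (c := 2 * a) (Eventually.of_forall fun x => by
          rw [norm_mul]; gcongr; exact hun x)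
      refine h1.trans ?_
      rw [ENNReal.ofReal_mul (p := 2 * a) (by positivity)]
      gcongr
      exact (eLpNorm_mono_measure _ Measure.restrict_le_self).trans eG
    · have h1 := eLpNorm_le_mul_eLpNorm_of_ae_le_mul (p := 2) (μ := volume.restrict Ω)
        (f := fun x => Complex.I * k * D x) (g := D) (c := |k|) (Eventually.of_forall fun x => by
          rw [norm_mul, norm_mul, Complex.norm_I, one_mul, Complex.norm_real, Real.norm_eq_abs])
      refine h1.trans ?_
      rw [ENNReal.ofReal_mul (abs_nonneg k)]
      gcongr
  have hp := (IsPrimitive.of_hasDerivAt dD (by fun_prop)).hasWeakDerivOn Ω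
  refine (hNorm_one_le hp).trans ((add_le_add N1 N2).trans (le_of_eq ?_))
  rw [← ENNReal.ofReal_add (by positivity) (by positivity)]
  congr 1
  ring

end Bounds

end KleinGordon

namespace KleinGordon

/-! ### Smallness thresholds and the assembly. -/

section Main

theorem Admissible.exists_isPrimitive {f : ℝ → ℝ} {a : ℝ} {θ : ℝ → ℝ} (h : Admissible f a θ) :
    (∀ x, HasDerivAt θ (deriv θ x) x) ∧
      ∃ T', IsPrimitive (deriv θ) T' ∧ MemLp (deriv θ) 2 volume ∧ MemLp T' 2 volume := by
  obtain ⟨h1, h2, -⟩ := h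
  refine ⟨fun x => (h1.differentiable (by norm_num) x).hasDerivAt, ?_⟩
  obtain ⟨W, T', p, e, m, m'⟩ := exists_isPrimitive_of_memH_one h2
  have e' : deriv θ = W :=
    (h1.continuous_deriv (by norm_num)).ae_eq_iff_eq volume p.continuous |>.1 e
  rw [e']
  exact ⟨T', p, m, m'⟩

/-- The H² regularity is qualitative: the two bounds involve the H¹ norm alone, because only that
norm is assumed small. -/
theorem exists_representative {w₀ : ℝ → ℂ} (h : MemH 2 univ w₀) :
    ∃ W W' W'', (∀ x, HasDerivAt W (W' x) x) ∧ IsPrimitive W' W'' ∧ w₀ =ᵐ[volume] W ∧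
      MemLp W 2 volume ∧ MemLp W' 2 volume ∧ MemLp W'' 2 volume ∧
      eLpNorm W 2 volume ≤ hNorm 1 univ w₀ ∧ eLpNorm W' 2 volume ≤ hNorm 1 univ w₀ := by
  obtain ⟨W, W', W'', d, p, e, m, m', m''⟩ := exists_isPrimitive_of_memH_two h
  refine ⟨W, W', W'', d, p, e, m, m', m'', ?_, ?_⟩
  · have := eLpNorm_le_hNorm 1 univ w₀
    rwa [Measure.restrict_univ, eLpNorm_congr_ae e] at this
  · have hw : HasWeakDerivOn univ w₀ W' :=
      ((IsPrimitive.of_hasDerivAt d p.continuous).hasWeakDerivOn univ).congr MeasurableSet.univ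
        (by rw [Measure.restrict_univ]; exact e.symm) EventuallyEq.rfl
    have := hNorm_weakDeriv_le isOpen_univ hw 0
    rwa [hNorm_zero, Measure.restrict_univ] at this

/-- Waves starting close to the periodic wave exist globally and stay close to it. -/
theorem exists_stable_wave {f : ℝ → ℝ} (hf : ContDiffOn ℝ 2 f (Ici 0)) {a k ω : ℝ} (ha : 0 < a)
    (hkω : (k, ω) ≠ (0, 0)) (hdisp : ω ^ 2 = k ^ 2 + f (a ^ 2))
    (hspec : 2 * max 0 (-f (a ^ 2)) < a ^ 2 * deriv f (a ^ 2)) :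
    ∃ κ > 0, ∃ e₀ > 0, ∀ (θ T T' : ℝ → ℝ) (W W' W'' V V' : ℝ → ℂ) (e : ℝ), 0 ≤ e → e ≤ e₀ →
      (∀ x, HasDerivAt θ (T x) x) → IsPrimitive T T' → MemLp T' 2 volume →
      (∀ x, HasDerivAt W (W' x) x) → IsPrimitive W' W'' → MemLp W'' 2 volume →
      IsPrimitive V V' → MemLp V' 2 volume →
      eLpNorm T 2 volume ≤ ENNReal.ofReal e → eLpNorm W 2 volume ≤ ENNReal.ofReal e →
      eLpNorm W' 2 volume ≤ ENNReal.ofReal e → eLpNorm V 2 volume ≤ ENNReal.ofReal e →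
      ∃ (g : ℂ → ℂ) (u p q : ℝ → ℝ → ℂ), IsWave g u p q ∧
        (∀ x, u 0 x = carrier a k θ x + W x) ∧ (∀ x, ‖W x‖ ≤ a / 2) ∧
        (∃ M, ∀ t, |t| ≤ 1 → ∀ x, ‖u t x‖ ≤ M ∧ ‖p t x‖ ≤ M ∧ ‖q t x‖ ≤ M) ∧
        (∀ t, 0 ≤ t → ∀ x, |relMod a u t x - 1| ≤ 1 / 4) ∧
        (∀ t, 0 ≤ t → ∀ l r, l ≤ r → ∫ x in l..r, quadDensity a k ω u p q t x ≤ (κ * e) ^ 2) ∧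
        ∀ U₀ U₁ : ℝ → ℂ, (fun x => carrier a k θ x + W x) =ᵐ[volume] U₀ →
          (fun x => carrier a k θ x * (Complex.I * ω) + V x) =ᵐ[volume] U₁ →
          IsClassicalSolution f U₀ U₁ u := by
  obtain ⟨F, cF, sF, eF, hF⟩ := exists_truncation hf (by positivity : 0 < a ^ 2)
  have hFa : F (a ^ 2) = f (a ^ 2) := eF.self_of_nhds
  have hdF : HasDerivAt F (deriv f (a ^ 2)) (a ^ 2) :=
    (((hf.contDiffAt (Ici_mem_nhds (by positivity))).differentiableAt
      (by norm_num)).hasDerivAt).congr_of_eventuallyEq eF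
  obtain ⟨ε, hε, hε4, K, hK, η, hη, hstab⟩ := exists_stability (k := k) (ω := ω) cF.continuous hdF
    ha hkω (by rw [hFa]; exact hdisp) (by rw [hFa]; exact hspec)
  set Kd := 32 / a ^ 2 * (1 + a ^ 2 + ω ^ 2 + k ^ 2) + 9 / a ^ 2 with hKd
  have hKd0 : 0 < Kd := by positivity
  -- The energy starts below 4·Kd·e² and stays below K times that, whence κ. The three thresholds
  -- ensure |W| ≤ 2e ≤ a/2, initial modulus deviation (3/a)·2e ≤ ε, and initial energy at most η.
  refine ⟨√(4 * K * Kd), by positivity, min (a / 4) (min (a * ε / 6) (√(η / (4 * Kd)))),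
    by positivity, ?_⟩
  intro θ T T' W W' W'' V V' e he0 hee hθ pT mT' dW pW' mW'' pV mV' eT eW eW' eV
  have he1 : e ≤ a / 4 := hee.trans (min_le_left _ _)
  have he2 : e ≤ a * ε / 6 := hee.trans ((min_le_right _ _).trans (min_le_left _ _))
  have he3 : e ≤ √(η / (4 * Kd)) := hee.trans ((min_le_right _ _).trans (min_le_right _ _))
  have he4 : 4 * Kd * e ^ 2 ≤ η := by
    have h1 : e ^ 2 ≤ η / (4 * Kd) := by
      rw [← Real.sq_sqrt (by positivity : 0 ≤ η / (4 * Kd))]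
      gcongr
    rw [le_div_iff₀ (by positivity)] at h1
    linarith
  have cT := pT.continuous
  have cW' := pW'.continuous
  have cV := pV.continuous
  have pW : IsPrimitive W W' := IsPrimitive.of_hasDerivAt dW cW'
  have cW := pW.continuous
  have fin : ∀ {E : Type} [NormedAddCommGroup E] {h : ℝ → E}, Continuous h →
      eLpNorm h 2 volume ≤ ENNReal.ofReal e → MemLp h 2 volume := fun hc hb =>
    ⟨hc.aestronglyMeasurable, hb.trans_lt ENNReal.ofReal_lt_top⟩
  have hWb : ∀ x, ‖W x‖ ≤ 2 * e := fun x => by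
    have h1 := (pW.enorm_le_add x).trans (add_le_add eW eW')
    rw [← ENNReal.ofReal_add he0 he0, ← ofReal_norm,
      ENNReal.ofReal_le_ofReal_iff (by positivity)] at h1
    linarith
  have hW : ∀ x, ‖W x‖ ≤ a / 2 := fun x => (hWb x).trans (by linarith)
  obtain ⟨CT, hCT⟩ := pT.exists_bound (fin cT eT) mT'
  obtain ⟨CW', hCW'⟩ := pW'.exists_bound (fin cW' eW') mW''
  obtain ⟨CV, hCV⟩ := pV.exists_bound (fin cV eV) mV'
  have hCT0 : 0 ≤ CT := (norm_nonneg _).trans (hCT 0)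
  have hCW0 : 0 ≤ CW' := (norm_nonneg _).trans (hCW' 0)
  have hCV0 : 0 ≤ CV := (norm_nonneg _).trans (hCV 0)
  have hcar : ∀ x, ‖carrier a k θ x‖ = a := fun x => norm_carrier ha x
  have dc : ∀ x, HasDerivAt (carrier a k θ) ((k - T x) • (Complex.I * carrier a k θ x)) x :=
    hasDerivAt_carrier hθ
  obtain ⟨b', pb', lb'⟩ := isPrimitive_carrier_deriv (a := a) (k := k) hθ pT ha mT'
  have pc : IsPrimitive (carrier a k θ) fun x => (k - T x) • (Complex.I * carrier a k θ x) :=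
    IsPrimitive.of_hasDerivAt dc pb'.continuous
  have pu₁ : IsPrimitive (fun x => carrier a k θ x * (Complex.I * ω) + V x)
      (fun x => Complex.I * ω * ((k - T x) • (Complex.I * carrier a k θ x)) + V' x) := by
    have e : (fun x => carrier a k θ x * (Complex.I * ω) + V x) =
        fun x => Complex.I * ω * carrier a k θ x + V x := by
      ext x; ring
    rw [e]
    exact (pc.const_mul _).add pV
  have cb' := pb'.continuous
  obtain ⟨u, p, q, hw, hu0, hp0, hq0, hM, hsol⟩ := exists_wave_solution (contDiff_radial cF)
    (hasCompactSupport_radial sF) (u₀ := fun x => carrier a k θ x + W x)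
    (u₀' := fun x => (k - T x) • (Complex.I * carrier a k θ x) + W' x)
    (u₁ := fun x => carrier a k θ x * (Complex.I * ω) + V x)
    (fun x => (dc x).add (dW x)) (pb'.add pW') pu₁ (lb'.add fun r => mW''.restrict _)
    (LocL2.add (LocL2.of_continuous (cb'.const_mul _)) fun r => mV'.restrict _)
    (C := a * (1 + |k| + CT + |ω|) + a / 2 + CW' + CV)
    (fun x => by
      refine (norm_add_le _ _).trans ?_
      rw [hcar]
      have := hW x
      have : 0 ≤ a * (|k| + CT + |ω|) := by positivity
      linarith)
    (fun x => by
      refine (norm_add_le _ _).trans ?_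
      rw [norm_smul, norm_mul, Complex.norm_I, hcar, one_mul]
      have h1 : ‖k - T x‖ ≤ |k| + CT := (norm_sub_le _ _).trans (add_le_add le_rfl (hCT x))
      have h2 : ‖k - T x‖ * a ≤ (|k| + CT) * a := by gcongr
      have h3 : 0 ≤ a * |ω| := by positivity
      linarith [hCW' x])
    (fun x => by
      refine (norm_add_le _ _).trans ?_
      rw [norm_mul, norm_mul, Complex.norm_I, hcar, one_mul, Complex.norm_real, Real.norm_eq_abs]
      have h3 : 0 ≤ a * (|k| + CT) := by positivity
      linarith [hCV x])
  have hclose : ∀ x, |relMod a u 0 x - 1| ≤ ε := fun x => by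
    rw [relMod, hu0]
    refine (abs_norm_sq_div_sub_one_le ha (hcar x) (hW x)).trans ?_
    rw [div_mul_eq_mul_div, div_le_iff₀ ha]
    linarith [hWb x]
  have hquad : ∀ l r, l ≤ r → ∫ x in l..r, quadDensity a k ω u p q 0 x ≤ 4 * Kd * e ^ 2 := by
    intro l r hlr
    have i : ∀ {E : Type} [NormedAddCommGroup E] {h : ℝ → E}, Continuous h →
        IntervalIntegrable (fun x => ‖h x‖ ^ 2) volume l r := fun hc =>
      Continuous.intervalIntegrable (by fun_prop) _ _
    have cq : Continuous fun x => quadDensity a k ω u p q 0 x := by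
      have m : ∀ v ∈ ({0} : Set ℝ) ×ˢ (univ : Set ℝ), u v.1 v.2 ≠ 0 := fun v hv => by
        rw [show v.1 = 0 from hv.1]
        intro h0
        have := hclose v.2
        rw [relMod, h0] at this
        norm_num at this
        linarith
      have h1 := hw.continuousOn_quadDensity (a := a) (k := k) (ω := ω) m
      exact h1.comp_continuous (f := fun x : ℝ => ((0 : ℝ), x)) (by fun_prop)
        fun x => ⟨rfl, mem_univ _⟩
    have h1 : ∫ x in l..r, quadDensity a k ω u p q 0 x ≤
        ∫ x in l..r, Kd * (‖V x‖ ^ 2 + ‖W' x‖ ^ 2 + ‖T x‖ ^ 2 + ‖W x‖ ^ 2) := by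
      refine intervalIntegral.integral_mono_on hlr (cq.intervalIntegrable _ _)
        (Continuous.intervalIntegrable (by fun_prop) _ _) fun x _ => ?_
      have := quadDensity_zero_le (k := k) (ω := ω) ha hu0 hp0 hq0 (hW x)
      rw [Real.norm_eq_abs, sq_abs]
      exact this
    rw [intervalIntegral.integral_const_mul,
      intervalIntegral.integral_add (((i cV).add (i cW')).add (i cT)) (i cW),
      intervalIntegral.integral_add ((i cV).add (i cW')) (i cT),
      intervalIntegral.integral_add (i cV) (i cW')] at h1
    have b1 := integral_sq_le_of_eLpNorm_le cV he0 eV l r hlr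
    have b2 := integral_sq_le_of_eLpNorm_le cW' he0 eW' l r hlr
    have b3 := integral_sq_le_of_eLpNorm_le cT he0 eT l r hlr
    have b4 := integral_sq_le_of_eLpNorm_le cW he0 eW l r hlr
    refine h1.trans ?_
    calc _ ≤ Kd * (e ^ 2 + e ^ 2 + e ^ 2 + e ^ 2) := by gcongr
      _ = _ := by ring
  have hst := hstab u p q hw
    (fun T hT => (hM T hT).imp fun M h t ht => h t (by rw [abs_of_nonneg ht.1]; exact ht.2))
    hclose _ he4 hquad
  refine ⟨_, u, p, q, hw, hu0, hW, hM 1 zero_le_one,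
    fun t ht x => ((hst t ht).1 x).trans hε4, fun t ht l r hlr => ?_,
    fun U₀ U₁ h0 h1 => hsol f U₀ U₁ (fun t ht x => ?_) h0 h1⟩
  · refine ((hst t ht).2 l r hlr).trans (le_of_eq ?_)
    rw [mul_pow, Real.sq_sqrt (by positivity)]
    ring
  -- Stability keeps ||u|² - a²| ≤ a²/4, exactly where the truncated and the original nonlinearity
  -- coincide.
  · rw [hF]
    have h1 := ((hst t ht).1 x).trans hε4
    rw [relMod] at h1
    have e1 : ‖u t x‖ ^ 2 - a ^ 2 = (‖u t x‖ ^ 2 / a ^ 2 - 1) * a ^ 2 := by field_simp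
    rw [e1, abs_mul, abs_of_pos (by positivity : 0 < a ^ 2)]
    calc _ ≤ 1 / 4 * a ^ 2 := by gcongr
      _ = _ := by ring

end Main

end KleinGordon
theorem theorem1p3 (f : ℝ → ℝ) (hf : ContDiffOn ℝ 2 f (Set.Ici 0))
    (a k ω : ℝ) (ha : 0 < a) (hkω : (k, ω) ≠ (0, 0))
    (hdisp : ω ^ 2 = k ^ 2 + f (a ^ 2))
    (hspec : 2 * max 0 (-f (a ^ 2)) < a ^ 2 * deriv f (a ^ 2))
    (R : ℝ) (hR : 0 < R) :
    ∃ C δ : ℝ≥0, 0 < C ∧ 0 < δ ∧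
      ∀ θ : ℝ → ℝ, Admissible f a θ → phaseSize f a θ ≤ δ →
      ∀ w₀ v₀ : ℝ → ℂ, MemH 2 Set.univ w₀ → MemH 1 Set.univ v₀ →
        dataSize w₀ v₀ ≤ δ →
      ∃ u : ℝ → ℝ → ℂ,
        IsClassicalSolution f
          (fun x => a * Complex.exp (Complex.I * (k * x - θ x)) + w₀ x)
          (fun x => a * Complex.exp (Complex.I * (k * x - θ x)) * (Complex.I * ω) + v₀ x) u ∧
        -- uniqueness, for functions of `x` up to null sets
        (∀ u' : ℝ → ℝ → ℂ,
          IsClassicalSolution f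
            (fun x => a * Complex.exp (Complex.I * (k * x - θ x)) + w₀ x)
            (fun x => a * Complex.exp (Complex.I * (k * x - θ x)) * (Complex.I * ω) + v₀ x) u' →
          ∀ t, 0 ≤ t → u' t =ᵐ[volume] u t) ∧
        -- local orbital stability
        (∀ xs t : ℝ, 0 ≤ t → ∃ γ : ℝ,
          hNorm 1 (Set.Ioo (xs - R) (xs + R))
              (fun x => u t x - a * Complex.exp (Complex.I * (k * x + ω * t + γ))) ≤
            C * (dataSize w₀ v₀ + phaseSize f a θ)) ∧
        -- bounds on phase and radius
        ∃ ϱ ϑ : ℝ → ℝ → ℝ,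
          ContDiffOn ℝ 1 (fun p : ℝ × ℝ => ϱ p.2 p.1) (Set.univ ×ˢ Set.Ici 0) ∧
          ContDiffOn ℝ 1 (fun p : ℝ × ℝ => ϑ p.2 p.1) (Set.univ ×ˢ Set.Ici 0) ∧
          (∀ x t : ℝ, 0 ≤ t →
            u t x = a * Complex.exp (Complex.I * (k * x + ω * t - θ x)) *
              Complex.exp (ϱ t x + Complex.I * ϑ t x)) ∧
          ∀ t : ℝ, 0 ≤ t →
            MemH 1 Set.univ (ϱ t) ∧ MemH 1 Set.univ (ϑ t) ∧
            MemLp (fun x => derivWithin (fun s => ϱ s x) (Set.Ici 0) t) 2 ∧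
            MemLp (fun x => derivWithin (fun s => ϑ s x) (Set.Ici 0) t) 2 ∧
            eLpNorm (fun x => derivWithin (fun s => ϱ s x) (Set.Ici 0) t) 2 +
                eLpNorm (fun x => derivWithin (fun s => ϑ s x) (Set.Ici 0) t) 2 +
                hNorm 1 Set.univ (ϱ t) +
                eLpNorm (deriv (ϑ t)) 2 ≤
              C * (dataSize w₀ v₀ + phaseSize f a θ) ∧
            eLpNorm (ϑ t) 2 ≤
              C * (dataSize w₀ v₀ + phaseSize f a θ) *
                ENNReal.ofReal (t + 1) := by
  obtain ⟨κ, hκ, e₀, he₀, hmain⟩ := exists_stable_wave hf ha hkω hdisp hspec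
  set CR := a * (2 + √R * √(2 * R)) * (1 + |k|) + 2 * a with hCR
  have hCR0 : 0 ≤ CR := by positivity
  -- The sum of the constants of the three estimates (radius and phase derivatives, growth of the
  -- phase, orbital stability), so that one C serves all.
  set C := 5 * κ + 1 + (3 / (2 * a) + κ) + CR * κ with hC
  have hC0 : 0 < C := by positivity
  obtain ⟨C', hC'⟩ : ∃ C' : ℝ≥0, (C' : ℝ) = C := ⟨⟨C, hC0.le⟩, rfl⟩
  -- Half of e₀, because the two sizes are each at most δ and their sum e must not exceed e₀.
  obtain ⟨δ, hδ⟩ : ∃ δ : ℝ≥0, (δ : ℝ) = e₀ / 2 := ⟨⟨e₀ / 2, by positivity⟩, rfl⟩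
  refine ⟨C', δ, NNReal.coe_pos.1 (by rw [hC']; exact hC0),
    NNReal.coe_pos.1 (by rw [hδ]; exact half_pos he₀), ?_⟩
  intro θ hθ hE w₀ v₀ hw₀ hv₀ hD
  rw [← ENNReal.ofReal_coe_nnreal, hδ] at hE hD
  obtain ⟨dθ, T', pT, mT, mT'⟩ := hθ.exists_isPrimitive
  obtain ⟨W, W', W'', dW, pW', eqW, mW, mW', mW'', nW, nW'⟩ := exists_representative hw₀
  obtain ⟨V, V', pV, eqV, mV, mV'⟩ := exists_isPrimitive_of_memH_one hv₀
  set S := dataSize w₀ v₀ + phaseSize f a θ with hS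
  have hSle : S ≤ ENNReal.ofReal e₀ := by
    refine (add_le_add hD hE).trans (le_of_eq ?_)
    rw [← ENNReal.ofReal_add (by positivity) (by positivity), add_halves]
  have hSfin : S ≠ ⊤ := ne_top_of_le_ne_top ENNReal.ofReal_ne_top hSle
  obtain ⟨e, he, hSe⟩ : ∃ e : ℝ, 0 ≤ e ∧ S = ENNReal.ofReal e :=
    ⟨S.toReal, ENNReal.toReal_nonneg, (ENNReal.ofReal_toReal hSfin).symm⟩
  have hee : e ≤ e₀ := by
    rw [hSe] at hSle
    exact (ENNReal.ofReal_le_ofReal_iff he₀.le).1 hSle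
  have hCS : ∀ c, c ≤ C * e →
      ENNReal.ofReal c ≤ (C' : ℝ≥0∞) * S := fun c hc => by
    rw [hSe, ← ENNReal.ofReal_coe_nnreal, hC', ← ENNReal.ofReal_mul hC0.le]
    exact ENNReal.ofReal_le_ofReal hc
  have eT : eLpNorm (deriv θ) 2 volume ≤ ENNReal.ofReal e := by
    rw [← hSe]
    exact le_self_add.trans le_add_self
  have hdat : hNorm 1 Set.univ w₀ ≤ ENNReal.ofReal e := by
    rw [← hSe]
    exact le_self_add.trans le_self_add
  have eV : eLpNorm V 2 volume ≤ ENNReal.ofReal e := by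
    rw [← eLpNorm_congr_ae eqV, ← hSe]
    exact le_add_self.trans le_self_add
  have eW := nW.trans hdat
  have eW' := nW'.trans hdat
  obtain ⟨g, u, p, q, hw, hu0, hWb, ⟨M, hM⟩, hmod, hquad, hsol⟩ :=
    hmain θ (deriv θ) T' W W' W'' V V' e he hee dθ pT mT' dW pW' mW'' pV mV' eT eW eW' eV
  have hB0 : 0 ≤ κ * e := by positivity
  have cW : Continuous W := continuous_iff_continuousAt.2 fun x => (dW x).continuousAt
  have hlow : ∀ t, 0 ≤ t → ∀ x, a / 2 ≤ ‖u t x‖ := fun t ht x => by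
    have h1 := (abs_le.1 (hmod t ht x)).1
    rw [relMod] at h1
    have h2 : 1 / 2 ≤ ‖u t x‖ ^ 2 / a ^ 2 := by linarith
    rw [le_div_iff₀ (by positivity)] at h2
    refine le_of_sq_le_sq ?_ (norm_nonneg _)
    nlinarith
  obtain ⟨z, dt, dx, cz, hexp, hz⟩ := hw.exists_polar (k := k) (ω := ω) ha hM hlow dθ
    pT.continuous cW hu0 hWb
  have hcl : IsClassicalSolution f
      (fun x => a * Complex.exp (Complex.I * (k * x - θ x)) + w₀ x)
      (fun x => a * Complex.exp (Complex.I * (k * x - θ x)) * (Complex.I * ω) + v₀ x) u := by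
    refine hsol _ _ ?_ ?_
    · filter_upwards [eqW] with x hx
      rw [hx, carrier]
    · filter_upwards [eqV] with x hx
      rw [hx, carrier]
  have hbd := fun t (ht : 0 ≤ t) => hw.polar_bounds ha ht hmod hB0 hquad pT.continuous cW hWb he
    eW eT dt dx hexp hz
  have b1 : 0 ≤ (3 / (2 * a) + κ) * e := by positivity
  have b2 : 0 ≤ CR * κ * e := by positivity
  have b3 : 0 ≤ (5 * κ + 1) * e := by positivity
  refine ⟨u, hcl, fun u' hu' t ht => hu'.ae_eq hf hcl t ht, fun xs t ht => ?_,
    fun t x => (z t x).re, fun t x => (z t x).im, Complex.reCLM.contDiff.comp_contDiffOn cz,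
    Complex.imCLM.contDiff.comp_contDiffOn cz, fun x t ht => ?_, fun t ht => ?_⟩
  · obtain ⟨-, -, -, -, -, -, eR, hre⟩ := hbd t ht
    obtain ⟨γ, hγ⟩ := hw.orbital_bound ha (hmod t ht) hB0 (hquad t ht) dθ (dx t ht) (hexp t ht)
      eR hre hR xs
    refine ⟨γ, hγ.trans (hCS _ ?_)⟩
    rw [← hCR, hC]
    linear_combination b1 + b3
  · rw [hexp t ht x, carrier, mul_assoc, mul_assoc, mul_assoc, ← Complex.exp_add,
      ← Complex.exp_add, ← Complex.exp_add]
    congr 2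
    have e3 : z t x = (z t x).re + Complex.I * (z t x).im := by
      rw [mul_comm]; exact (Complex.re_add_im (z t x)).symm
    linear_combination e3
  · obtain ⟨h1, h2, h3, h4, h5, h6, -, -⟩ := hbd t ht
    refine ⟨h1, h2, h3, h4, h5.trans (hCS _ ?_), h6.trans ?_⟩
    · rw [hC]
      linear_combination b1 + b2
    · gcongr
      refine hCS _ ?_
      rw [hC]
      linear_combination b3 + b2
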